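/- Let $K$ be a field. Algebras over $K$ are associative, with or without unit, and have a non-degenerate product; $M(A)$ denotes the multiplier algebra of $A$. A multiplier Hopf algebra is an algebra $A$ with a coassociative homomorphism $\Delta:A\to M(A\otimes A)$ such that $a\otimes b\mapsto\Delta(a)(1\otimes b)$ and $a\otimes b\mapsto(a\otimes1)\Delta(b)$ are bijections of $A\otimes A$ onto $A\otimes A$; it is regular if $(A,\Delta^{cop})$, where $\Delta^{cop}$ is $\Delta$ followed by the flip, is a multiplier Hopf algebra as well. We write $\varepsilon$ and $S$ for its counit and its (bijective) antipode, and $\Delta(a)=\sum a_{(1)}\otimes a_{(2)}$. A pairing of regular multiplier Hopf algebras $A$ and $B$ is a non-degenerate bilinear form $\langle\cdot,\cdot\rangle:A\times B\to K$ such that the multipliers $b\blacktriangleright a=\sum\langle a_{(2)},b\rangle a_{(1)}$ and $a\blacktriangleleft b=\sum\langle a_{(1)},b\rangle a_{(2)}$ of $A$ belong to $A$, the multipliers $a\blacktriangleright b=\sum\langle a,b_{(2)}\rangle b_{(1)}$ and $b\blacktriangleleft a=\sum\langle a,b_{(1)}\rangle b_{(2)}$ of $B$ belong to $B$, and $\langle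 a,bb'\rangle=\langle b'\blacktriangleright a,b\rangle=\langle a\blacktriangleleft b,b'\rangle$, $\langle aa',b\rangle=\langle a,a'\blacktriangleright b\rangle=\langle a',b\blacktriangleleft a\rangle$ for all $a,a'\in A$, $b,b'\in B$. **Theorem.** Let $A$ and $B$ be non-zero regular multiplier Hopf algebras with a pairing. Let $\mathrm{Aut}_{Hopf}(B)$ be the group of algebra automorphisms $\alpha$ of $B$ with $\Delta\circ\alpha=(\alpha\otimes\alpha)\circ\Delta$, and let $G=\mathrm{Aut}_{Hopf}(B)\times\mathrm{Aut}_{Hopf}(B)$ with the product $(\alpha,\beta)*(\gamma,\delta)=(\alpha\gamma,\delta\gamma^{-1}\beta\gamma)$, which is a group with $(\alpha,\beta)^{-1}=(\alpha^{-1},\alpha\beta^{-1}\alpha^{-1})$. For $p=(\alpha,\beta)\in G$ there is a unique linear map $T_p:B\otimes A\to A\otimes B$ given by $$T_p(b\otimes a)=\sum\bigl(\alpha(b_{(1)})\blacktriangleright a\blacktriangleleft S^{-1}\beta(b_{(3)})\bigr)\otimes b_{(2)},$$ that is, with $$T_p\bigl(b\otimes(e\blacktriangleright a)\bigr)(1\otimes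 b')=\sum\bigl(\alpha(b_{(1)}\alpha^{-1}(e))\blacktriangleright a\blacktriangleleft S^{-1}\beta(b_{(3)})\bigr)\otimes b_{(2)}b'$$ for all $a\in A$ and $b,b',e\in B$. Let $A\bowtie B_p$ be the space $A\otimes B$, with elements $a\bowtie b=a\otimes b$ and the product $$(a\bowtie b)(a'\bowtie b')=(a\otimes1)\,T_p(b\otimes a')\,(1\otimes b')=\sum a\bigl(\alpha(b_{(1)})\blacktriangleright a'\blacktriangleleft S^{-1}\beta(b_{(3)})\bigr)\bowtie b_{(2)}b'.$$ Then each $A\bowtie B_p$ is an associative algebra with non-degenerate product, and the direct sum of algebras $D(A,B)=\bigoplus_{p\in G}A\bowtie B_p$ is a regular multiplier Hopf algebra $(D(A,B),\Delta)$ that is $G$-cograded with the components $A\bowtie B_p$. The latter means that the $A\bowtie B_p$ are non-zero subalgebras, that $D(A,B)$ is their direct sum, that $(A\bowtie B_p)(A\bowtie B_q)=0$ for $p\ne q$, and that $$\Delta(A\bowtie B_{p*q})(1\otimes A\bowtie B_q)=A\bowtie B_p\otimes A\bowtie B_q=(A\bowtie B_p\otimes1)\Delta(A\bowtie B_{p*q})\qquad(p,q\in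 G).$$ Its structure maps are as follows. * Comultiplication: for $p=(\alpha,\beta)$ and $q=(\gamma,\delta)$, the component in $M(A\bowtie B_p\otimes A\bowtie B_q)$ of $\Delta(a\bowtie b)$, for $a\bowtie b\in A\bowtie B_{p*q}$, is $$\Delta_{p,q}(a\bowtie b)=\Delta^{cop}(a)\,(\gamma\otimes\gamma^{-1}\beta\gamma)\Delta(b).$$ Here $M(A\otimes A)$ and $M(B\otimes B)$ are embedded in $M(A\bowtie B_p\otimes A\bowtie B_q)$ through $a\mapsto a\bowtie1$ and $b\mapsto1\bowtie b$. The components at $(p,q)$ of $\Delta(x)$ for $x\in A\bowtie B_r$ with $r\ne p*q$ are $0$. * Counit: $\varepsilon(a\bowtie b)=\varepsilon_A(a)\varepsilon_B(b)$ on $A\bowtie B_{(\iota,\iota)}$, and $\varepsilon=0$ on $A\bowtie B_p$ for $p\neq(\iota,\iota)$. * Antipode: $S$ maps $A\bowtie B_{(\alpha,\beta)}$ to $A\bowtie B_{(\alpha,\beta)^{-1}}$ by $$S(a\bowtie b)=T_{(\alpha,\beta)^{-1}}\bigl(\alpha\beta S_B(b)\otimes S_A^{-1}(a)\bigr).$$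 -/

import Mathlib

open scoped TensorProduct

noncomputable section

namespace MHA

universe u v w x

/-- An associative algebra over `K`, possibly without unit, on the vector space `V`. -/
structure NUAlgebra (K : Type u) (V : Type v) [Field K] [AddCommGroup V] [Module K V] where
  mul : V →ₗ[K] V →ₗ[K] V
  assoc : ∀ x y z : V, mul (mul x y) z = mul x (mul y z)

namespace NUAlgebra

variable {K : Type u} [Field K]
variable {V : Type v} [AddCommGroup V] [Module K V]
variable {W : Type w} [AddCommGroup W] [Module K W]

/-- The product, viewed as a bilinear form, is non-degenerate. -/
def Nondegenerate (R : NUAlgebra K V) : Prop :=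
  (∀ x, (∀ y, R.mul x y = 0) → x = 0) ∧ (∀ x, (∀ y, R.mul y x = 0) → x = 0)

/-- The tensor product algebra, `(x ⊗ y)(x' ⊗ y') = xx' ⊗ yy'`. -/
def tensor (R : NUAlgebra K V) (S : NUAlgebra K W) : NUAlgebra K (V ⊗[K] W) where
  mul := TensorProduct.map₂ R.mul S.mul
  assoc := by
    intro x y z
    induction x with
    | zero => simp
    | add x₁ x₂ h₁ h₂ => simp only [map_add, LinearMap.add_apply, h₁, h₂]
    | tmul a b =>
      induction y with
      | zero => simp
      | add x₁ x₂ h₁ h₂ => simp only [map_add, LinearMap.add_apply, h₁, h₂]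
      | tmul c d =>
        induction z with
        | zero => simp
        | add x₁ x₂ h₁ h₂ => simp only [map_add, h₁, h₂]
        | tmul e f => simp [TensorProduct.map₂_apply_tmul, R.assoc, S.assoc]

/-- The multiplier algebra `M(R)`: a multiplier `m` is a pair of linear maps, `y ↦ m y` (first
component) and `x ↦ x m` (second component), such that `x (m y) = (x m) y`. Products are
`(m n) y = m (n y)` and `x (m n) = (x m) n`, which is why the second component lives in the
opposite of the endomorphism algebra. -/
def M (R : NUAlgebra K V) : Subalgebra K (Module.End K V × (Module.End K V)ᵐᵒᵖ) where
  carrier := {m | ∀ x y, R.mul x (m.1 y) = R.mul (m.2.unop x) y}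
  mul_mem' := by
    intro m n hm hn x y
    simp only [Set.mem_ofPred_eq] at hm hn
    simp [hm, hn]
  add_mem' := by
    intro m n hm hn x y
    simp only [Set.mem_ofPred_eq] at hm hn
    simp [hm, hn]
  algebraMap_mem' := by
    intro r x y
    simp [Module.algebraMap_end_apply, Prod.algebraMap_apply, MulOpposite.algebraMap_apply]

/-- The left action `y ↦ m y` of a multiplier. -/
def M.left {R : NUAlgebra K V} (m : R.M) : V →ₗ[K] V := m.1.1

/-- The right action `x ↦ x m` of a multiplier. -/
def M.right {R : NUAlgebra K V} (m : R.M) : V →ₗ[K] V := m.1.2.unop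

theorem M.ext {R : NUAlgebra K V} {m n : R.M} (hl : ∀ y, M.left m y = M.left n y)
    (hr : ∀ x, M.right m x = M.right n x) : m = n :=
  Subtype.ext (Prod.ext (LinearMap.ext hl) (MulOpposite.unop_injective (LinearMap.ext hr)))

/-- The canonical map from an algebra to its multiplier algebra. -/
def of (R : NUAlgebra K V) : V →ₗ[K] R.M where
  toFun x := ⟨(R.mul x, MulOpposite.op (R.mul.flip x)), fun y z => (R.assoc y x z).symm⟩
  map_add' x y := by
    apply Subtype.ext
    simp [map_add]
  map_smul' c x := by
    apply Subtype.ext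
    simp

/-- The multiplier `m ⊗ n` of `R ⊗ S`. -/
def tmul {R : NUAlgebra K V} {S : NUAlgebra K W} (m : R.M) (n : S.M) : (R.tensor S).M :=
  ⟨(TensorProduct.map (M.left m) (M.left n),
      MulOpposite.op (TensorProduct.map (M.right m) (M.right n))), by
    intro x y
    induction x with
    | zero => simp
    | add x₁ x₂ h₁ h₂ => simp only [map_add, LinearMap.add_apply, h₁, h₂]
    | tmul a b =>
      induction y with
      | zero => simp
      | add x₁ x₂ h₁ h₂ => simp only [map_add, h₁, h₂]
      | tmul c d =>
        have h₁ := m.2 a c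
        have h₂ := n.2 b d
        simp only [tensor, M.left, M.right, TensorProduct.map_tmul, MulOpposite.unop_op,
          TensorProduct.map₂_apply_tmul, h₁, h₂]⟩

/-- The extension to multiplier algebras of an algebra isomorphism `e`:
`e(m) e(y) = e(m y)` and `e(x) e(m) = e(x m)`. -/
def congr {R : NUAlgebra K V} {S : NUAlgebra K W} (e : V ≃ₗ[K] W)
    (he : ∀ x y, e (R.mul x y) = S.mul (e x) (e y)) : R.M →ₗ[K] S.M where
  toFun m := ⟨(e.toLinearMap ∘ₗ M.left m ∘ₗ e.symm.toLinearMap,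
      MulOpposite.op (e.toLinearMap ∘ₗ M.right m ∘ₗ e.symm.toLinearMap)), by
    intro x y
    have h := congrArg e (m.2 (e.symm x) (e.symm y))
    rw [he, he] at h
    simpa [M.left, M.right] using h⟩
  map_add' m n := M.ext (fun y => by simp [M.left]) (fun y => by simp [M.right])
  map_smul' c m := M.ext (fun y => by simp [M.left]) (fun y => by simp [M.right])

theorem flip_mul (R : NUAlgebra K V) (S : NUAlgebra K W) (x y : V ⊗[K] W) :
    TensorProduct.comm K V W ((R.tensor S).mul x y)
      = (S.tensor R).mul (TensorProduct.comm K V W x) (TensorProduct.comm K V W y) := by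
  induction x with
  | zero => simp
  | add x₁ x₂ h₁ h₂ => simp only [map_add, LinearMap.add_apply, h₁, h₂]
  | tmul a b =>
    induction y with
    | zero => simp
    | add x₁ x₂ h₁ h₂ => simp only [map_add, h₁, h₂]
    | tmul c d => simp [tensor, TensorProduct.map₂_apply_tmul]

/-- The flip `τ : M(R ⊗ R) → M(R ⊗ R)`. -/
def flip (R : NUAlgebra K V) : (R.tensor R).M →ₗ[K] (R.tensor R).M :=
  congr (TensorProduct.comm K V V) (flip_mul R R)

theorem congr_mul (R : NUAlgebra K V) (e f : V ≃ₗ[K] V)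
    (he : ∀ x y, e (R.mul x y) = R.mul (e x) (e y))
    (hf : ∀ x y, f (R.mul x y) = R.mul (f x) (f y)) (x y : V ⊗[K] V) :
    TensorProduct.congr e f ((R.tensor R).mul x y)
      = (R.tensor R).mul (TensorProduct.congr e f x) (TensorProduct.congr e f y) := by
  induction x with
  | zero => simp
  | add x₁ x₂ h₁ h₂ => simp only [map_add, LinearMap.add_apply, h₁, h₂]
  | tmul a b =>
    induction y with
    | zero => simp
    | add x₁ x₂ h₁ h₂ => simp only [map_add, h₁, h₂]
    | tmul c d => simp [tensor, TensorProduct.map₂_apply_tmul, he, hf]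

end NUAlgebra

open NUAlgebra

section Hopf

variable {K : Type u} [Field K]
variable {V : Type v} [AddCommGroup V] [Module K V]

/-- `(R, Δ)` is a multiplier Hopf algebra: `R` is non-degenerate, `Δ : R → M(R ⊗ R)` is a
homomorphism, `T₁ (a ⊗ b) = Δ(a)(1 ⊗ b)` and `T₂ (a ⊗ b) = (a ⊗ 1)Δ(b)` have range in `R ⊗ R` and
are bijective from `R ⊗ R` to `R ⊗ R`, and `Δ` is coassociative,
`(a ⊗ 1 ⊗ 1)(Δ ⊗ ι)(Δ(b)(1 ⊗ c)) = (ι ⊗ Δ)((a ⊗ 1)Δ(b))(1 ⊗ 1 ⊗ c)`,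
the two sides being `(T₂ ⊗ ι)(ι ⊗ T₁)` and `(ι ⊗ T₁)(T₂ ⊗ ι)` at `a ⊗ b ⊗ c`. -/
structure IsMultiplierHopf (R : NUAlgebra K V) (Δ : V →ₗ[K] (R.tensor R).M) : Prop where
  nondegenerate : R.Nondegenerate
  comul_mul : ∀ a b, Δ (R.mul a b) = Δ a * Δ b
  exists_T : ∃ T₁ T₂ : (V ⊗[K] V) ≃ₗ[K] (V ⊗[K] V),
    (∀ a b, (R.tensor R).of (T₁ (a ⊗ₜ b)) = Δ a * tmul 1 (R.of b)) ∧
    (∀ a b, (R.tensor R).of (T₂ (a ⊗ₜ b)) = tmul (R.of a) 1 * Δ b) ∧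
    ∀ z : V ⊗[K] (V ⊗[K] V),
      T₂.toLinearMap.rTensor V ((TensorProduct.assoc K V V V).symm
          (T₁.toLinearMap.lTensor V z))
        = (TensorProduct.assoc K V V V).symm (T₁.toLinearMap.lTensor V
            (TensorProduct.assoc K V V V (T₂.toLinearMap.rTensor V
              ((TensorProduct.assoc K V V V).symm z))))

end Hopf

/-- A regular multiplier Hopf algebra on the vector space `V`: both `(R, Δ)` and `(R, τ ∘ Δ)` are
multiplier Hopf algebras. -/
structure RegularMHA (K : Type u) (V : Type v) [Field K] [AddCommGroup V] [Module K V] extends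
    NUAlgebra K V where
  comul : V →ₗ[K] (toNUAlgebra.tensor toNUAlgebra).M
  isMultiplierHopf : IsMultiplierHopf toNUAlgebra comul
  isMultiplierHopf_cop : IsMultiplierHopf toNUAlgebra (toNUAlgebra.flip ∘ₗ comul)

namespace RegularMHA

variable {K : Type u} [Field K]
variable {V : Type v} [AddCommGroup V] [Module K V]

/-- `T₁ (a ⊗ b) = Δ(a)(1 ⊗ b)`, as an element of `V ⊗ V`. -/
def T₁ (H : RegularMHA K V) : (V ⊗[K] V) ≃ₗ[K] (V ⊗[K] V) :=
  H.isMultiplierHopf.exists_T.choose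

/-- `T₂ (a ⊗ b) = (a ⊗ 1)Δ(b)`, as an element of `V ⊗ V`. -/
def T₂ (H : RegularMHA K V) : (V ⊗[K] V) ≃ₗ[K] (V ⊗[K] V) :=
  H.isMultiplierHopf.exists_T.choose_spec.choose

/-- `T₃ (a ⊗ b) = Δ(a)(b ⊗ 1)`, as an element of `V ⊗ V`. -/
def T₃ (H : RegularMHA K V) : (V ⊗[K] V) ≃ₗ[K] (V ⊗[K] V) :=
  H.isMultiplierHopf_cop.exists_T.choose.trans (TensorProduct.comm K V V)

theorem T₁_spec (H : RegularMHA K V) (a b : V) :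
    (H.tensor H.toNUAlgebra).of (H.T₁ (a ⊗ₜ b)) = H.comul a * tmul 1 (H.of b) :=
  H.isMultiplierHopf.exists_T.choose_spec.choose_spec.1 a b

theorem T₂_spec (H : RegularMHA K V) (a b : V) :
    (H.tensor H.toNUAlgebra).of (H.T₂ (a ⊗ₜ b)) = tmul (H.of a) 1 * H.comul b :=
  H.isMultiplierHopf.exists_T.choose_spec.choose_spec.2.1 a b

theorem flip_flip_mul_tmul (R : NUAlgebra K V) (m : (R.tensor R).M) (n n' : R.M) :
    R.flip (R.flip m * tmul n n') = m * tmul n' n := by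
  have key : ∀ (f g : V →ₗ[K] V) (z : V ⊗[K] V),
      TensorProduct.comm K V V (TensorProduct.map f g (TensorProduct.comm K V V z))
        = TensorProduct.map g f z := by
    intro f g z
    induction z with
    | zero => simp
    | add x y hx hy => simp only [map_add, hx, hy]
    | tmul x y => simp
  refine M.ext (fun y => ?_) (fun y => ?_)
  · have := key (M.left n) (M.left n') y
    simp_all [NUAlgebra.flip, NUAlgebra.congr, NUAlgebra.tmul, M.left, M.right]
  · have := key (M.right n) (M.right n') (M.right m y)
    simp_all [NUAlgebra.flip, NUAlgebra.congr, NUAlgebra.tmul, M.left, M.right]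

theorem flip_of (R : NUAlgebra K V) (x : V ⊗[K] V) :
    R.flip ((R.tensor R).of x) = (R.tensor R).of (TensorProduct.comm K V V x) :=
  M.ext (fun y => by simp [NUAlgebra.flip, NUAlgebra.congr, NUAlgebra.of, M.left, flip_mul])
    (fun y => by simp [NUAlgebra.flip, NUAlgebra.congr, NUAlgebra.of, M.right, flip_mul])

theorem T₃_spec (H : RegularMHA K V) (a b : V) :
    (H.tensor H.toNUAlgebra).of (H.T₃ (a ⊗ₜ b)) = H.comul a * tmul (H.of b) 1 := by
  have h := congrArg H.flip (H.isMultiplierHopf_cop.exists_T.choose_spec.choose_spec.1 a b)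
  rw [flip_of, LinearMap.comp_apply, flip_flip_mul_tmul] at h
  exact h

/-- `ε` is the counit: a homomorphism with `(ε ⊗ ι)(Δ(a)(1 ⊗ b)) = ab` and
`(ι ⊗ ε)((a ⊗ 1)Δ(b)) = ab`. It exists and is unique for every multiplier Hopf algebra. -/
structure IsCounit (H : RegularMHA K V) (ε : V →ₗ[K] K) : Prop where
  map_mul : ∀ a b, ε (H.mul a b) = ε a * ε b
  counit_left : ∀ a b, TensorProduct.lid K V (ε.rTensor V (H.T₁ (a ⊗ₜ b))) = H.mul a b
  counit_right : ∀ a b, TensorProduct.rid K V (ε.lTensor V (H.T₂ (a ⊗ₜ b))) = H.mul a b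

/-- The counit of a regular multiplier Hopf algebra. -/
def counit (H : RegularMHA K V) : V →ₗ[K] K := Classical.epsilon H.IsCounit

/-- `S` is the antipode: a bijective anti-homomorphism with
`m(S ⊗ ι)(Δ(a)(1 ⊗ b)) = ε(a)b` and `m(ι ⊗ S)((a ⊗ 1)Δ(b)) = ε(b)a`. It exists and is unique for
every regular multiplier Hopf algebra. -/
structure IsAntipode (H : RegularMHA K V) (S : V ≃ₗ[K] V) : Prop where
  map_mul : ∀ a b, S (H.mul a b) = H.mul (S b) (S a)
  antipode_left : ∀ a b,
    TensorProduct.lift H.mul (S.toLinearMap.rTensor V (H.T₁ (a ⊗ₜ b))) = H.counit a • b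
  antipode_right : ∀ a b,
    TensorProduct.lift H.mul (S.toLinearMap.lTensor V (H.T₂ (a ⊗ₜ b))) = H.counit b • a

/-- The antipode of a regular multiplier Hopf algebra. -/
def antipode (H : RegularMHA K V) : V ≃ₗ[K] V :=
  @Classical.epsilon _ ⟨LinearEquiv.refl K V⟩ H.IsAntipode

/-- The group `Aut_Hopf(H)` of algebra automorphisms `α` with `Δ(α(a)) = (α ⊗ α)(Δ(a))`, where
`α ⊗ α` is extended to `M(H ⊗ H)`, so that `(α ⊗ α)(m) (α ⊗ α)(z) = (α ⊗ α)(m z)` and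
`(α ⊗ α)(z) (α ⊗ α)(m) = (α ⊗ α)(z m)`. -/
def hopfAut (H : RegularMHA K V) : Subgroup (V ≃ₗ[K] V) where
  carrier := {α | (∀ x y, α (H.mul x y) = H.mul (α x) (α y)) ∧
    ∀ a z, M.left (H.comul (α a)) (TensorProduct.congr α α z)
          = TensorProduct.congr α α (M.left (H.comul a) z) ∧
        M.right (H.comul (α a)) (TensorProduct.congr α α z)
          = TensorProduct.congr α α (M.right (H.comul a) z)}
  mul_mem' := by
    rintro α β ⟨hα, hα'⟩ ⟨hβ, hβ'⟩
    have key : ∀ z, TensorProduct.congr (α * β) (α * β) z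
        = TensorProduct.congr α α (TensorProduct.congr β β z) := by
      intro z
      induction z with
      | zero => simp
      | add x y hx hy => simp only [map_add, hx, hy]
      | tmul x y => simp
    refine ⟨fun x y => by simp [hα, hβ], fun a z => ?_⟩
    rw [key, key, key, LinearEquiv.mul_apply, (hα' _ _).1, (hα' _ _).2, (hβ' _ _).1, (hβ' _ _).2]
    exact ⟨rfl, rfl⟩
  one_mem' := by
    have key : ∀ z : V ⊗[K] V,
        TensorProduct.congr (1 : V ≃ₗ[K] V) (1 : V ≃ₗ[K] V) z = z := by
      intro z
      induction z with
      | zero => simp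
      | add x y hx hy => simp only [map_add, hx, hy]
      | tmul x y => simp
    refine ⟨fun x y => rfl, fun a z => ?_⟩
    rw [key, key, key]
    exact ⟨rfl, rfl⟩
  inv_mem' := by
    rintro α ⟨hα, hα'⟩
    have key : ∀ z : V ⊗[K] V,
        TensorProduct.congr α α (TensorProduct.congr α⁻¹ α⁻¹ z) = z := by
      intro z
      induction z with
      | zero => simp
      | add x y hx hy => simp only [map_add, hx, hy]
      | tmul x y => simp
    have key' : ∀ x, α (α⁻¹ x) = x := fun x => by simp
    refine ⟨fun x y => α.injective (by simp only [hα, key']), fun a z => ⟨?_, ?_⟩⟩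
    · apply (TensorProduct.congr α α).injective
      rw [← (hα' _ _).1, key, key, key']
    · apply (TensorProduct.congr α α).injective
      rw [← (hα' _ _).2, key, key, key']

/-- `H` is a `G`-cograded multiplier Hopf algebra with respect to the family of non-trivial
subalgebras `𝒜 p`: `H = ⨁ 𝒜 p`, `𝒜 p 𝒜 q = 0` for `p ≠ q`, `Δ(𝒜 (pq))(1 ⊗ 𝒜 q) = 𝒜 p ⊗ 𝒜 q` and
`(𝒜 p ⊗ 1)Δ(𝒜 (pq)) = 𝒜 p ⊗ 𝒜 q`. -/
structure IsCograded {G : Type w} [Group G] (H : RegularMHA K V) (𝒜 : G → Submodule K V) :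
    Prop where
  nontrivial : ∀ p, 𝒜 p ≠ ⊥
  mul_mem : ∀ p, ∀ x ∈ 𝒜 p, ∀ y ∈ 𝒜 p, H.mul x y ∈ 𝒜 p
  isInternal : open Classical in DirectSum.IsInternal 𝒜
  mul_eq_zero : ∀ p q, p ≠ q → ∀ x ∈ 𝒜 p, ∀ y ∈ 𝒜 q, H.mul x y = 0
  comul_right : ∀ p q,
    Submodule.map H.T₁.toLinearMap (LinearMap.range (TensorProduct.mapIncl (𝒜 (p * q)) (𝒜 q)))
      = LinearMap.range (TensorProduct.mapIncl (𝒜 p) (𝒜 q))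
  comul_left : ∀ p q,
    Submodule.map H.T₂.toLinearMap (LinearMap.range (TensorProduct.mapIncl (𝒜 p) (𝒜 (p * q))))
      = LinearMap.range (TensorProduct.mapIncl (𝒜 p) (𝒜 q))

/-- A pair `(α, β)` of Hopf automorphisms of `H`. -/
@[ext]
structure AutPair (H : RegularMHA K V) where
  fst : H.hopfAut
  snd : H.hopfAut

/-- The group `Aut_Hopf(H) × Aut_Hopf(H)` with the twisted product
`(α, β) * (γ, δ) = (αγ, δγ⁻¹βγ)`. -/
instance (H : RegularMHA K V) : Group H.AutPair where
  mul p q := ⟨p.fst * q.fst, q.snd * q.fst⁻¹ * p.snd * q.fst⟩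
  one := ⟨1, 1⟩
  inv p := ⟨p.fst⁻¹, p.fst * p.snd⁻¹ * p.fst⁻¹⟩
  mul_assoc p q r := by
    apply AutPair.ext
    · exact mul_assoc _ _ _
    · change r.snd * r.fst⁻¹ * (q.snd * q.fst⁻¹ * p.snd * q.fst) * r.fst
        = (r.snd * r.fst⁻¹ * q.snd * r.fst) * (q.fst * r.fst)⁻¹ * p.snd * (q.fst * r.fst)
      group
  one_mul p := by
    apply AutPair.ext
    · exact one_mul _
    · change p.snd * p.fst⁻¹ * 1 * p.fst = p.snd
      group
  mul_one p := by
    apply AutPair.ext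
    · exact mul_one _
    · change 1 * 1⁻¹ * p.snd * 1 = p.snd
      group
  inv_mul_cancel p := by
    apply AutPair.ext
    · exact inv_mul_cancel _
    · change p.snd * p.fst⁻¹ * (p.fst * p.snd⁻¹ * p.fst⁻¹) * p.fst = 1
      group

/-- For Hopf automorphisms `γ` and `σ` of `H`, the multiplier `(γ ⊗ σ)(Δ(b))` of `H ⊗ H`, where
`γ ⊗ σ` is extended to `M(H ⊗ H)`. -/
def twistedComul (H : RegularMHA K V) (γ σ : H.hopfAut) (b : V) :
    (H.tensor H.toNUAlgebra).M :=
  congr (TensorProduct.congr γ.1 σ.1) (congr_mul H.toNUAlgebra γ.1 σ.1 γ.2.1 σ.2.1) (H.comul b)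

end RegularMHA

/-- A pairing of two regular multiplier Hopf algebras `𝒜` and `ℬ`: a non-degenerate bilinear form
`⟨a, b⟩` such that the multipliers
`b ▶ a = ∑ ⟨a₍₂₎, b⟩ a₍₁₎`, `a ◀ b = ∑ ⟨a₍₁₎, b⟩ a₍₂₎` of `𝒜` and
`a ▶ b = ∑ ⟨a, b₍₂₎⟩ b₍₁₎`, `b ◀ a = ∑ ⟨a, b₍₁₎⟩ b₍₂₎` of `ℬ` belong to `𝒜` and `ℬ` respectively,
and such that the coproduct of each algebra is dual to the product of the other one. -/
structure Pairing {K : Type u} {A : Type v} {B : Type w} [Field K] [AddCommGroup A] [Module K A]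
    [AddCommGroup B] [Module K B] (𝒜 : RegularMHA K A) (ℬ : RegularMHA K B) where
  form : A →ₗ[K] B →ₗ[K] K
  nondegenerate_left : ∀ a, (∀ b, form a b = 0) → a = 0
  nondegenerate_right : ∀ b, (∀ a, form a b = 0) → b = 0
  /-- `lactA b a` is `b ▶ a`. -/
  lactA : B →ₗ[K] A →ₗ[K] A
  /-- `ractA a b` is `a ◀ b`. -/
  ractA : A →ₗ[K] B →ₗ[K] A
  /-- `lactB a b` is `a ▶ b`. -/
  lactB : A →ₗ[K] B →ₗ[K] B
  /-- `ractB b a` is `b ◀ a`. -/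
  ractB : B →ₗ[K] A →ₗ[K] B
  lactA_spec : ∀ b a a', 𝒜.mul (lactA b a) a'
    = TensorProduct.rid K A ((form.flip b).lTensor A (𝒜.T₃ (a ⊗ₜ a')))
  ractA_spec : ∀ a b a', 𝒜.mul (ractA a b) a'
    = TensorProduct.lid K A ((form.flip b).rTensor A (𝒜.T₁ (a ⊗ₜ a')))
  lactB_spec : ∀ a b b', ℬ.mul (lactB a b) b'
    = TensorProduct.rid K B ((form a).lTensor B (ℬ.T₃ (b ⊗ₜ b')))
  ractB_spec : ∀ b a b', ℬ.mul (ractB b a) b'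
    = TensorProduct.lid K B ((form a).rTensor B (ℬ.T₁ (b ⊗ₜ b')))
  /-- `⟨a, bb'⟩ = ∑ ⟨a₍₁₎, b⟩⟨a₍₂₎, b'⟩`, with the sum read as `⟨b' ▶ a, b⟩`. -/
  form_mul_right : ∀ a b b', form a (ℬ.mul b b') = form (lactA b' a) b
  /-- `⟨a, bb'⟩ = ∑ ⟨a₍₁₎, b⟩⟨a₍₂₎, b'⟩`, with the sum read as `⟨a ◀ b, b'⟩`. -/
  form_mul_right' : ∀ a b b', form a (ℬ.mul b b') = form (ractA a b) b'
  /-- `⟨aa', b⟩ = ∑ ⟨a, b₍₁₎⟩⟨a', b₍₂₎⟩`, with the sum read as `⟨a, a' ▶ b⟩`. -/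
  form_mul_left : ∀ a a' b, form (𝒜.mul a a') b = form a (lactB a' b)
  /-- `⟨aa', b⟩ = ∑ ⟨a, b₍₁₎⟩⟨a', b₍₂₎⟩`, with the sum read as `⟨a', b ◀ a⟩`. -/
  form_mul_left' : ∀ a a' b, form (𝒜.mul a a') b = form a' (ractB b a)

section Double

variable {K : Type u} {A : Type v} {B : Type w} [Field K] [AddCommGroup A] [Module K A]
  [AddCommGroup B] [Module K B]

/-- For fixed `a`, the linear map
`x ⊗ (y ⊗ z) ↦ (α(x) ▶ a ◀ S⁻¹(β(z))) ⊗ y` from `B ⊗ (B ⊗ B)` to `A ⊗ B`. -/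
def Pairing.sandwich {𝒜 : RegularMHA K A} {ℬ : RegularMHA K B} (P : Pairing 𝒜 ℬ)
    (p : ℬ.AutPair) (a : A) : B ⊗[K] (B ⊗[K] B) →ₗ[K] A ⊗[K] B :=
  (TensorProduct.lift
      ((P.ractA ∘ₗ P.lactA.flip a ∘ₗ p.fst.1.toLinearMap).compl₂
        (ℬ.antipode.symm.toLinearMap ∘ₗ p.snd.1.toLinearMap))).rTensor B ∘ₗ
    (TensorProduct.comm K B (B ⊗[K] B)).toLinearMap ∘ₗ
      (TensorProduct.leftComm K B B B).toLinearMap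

/-- `T` is the linear map `T (b ⊗ a) = (α(b₍₁₎) ▶ a ◀ S⁻¹β(b₍₃₎)) ⊗ b₍₂₎`. Since every element of
`A` is a sum of elements `e ▶ a`, and `α(b₍₁₎) ▶ (e ▶ a) = α(b₍₁₎ α⁻¹(e)) ▶ a`, this means that
`T (b ⊗ (e ▶ a)) (1 ⊗ b') = (α(b₍₁₎ α⁻¹(e)) ▶ a ◀ S⁻¹β(b₍₃₎)) ⊗ b₍₂₎ b'`, in which
`b₍₁₎ α⁻¹(e) ⊗ b₍₂₎ b' ⊗ b₍₃₎ = (ι ⊗ Δ)(Δ(b)(α⁻¹(e) ⊗ 1))(1 ⊗ b' ⊗ 1)` is in `B ⊗ B ⊗ B`. These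
equations determine `T`. -/
def Pairing.IsTwist {𝒜 : RegularMHA K A} {ℬ : RegularMHA K B} (P : Pairing 𝒜 ℬ)
    (p : ℬ.AutPair) (T : B ⊗[K] A →ₗ[K] A ⊗[K] B) : Prop :=
  ∀ b e a b', (ℬ.mul.flip b').lTensor A (T (b ⊗ₜ P.lactA e a))
    = P.sandwich p a ((ℬ.T₃.toLinearMap ∘ₗ (TensorProduct.mk K B B).flip b').lTensor B
        (ℬ.T₃ (b ⊗ₜ p.fst.1.symm e)))

/-- Let `X` and `Y` be algebras on `A ⊗ B` that contain `A` through `a ↦ a ⋈ 1`, where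
`(a ⋈ 1)(a' ⋈ b') = aa' ⋈ b'`. The multiplier `U` of `X ⊗ Y` is the image of the multiplier `m` of
`A ⊗ A`: it acts on the left by `m` on the two factors `A`. (For non-degenerate `X ⊗ Y` a multiplier
is determined by its left action.) -/
def IsImageA {𝒜 : NUAlgebra K A} {X Y : NUAlgebra K (A ⊗[K] B)} (m : (𝒜.tensor 𝒜).M)
    (U : (X.tensor Y).M) : Prop :=
  ∀ z, TensorProduct.tensorTensorTensorComm K A B A B (M.left U z)
    = (M.left m).rTensor (B ⊗[K] B) (TensorProduct.tensorTensorTensorComm K A B A B z)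

/-- Let `X` and `Y` be algebras on `A ⊗ B` that contain `B` through `b ↦ 1 ⋈ b`, where
`(a' ⋈ b')(1 ⋈ b) = a' ⋈ b'b`. The multiplier `U` of `X ⊗ Y` is the image of the multiplier `n` of
`B ⊗ B`: it acts on the right by `n` on the two factors `B`. (For non-degenerate `X ⊗ Y` a
multiplier is determined by its right action.) -/
def IsImageB {ℬ : NUAlgebra K B} {X Y : NUAlgebra K (A ⊗[K] B)} (n : (ℬ.tensor ℬ).M)
    (U : (X.tensor Y).M) : Prop :=
  ∀ z, TensorProduct.tensorTensorTensorComm K A B A B (M.right U z)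
    = (M.right n).lTensor (A ⊗[K] A) (TensorProduct.tensorTensorTensorComm K A B A B z)

/-- `m ∈ M(X ⊗ Y)` is the `(p, q)` component of the multiplier `N` of `D ⊗ D`, where `D` is an
algebra on `⨁ V` (finitely supported functions on `G`) and `X`, `Y` are its components at `p`, `q`:
`N` acts on both sides of the summand `V ⊗ V` at `(p, q)` as `m` does. -/
def IsComponent {G : Type w} {V : Type v} [AddCommGroup V] [Module K V] {X Y : NUAlgebra K V}
    {D : NUAlgebra K (G →₀ V)} (N : (D.tensor D).M) (p q : G) (m : (X.tensor Y).M) : Prop :=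
  ∀ z, M.left N (TensorProduct.map (Finsupp.lsingle p) (Finsupp.lsingle q) z)
        = TensorProduct.map (Finsupp.lsingle p) (Finsupp.lsingle q) (M.left m z) ∧
      M.right N (TensorProduct.map (Finsupp.lsingle p) (Finsupp.lsingle q) z)
        = TensorProduct.map (Finsupp.lsingle p) (Finsupp.lsingle q) (M.right m z)

end Double

end MHA

end

/-!
The double of a pairing of regular multiplier Hopf algebras, without sums over elements: every
Sweedler expression that occurs is the value of a *canonical map*. A regular multiplier Hopf algebra
has local units, a counit and a bijective antipode, all of which are read off from the bijections
`T₁(a ⊗ b) = Δ(a)(1 ⊗ b)` and `T₂(a ⊗ b) = (a ⊗ 1)Δ(b)` (`exists_counit_slices`, `antipodeM`,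
`hasLocalUnits`). By the local units, `T₁` induces on every unital module `N` a bijection
`a ⊗ n ↦ a₍₁₎ ⊗ a₍₂₎n` of `A ⊗ N`, and similarly for right modules and for `Δ^cop` (`canL`, `canR`).
Identities between such maps are checked after slicing with the non-degenerate pairing.

*The twist map.* For a pairing the maps `L(b ⊗ a) = (b₍₁₎ ▶ a) ⊗ b₍₂₎` and
`R(b ⊗ a) = b₍₁₎ ⊗ (a ◀ b₍₂₎)` are canonical maps, hence bijective, and `T_p = L R⁻¹`, where `L` is
taken for the pairing `⟨a, α(b)⟩` and `R` for `⟨a, β(b)⟩` (`Pairing.T`). Since the inverse of `R` is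
`b ⊗ a ↦ b₍₁₎ ⊗ (a ◀ S⁻¹(b₍₂₎))`, this is the map of the defining formula (`isTwist_iff`). As a
bijection compatible with the products of `A` and `B` (`T_mul_A`, `T_mul_B`), it makes `A ⊗ B` an
associative algebra with non-degenerate product (`TwistMap.algebra`, `TwistMap.nondegenerate`).

*Multiplicativity of `Δ`.* The commutation rule `(1 ⋈ b)(a ⋈ 1) = T(b ⊗ a)` of a component is
equivalent to `∑ (1 ⋈ b₍₁₎)((a ◀ b₍₂₎) ⋈ 1) = ∑ ((b₍₁₎ ▶ a) ⋈ 1)(1 ⋈ b₍₂₎)`, with `◀` from the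
second pairing and `▶` from the first one (`Covariant`, `covariant_iff`). In this form the relation
passes to tensor products: if `(π, θ)` is covariant for the pairings `(P, Q)` and `(π', θ')` for
`(Q, Q')`, then `π(a₍₂₎) ⊗ π'(a₍₁₎)` and `θ(b₍₁₎) ⊗ θ'(b₍₂₎)` are covariant for `(P, Q')`
(`Covariant.tensor`). Applied to `A ⋈ B_p` and `A ⋈ B_q`, whose actions of `B` are twisted by `γ` and
by `γ⁻¹βγ`, it requires that the middle pairings agree, which is `γ(γ⁻¹βγ) = βγ`; the outer pairings
are then twisted by `αγ` and `δγ⁻¹βγ`. So the product of `G` is exactly what makes `Δ_{p,q}` a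
homomorphism of `A ⋈ B_{p * q}` (`comulMap_mul`, `doubleComul_mul`).

*The Hopf structure.* The maps `x ⊗ y ↦ Δ_{p,q}(x)(1 ⊗ y)` and `x ⊗ y ↦ (x ⊗ 1)Δ_{p,q}(y)` are
composed of canonical maps of `A` and of `B` and of automorphisms, so that they are bijective, and
coassociativity reduces to that of `A` and `B` (`leftCan`, `rightCan`, `compT_coassoc`) and to two
identities between the automorphisms involved (`conjSnd_mul_fst`, `conjSnd_mul`). For `Δ^cop`
one takes instead the canonical maps of `A^cop` and `B^cop`, and the opposite group. Direct sums over
the group are taken at the end (`isMultiplierHopf_glue`, `isMultiplierHopf_glue_cop`). The stated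
counit and antipode satisfy the identities which characterize these maps (`sliceL_leftCan`,
`lift_antipode_leftCan`).
-/

noncomputable section

namespace MHA

/-! ### Slices and multipliers -/

section Slices

variable {K : Type*} [Field K] {U V W N : Type*} [AddCommGroup U] [Module K U] [AddCommGroup V]
  [Module K V] [AddCommGroup W] [Module K W] [AddCommGroup N] [Module K N]

/-- The slice map `f ⊗ ι : V ⊗ N → N` of a linear functional `f`. -/
def sliceL (N : Type*) [AddCommGroup N] [Module K N] (f : V →ₗ[K] K) : V ⊗[K] N →ₗ[K] N :=
  (TensorProduct.lid K N).toLinearMap ∘ₗ f.rTensor N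

/-- The slice map `ι ⊗ f : N ⊗ V → N` of a linear functional `f`. -/
def sliceR (N : Type*) [AddCommGroup N] [Module K N] (f : V →ₗ[K] K) : N ⊗[K] V →ₗ[K] N :=
  (TensorProduct.rid K N).toLinearMap ∘ₗ f.lTensor N

@[simp] theorem sliceL_tmul (f : V →ₗ[K] K) (v : V) (n : N) : sliceL N f (v ⊗ₜ n) = f v • n := by
  simp [sliceL]

@[simp] theorem sliceR_tmul (f : V →ₗ[K] K) (v : V) (n : N) : sliceR N f (n ⊗ₜ v) = f v • n := by
  simp [sliceR]

theorem sliceR_comm (f : V →ₗ[K] K) (z : V ⊗[K] N) :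
    sliceR N f (TensorProduct.comm K V N z) = sliceL N f z := by
  induction z with
  | zero => simp
  | add x y hx hy => simp only [map_add, hx, hy]
  | tmul x y => simp

theorem sliceL_comm (f : V →ₗ[K] K) (z : N ⊗[K] V) :
    sliceL N f (TensorProduct.comm K N V z) = sliceR N f z := by
  induction z with
  | zero => simp
  | add x y hx hy => simp only [map_add, hx, hy]
  | tmul x y => simp

theorem sliceL_rTensor (f : W →ₗ[K] K) (g : V →ₗ[K] W) (z : V ⊗[K] N) :
    sliceL N f (g.rTensor N z) = sliceL N (f ∘ₗ g) z := by
  simp [sliceL, LinearMap.rTensor_comp_apply]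

theorem sliceR_lTensor (f : W →ₗ[K] K) (g : V →ₗ[K] W) (z : N ⊗[K] V) :
    sliceR N f (g.lTensor N z) = sliceR N (f ∘ₗ g) z := by
  simp [sliceR, LinearMap.lTensor_comp_apply]

theorem sliceL_lTensor (f : V →ₗ[K] K) (g : N →ₗ[K] W) (z : V ⊗[K] N) :
    sliceL W f (g.lTensor V z) = g (sliceL N f z) := by
  induction z with
  | zero => simp
  | add x y hx hy => simp only [map_add, hx, hy]
  | tmul x y => simp

theorem sliceR_rTensor (f : V →ₗ[K] K) (g : N →ₗ[K] W) (z : N ⊗[K] V) :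
    sliceR W f (g.rTensor V z) = g (sliceR N f z) := by
  induction z with
  | zero => simp
  | add x y hx hy => simp only [map_add, hx, hy]
  | tmul x y => simp

/-- Over a field, tensoring with `N` preserves joint injectivity of a family of linear maps. -/
theorem rTensor_joint {ι : Sort*} {f : ι → V →ₗ[K] W} (hf : ∀ v, (∀ i, f i v = 0) → v = 0)
    {z z' : V ⊗[K] N} (h : ∀ i, (f i).rTensor N z = (f i).rTensor N z') : z = z' := by
  classical
  let b := Module.Basis.ofVectorSpace K N
  have nat : ∀ i (z : V ⊗[K] N) k, TensorProduct.equivFinsuppOfBasisRight b ((f i).rTensor N z) k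
      = f i (TensorProduct.equivFinsuppOfBasisRight b z k) := by
    intro i z k
    induction z with
    | zero => simp
    | add x y hx hy => simp only [map_add, Finsupp.add_apply, hx, hy]
    | tmul x y => simp
  apply (TensorProduct.equivFinsuppOfBasisRight b).injective
  ext k
  rw [← sub_eq_zero]
  apply hf
  intro i
  rw [map_sub, ← nat, ← nat, h, sub_self]

theorem rTensor_comm (f : V →ₗ[K] W) (z : N ⊗[K] V) :
    f.rTensor N (TensorProduct.comm K N V z) = TensorProduct.comm K N W (f.lTensor N z) := by
  induction z with
  | zero => simp
  | add x y hx hy => simp only [map_add, hx, hy]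
  | tmul x y => simp

theorem lTensor_comm (f : V →ₗ[K] W) (z : V ⊗[K] N) :
    f.lTensor N (TensorProduct.comm K V N z) = TensorProduct.comm K W N (f.rTensor N z) := by
  induction z with
  | zero => simp
  | add x y hx hy => simp only [map_add, hx, hy]
  | tmul x y => simp

theorem lTensor_joint {ι : Sort*} {f : ι → V →ₗ[K] W} (hf : ∀ v, (∀ i, f i v = 0) → v = 0)
    {z z' : N ⊗[K] V} (h : ∀ i, (f i).lTensor N z = (f i).lTensor N z') : z = z' := by
  apply (TensorProduct.comm K N V).injective
  refine rTensor_joint hf fun i => ?_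
  rw [rTensor_comm, rTensor_comm, h]

theorem sliceL_joint {ι : Sort*} {f : ι → V →ₗ[K] K} (hf : ∀ v, (∀ i, f i v = 0) → v = 0)
    {z z' : V ⊗[K] N} (h : ∀ i, sliceL N (f i) z = sliceL N (f i) z') : z = z' :=
  rTensor_joint hf fun i => (TensorProduct.lid K N).injective (h i)

theorem sliceR_joint {ι : Sort*} {f : ι → V →ₗ[K] K} (hf : ∀ v, (∀ i, f i v = 0) → v = 0)
    {z z' : N ⊗[K] V} (h : ∀ i, sliceR N (f i) z = sliceR N (f i) z') : z = z' :=
  lTensor_joint hf fun i => (TensorProduct.rid K N).injective (h i)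

end Slices

namespace NUAlgebra

variable {K : Type*} [Field K] {V W N : Type*} [AddCommGroup V] [Module K V]
  [AddCommGroup W] [Module K W] [AddCommGroup N] [Module K N]

/-- The opposite algebra. -/
def opp (R : NUAlgebra K V) : NUAlgebra K V where
  mul := R.mul.flip
  assoc x y z := (R.assoc z y x).symm

@[simp] theorem opp_mul (R : NUAlgebra K V) (x y : V) : R.opp.mul x y = R.mul y x := rfl

theorem Nondegenerate.opp {R : NUAlgebra K V} (h : R.Nondegenerate) : R.opp.Nondegenerate :=
  ⟨h.2, h.1⟩

@[simp] theorem tensor_mul_tmul (R : NUAlgebra K V) (S : NUAlgebra K W) (a c : V) (b d : W) :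
    (R.tensor S).mul (a ⊗ₜ b) (c ⊗ₜ d) = R.mul a c ⊗ₜ S.mul b d := rfl

theorem tensor_mul_tmul_left (R : NUAlgebra K V) (S : NUAlgebra K W) (a : V) (b : W) :
    (R.tensor S).mul (a ⊗ₜ b) = TensorProduct.map (R.mul a) (S.mul b) := by
  ext; simp

theorem tensor_mul_tmul_right (R : NUAlgebra K V) (S : NUAlgebra K W) (z : V ⊗[K] W) (a : V)
    (b : W) : (R.tensor S).mul z (a ⊗ₜ b) = TensorProduct.map (R.mul.flip a) (S.mul.flip b) z := by
  induction z with
  | zero => simp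
  | add x y hx hy => simp only [map_add, LinearMap.add_apply, hx, hy]
  | tmul x y => simp

theorem tensor_opp_mul (R : NUAlgebra K V) (S : NUAlgebra K W) (x y : V ⊗[K] W) :
    (R.opp.tensor S.opp).mul x y = (R.tensor S).mul y x := by
  induction x with
  | zero => simp
  | add x₁ x₂ hx hy => simp only [map_add, LinearMap.add_apply, hx, hy]
  | tmul a b =>
    induction y with
    | zero => simp
    | add x₁ x₂ hx hy => simp only [map_add, LinearMap.add_apply, hx, hy]
    | tmul c d => simp

theorem map_eq_rTensor_lTensor {V' W' : Type*} [AddCommGroup V'] [Module K V'] [AddCommGroup W']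
    [Module K W'] (f : V →ₗ[K] V') (g : W →ₗ[K] W') (z : V ⊗[K] W) :
    TensorProduct.map f g z = f.rTensor W' (g.lTensor V z) := by
  rw [← LinearMap.comp_apply, LinearMap.rTensor_comp_lTensor]

theorem map_joint {ι κ : Sort*} {V' W' : Type*} [AddCommGroup V'] [Module K V'] [AddCommGroup W']
    [Module K W'] {f : ι → V →ₗ[K] V'} {g : κ → W →ₗ[K] W'} (hf : ∀ v, (∀ i, f i v = 0) → v = 0)
    (hg : ∀ v, (∀ i, g i v = 0) → v = 0) {z z' : V ⊗[K] W}
    (h : ∀ i j, TensorProduct.map (f i) (g j) z = TensorProduct.map (f i) (g j) z') : z = z' :=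
  lTensor_joint hg fun j => rTensor_joint hf fun i => by
    rw [← map_eq_rTensor_lTensor, ← map_eq_rTensor_lTensor, h]

theorem Nondegenerate.tensor {R : NUAlgebra K V} {S : NUAlgebra K W} (hR : R.Nondegenerate)
    (hS : S.Nondegenerate) : (R.tensor S).Nondegenerate := by
  constructor
  · intro z hz
    refine map_joint (f := fun a => R.mul.flip a) (g := fun b => S.mul.flip b) hR.1 hS.1
      fun a b => ?_
    rw [← tensor_mul_tmul_right, hz, map_zero]
  · intro z hz
    refine map_joint (f := fun a => R.mul a) (g := fun b => S.mul b) hR.2 hS.2 fun a b => ?_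
    rw [← tensor_mul_tmul_left, hz, map_zero]

section Multipliers

variable {R : NUAlgebra K V} {S : NUAlgebra K W}

theorem Nondegenerate.eq_of_mul_right (h : R.Nondegenerate) {x x' : V}
    (hx : ∀ y, R.mul x y = R.mul x' y) : x = x' := by
  rw [← sub_eq_zero]
  exact h.1 _ fun y => by rw [map_sub, LinearMap.sub_apply, hx, sub_self]

theorem Nondegenerate.eq_of_mul_left (h : R.Nondegenerate) {x x' : V}
    (hx : ∀ y, R.mul y x = R.mul y x') : x = x' :=
  h.opp.eq_of_mul_right hx

theorem M.compat (m : R.M) (x y : V) : R.mul x (M.left m y) = R.mul (M.right m x) y := m.2 x y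

@[simp] theorem M.left_mul (m n : R.M) (y : V) : M.left (m * n) y = M.left m (M.left n y) := rfl

@[simp] theorem M.right_mul (m n : R.M) (y : V) : M.right (m * n) y = M.right n (M.right m y) :=
  rfl

@[simp] theorem M.left_one (y : V) : M.left (1 : R.M) y = y := rfl

@[simp] theorem M.right_one (y : V) : M.right (1 : R.M) y = y := rfl

@[simp] theorem M.left_add (m n : R.M) (y : V) : M.left (m + n) y = M.left m y + M.left n y := rfl

@[simp] theorem M.right_add (m n : R.M) (y : V) : M.right (m + n) y = M.right m y + M.right n y :=
  rfl

@[simp] theorem M.left_smul (c : K) (m : R.M) (y : V) : M.left (c • m) y = c • M.left m y := rfl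

@[simp] theorem M.right_smul (c : K) (m : R.M) (y : V) : M.right (c • m) y = c • M.right m y := rfl

@[simp] theorem M.left_zero (y : V) : M.left (0 : R.M) y = 0 := rfl

@[simp] theorem M.right_zero (y : V) : M.right (0 : R.M) y = 0 := rfl

@[simp] theorem left_of (x y : V) : M.left (R.of x) y = R.mul x y := rfl

@[simp] theorem right_of (x y : V) : M.right (R.of x) y = R.mul y x := rfl

@[simp] theorem left_tmul (m : R.M) (n : S.M) :
    M.left (NUAlgebra.tmul m n) = TensorProduct.map (M.left m) (M.left n) := rfl

@[simp] theorem right_tmul (m : R.M) (n : S.M) :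
    M.right (NUAlgebra.tmul m n) = TensorProduct.map (M.right m) (M.right n) := rfl

/-- Multipliers of a non-degenerate algebra are determined by their left action. -/
theorem M.ext_left (h : R.Nondegenerate) {m n : R.M} (hl : ∀ y, M.left m y = M.left n y) :
    m = n :=
  M.ext hl fun x => h.eq_of_mul_right fun y => by rw [← M.compat, ← M.compat, hl]

/-- Multipliers of a non-degenerate algebra are determined by their right action. -/
theorem M.ext_right (h : R.Nondegenerate) {m n : R.M} (hr : ∀ y, M.right m y = M.right n y) :
    m = n :=
  M.ext (fun x => h.eq_of_mul_left fun y => by rw [M.compat, M.compat, hr]) hr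

theorem M.left_mul_right (h : R.Nondegenerate) (m : R.M) (x y : V) :
    M.left m (R.mul x y) = R.mul (M.left m x) y :=
  h.eq_of_mul_left fun z => by rw [M.compat, ← R.assoc, ← M.compat, R.assoc]

theorem M.right_mul_left (h : R.Nondegenerate) (m : R.M) (x y : V) :
    M.right m (R.mul x y) = R.mul x (M.right m y) :=
  h.eq_of_mul_right fun z => by rw [← M.compat, R.assoc, M.compat, R.assoc]

theorem of_injective (h : R.Nondegenerate) : Function.Injective R.of := fun x y hxy =>
  h.eq_of_mul_right fun z => by rw [← left_of, hxy, left_of]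

theorem left_flip (m : (R.tensor R).M) (z : V ⊗[K] V) : M.left (R.flip m) z
    = TensorProduct.comm K V V (M.left m (TensorProduct.comm K V V z)) := rfl

theorem right_flip (m : (R.tensor R).M) (z : V ⊗[K] V) : M.right (R.flip m) z
    = TensorProduct.comm K V V (M.right m (TensorProduct.comm K V V z)) := rfl

theorem flip_mul_flip (m n : (R.tensor R).M) : R.flip (m * n) = R.flip m * R.flip n :=
  M.ext (fun y => by simp [left_flip]) (fun y => by simp [right_flip])

theorem flip_flip (m : (R.tensor R).M) : R.flip (R.flip m) = m :=
  M.ext (fun y => by simp [left_flip]) (fun y => by simp [right_flip])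

theorem comm_map (f : V →ₗ[K] V) (g : W →ₗ[K] W) (z : V ⊗[K] W) :
    TensorProduct.comm K V W (TensorProduct.map f g z)
      = TensorProduct.map g f (TensorProduct.comm K V W z) := by
  induction z with
  | zero => simp
  | add x y hx hy => simp only [map_add, hx, hy]
  | tmul x y => simp

end Multipliers

end NUAlgebra

open NUAlgebra

/-! ### Counit and antipode of a multiplier Hopf algebra -/

section Lift

variable {K : Type*} [Field K] {V W N : Type*} [AddCommGroup V] [Module K V]
  [AddCommGroup W] [Module K W] [AddCommGroup N] [Module K N]

/-- A vector `x ≠ 0` is detected by a functional. -/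
theorem exists_functional_eq_one {x : V} (hx : x ≠ 0) : ∃ f : V →ₗ[K] K, f x = 1 := by
  obtain ⟨g, hg⟩ := LinearMap.exists_leftInverse_of_injective (LinearMap.toSpanSingleton K V x)
    (LinearMap.ker_toSpanSingleton K hx)
  exact ⟨g, by simpa using LinearMap.congr_fun hg 1⟩

theorem tmul_right_injective {n : N} (hn : n ≠ 0) {v w : V} (h : v ⊗ₜ[K] n = w ⊗ₜ n) : v = w := by
  obtain ⟨f, hf⟩ := exists_functional_eq_one (K := K) hn
  simpa [hf] using congrArg (sliceR V f) h

end Lift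

namespace IsMultiplierHopf

variable {K : Type*} [Field K] {V : Type*} [AddCommGroup V] [Module K V]
  {R : NUAlgebra K V} {Δ Δ' : V →ₗ[K] (R.tensor R).M}

/-- `T₁ (a ⊗ b) = Δ(a)(1 ⊗ b)`. -/
def T1 (h : IsMultiplierHopf R Δ) : (V ⊗[K] V) ≃ₗ[K] (V ⊗[K] V) := h.exists_T.choose

/-- `T₂ (a ⊗ b) = (a ⊗ 1)Δ(b)`. -/
def T2 (h : IsMultiplierHopf R Δ) : (V ⊗[K] V) ≃ₗ[K] (V ⊗[K] V) :=
  h.exists_T.choose_spec.choose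

theorem T1_spec (h : IsMultiplierHopf R Δ) (a b : V) :
    (R.tensor R).of (h.T1 (a ⊗ₜ b)) = Δ a * tmul 1 (R.of b) :=
  h.exists_T.choose_spec.choose_spec.1 a b

theorem T2_spec (h : IsMultiplierHopf R Δ) (a b : V) :
    (R.tensor R).of (h.T2 (a ⊗ₜ b)) = tmul (R.of a) 1 * Δ b :=
  h.exists_T.choose_spec.choose_spec.2.1 a b

theorem coassoc (h : IsMultiplierHopf R Δ) (z : V ⊗[K] (V ⊗[K] V)) :
    h.T2.toLinearMap.rTensor V ((TensorProduct.assoc K V V V).symm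
          (h.T1.toLinearMap.lTensor V z))
        = (TensorProduct.assoc K V V V).symm (h.T1.toLinearMap.lTensor V
            (TensorProduct.assoc K V V V (h.T2.toLinearMap.rTensor V
              ((TensorProduct.assoc K V V V).symm z)))) :=
  h.exists_T.choose_spec.choose_spec.2.2 z

theorem nondegenerate_tensor (h : IsMultiplierHopf R Δ) : (R.tensor R).Nondegenerate :=
  h.nondegenerate.tensor h.nondegenerate

theorem left_comul (h : IsMultiplierHopf R Δ) (a e b f : V) :
    M.left (Δ a) (e ⊗ₜ R.mul b f) = (R.tensor R).mul (h.T1 (a ⊗ₜ b)) (e ⊗ₜ f) := by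
  exact (congrArg (fun m => M.left m (e ⊗ₜ[K] f)) (h.T1_spec a b)).symm

theorem right_comul (h : IsMultiplierHopf R Δ) (a e b f : V) :
    M.right (Δ b) (R.mul e a ⊗ₜ f) = (R.tensor R).mul (e ⊗ₜ f) (h.T2 (a ⊗ₜ b)) := by
  exact (congrArg (fun m => M.right m (e ⊗ₜ[K] f)) (h.T2_spec a b)).symm

theorem mul_T2 (h : IsMultiplierHopf R Δ) (a b : V) (z : V ⊗[K] V) :
    (R.tensor R).mul (h.T2 (a ⊗ₜ b)) z = (R.mul a).rTensor V (M.left (Δ b) z) := by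
  rw [← left_of, h.T2_spec]
  rfl

theorem T1_mul_right (h : IsMultiplierHopf R Δ) (a b c : V) :
    h.T1 (a ⊗ₜ R.mul b c) = (R.mul.flip c).lTensor V (h.T1 (a ⊗ₜ b)) := by
  apply of_injective h.nondegenerate_tensor
  refine M.ext_left h.nondegenerate_tensor fun y => ?_
  induction y with
  | zero => simp
  | add x y hx hy => rw [map_add, map_add, hx, hy]
  | tmul e f =>
    rw [left_of, ← h.left_comul, R.assoc, h.left_comul, left_of]
    generalize h.T1 (a ⊗ₜ b) = z
    induction z with
    | zero => simp
    | add x y hx hy => simp only [map_add, LinearMap.add_apply, hx, hy]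
    | tmul x y => simp [R.assoc]

theorem T2_mul_left (h : IsMultiplierHopf R Δ) (a b c : V) :
    h.T2 (R.mul c a ⊗ₜ b) = (R.mul c).rTensor V (h.T2 (a ⊗ₜ b)) := by
  refine h.nondegenerate_tensor.eq_of_mul_right fun y => ?_
  rw [h.mul_T2]
  have : ∀ z, (R.tensor R).mul ((R.mul c).rTensor V z) y
      = (R.mul c).rTensor V ((R.tensor R).mul z y) := by
    intro z
    induction z with
    | zero => simp
    | add x y hx hy => simp only [map_add, LinearMap.add_apply, hx, hy]
    | tmul u v =>
      induction y with
      | zero => simp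
      | add x y hx hy => simp only [map_add, hx, hy]
      | tmul x y => simp [R.assoc]
  rw [this, h.mul_T2, ← LinearMap.rTensor_comp_apply]
  congr 2
  ext x
  simp [R.assoc]

/-- `(a ⊗ 1)(Δ(b)(1 ⊗ c)) = ((a ⊗ 1)Δ(b))(1 ⊗ c)`. -/
theorem mul_T1_eq_T2_mul (h : IsMultiplierHopf R Δ) (a b c : V) :
    (R.mul a).rTensor V (h.T1 (b ⊗ₜ c)) = (R.mul.flip c).lTensor V (h.T2 (a ⊗ₜ b)) := by
  refine h.nondegenerate_tensor.eq_of_mul_right fun y => ?_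
  induction y with
  | zero => simp
  | add x y hx hy => rw [map_add, map_add, hx, hy]
  | tmul e f =>
    have h1 : ∀ z, (R.tensor R).mul ((R.mul a).rTensor V z) (e ⊗ₜ f)
        = (R.mul a).rTensor V ((R.tensor R).mul z (e ⊗ₜ f)) := by
      intro z
      induction z with
      | zero => simp
      | add x y hx hy => simp only [map_add, LinearMap.add_apply, hx, hy]
      | tmul u v => simp [R.assoc]
    have h2 : ∀ z, (R.tensor R).mul ((R.mul.flip c).lTensor V z) (e ⊗ₜ f)
        = (R.tensor R).mul z (e ⊗ₜ R.mul c f) := by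
      intro z
      induction z with
      | zero => simp
      | add x y hx hy => simp only [map_add, LinearMap.add_apply, hx, hy]
      | tmul u v => simp [R.assoc]
    rw [h1, h2, h.mul_T2, ← h.left_comul]

theorem T1_mul_left (h : IsMultiplierHopf R Δ) (a : V) (z : V ⊗[K] V) :
    h.T1 ((R.mul a).rTensor V z) = M.left (Δ a) (h.T1 z) := by
  induction z with
  | zero => simp
  | add x y hx hy => simp only [map_add, hx, hy]
  | tmul b c =>
    rw [LinearMap.rTensor_tmul]
    refine h.nondegenerate_tensor.eq_of_mul_right fun y => ?_
    induction y with
    | zero => simp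
    | add x y hx hy => rw [map_add, map_add, hx, hy]
    | tmul e f =>
      rw [← M.left_mul_right h.nondegenerate_tensor, ← h.left_comul, ← h.left_comul, h.comul_mul]
      rfl

section Counit

/-- With `E(c)(y) = m(T₁⁻¹(y ⊗ c))`, formally `ε(y)c`, one has `(ι ⊗ E(c))((a ⊗ 1)Δ(b)) = ab ⊗ c`.
This is coassociativity applied to `a ⊗ T₁⁻¹(b ⊗ c)`. -/
theorem lTensor_T2_eq (h : IsMultiplierHopf R Δ) (a b c : V) :
    (TensorProduct.lift R.mul ∘ₗ h.T1.symm.toLinearMap ∘ₗ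
        (TensorProduct.mk K V V).flip c).lTensor V (h.T2 (a ⊗ₜ b)) = R.mul a b ⊗ₜ c := by
  have h1 := h.coassoc (a ⊗ₜ h.T1.symm (b ⊗ₜ c))
  rw [LinearMap.lTensor_tmul, LinearEquiv.coe_coe, LinearEquiv.apply_symm_apply,
    TensorProduct.assoc_symm_tmul, LinearMap.rTensor_tmul] at h1
  have h2 := congrArg (fun z => (TensorProduct.lift R.mul).lTensor V
    (h.T1.symm.toLinearMap.lTensor V (TensorProduct.assoc K V V V z))) h1
  simp only [LinearEquiv.apply_symm_apply] at h2
  have h3 : ∀ z : V ⊗[K] (V ⊗[K] V),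
      h.T1.symm.toLinearMap.lTensor V (h.T1.toLinearMap.lTensor V z) = z := by
    intro z
    rw [← LinearMap.comp_apply, ← LinearMap.lTensor_comp]
    simp
  rw [h3] at h2
  have h4 : ∀ z : V ⊗[K] V, (TensorProduct.lift R.mul).lTensor V
      (h.T1.symm.toLinearMap.lTensor V (TensorProduct.assoc K V V V (z ⊗ₜ[K] c)))
      = (TensorProduct.lift R.mul ∘ₗ h.T1.symm.toLinearMap ∘ₗ
        (TensorProduct.mk K V V).flip c).lTensor V z := by
    intro z
    induction z with
    | zero => simp
    | add x y hx hy => simp only [TensorProduct.add_tmul, map_add, hx, hy]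
    | tmul x y => simp
  have h5 : ∀ z : V ⊗[K] V, (TensorProduct.lift R.mul).lTensor V
      (TensorProduct.assoc K V V V (h.T2.toLinearMap.rTensor V
              ((TensorProduct.assoc K V V V).symm (a ⊗ₜ z))))
      = (R.mul a).rTensor V (h.T1 z) := by
    intro z
    induction z with
    | zero => simp
    | add x y hx hy => simp only [TensorProduct.tmul_add, map_add, hx, hy]
    | tmul u v =>
      rw [h.mul_T1_eq_T2_mul, TensorProduct.assoc_symm_tmul, LinearMap.rTensor_tmul,
        LinearEquiv.coe_coe]
      generalize h.T2 (a ⊗ₜ u) = z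
      induction z with
      | zero => simp
      | add x y hx hy => simp only [TensorProduct.add_tmul, map_add, hx, hy]
      | tmul x y => simp
  rw [LinearEquiv.coe_coe, h4, h5, LinearEquiv.apply_symm_apply, LinearMap.rTensor_tmul] at h2
  exact h2

/-- The counit exists: `ε(y)` is the scalar by which `y ⊗ c ↦ m(T₁⁻¹(y ⊗ c))` multiplies `c`. It is a
scalar because `x ⊗ m(T₁⁻¹(y ⊗ c)) = m(T₂⁻¹(x ⊗ y)) ⊗ c`. -/
theorem exists_counit_slices (h : IsMultiplierHopf R Δ) : ∃ ε : V →ₗ[K] K,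
    (∀ z, sliceL V ε (h.T1 z) = TensorProduct.lift R.mul z) ∧
    (∀ z, sliceR V ε (h.T2 z) = TensorProduct.lift R.mul z) := by
  rcases subsingleton_or_nontrivial V with hV | hV
  · exact ⟨0, fun z => Subsingleton.elim _ _, fun z => Subsingleton.elim _ _⟩
  have key : ∀ x y c : V, x ⊗ₜ[K] TensorProduct.lift R.mul (h.T1.symm (y ⊗ₜ c))
      = TensorProduct.lift R.mul (h.T2.symm (x ⊗ₜ y)) ⊗ₜ c := by
    intro x y c
    have : ∀ w : V ⊗[K] V, (TensorProduct.lift R.mul ∘ₗ h.T1.symm.toLinearMap ∘ₗ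
        (TensorProduct.mk K V V).flip c).lTensor V (h.T2 w) = TensorProduct.lift R.mul w ⊗ₜ c := by
      intro w
      induction w with
      | zero => simp
      | add x y hx hy => simp only [TensorProduct.add_tmul, map_add, hx, hy]
      | tmul x y => simp only [h.lTensor_T2_eq, TensorProduct.lift.tmul]
    simpa using this (h.T2.symm (x ⊗ₜ y))
  obtain ⟨x, hx⟩ := exists_ne (0 : V)
  obtain ⟨f, hf⟩ := exists_functional_eq_one (K := K) hx
  let ε : V →ₗ[K] K := f ∘ₗ TensorProduct.lift R.mul ∘ₗ h.T2.symm.toLinearMap ∘ₗ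
    TensorProduct.mk K V V x
  have h1 : ∀ y c, TensorProduct.lift R.mul (h.T1.symm (y ⊗ₜ c)) = ε y • c := by
    intro y c
    have := congrArg (sliceL V f) (key x y c)
    simpa [hf, ε] using this
  have h2 : ∀ y c, TensorProduct.lift R.mul (h.T2.symm (y ⊗ₜ c)) = ε c • y := by
    intro y c
    apply tmul_right_injective (K := K) hx
    rw [← key, h1, TensorProduct.tmul_smul, TensorProduct.smul_tmul']
  refine ⟨ε, fun z => ?_, fun z => ?_⟩
  · obtain ⟨w, rfl⟩ := h.T1.symm.surjective z
    rw [LinearEquiv.apply_symm_apply]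
    induction w with
    | zero => simp
    | add x y hx hy => simp only [map_add, hx, hy]
    | tmul x y => simp [h1]
  · obtain ⟨w, rfl⟩ := h.T2.symm.surjective z
    rw [LinearEquiv.apply_symm_apply]
    induction w with
    | zero => simp
    | add x y hx hy => simp only [map_add, hx, hy]
    | tmul x y => simp [h2]

/-- The counit of a multiplier Hopf algebra. -/
def counit (h : IsMultiplierHopf R Δ) : V →ₗ[K] K := h.exists_counit_slices.choose

theorem counit_T1 (h : IsMultiplierHopf R Δ) (z : V ⊗[K] V) :
    sliceL V h.counit (h.T1 z) = TensorProduct.lift R.mul z :=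
  h.exists_counit_slices.choose_spec.1 z

theorem counit_T2 (h : IsMultiplierHopf R Δ) (z : V ⊗[K] V) :
    sliceR V h.counit (h.T2 z) = TensorProduct.lift R.mul z :=
  h.exists_counit_slices.choose_spec.2 z

theorem exists_mul_ne_zero [Nontrivial V] (h : IsMultiplierHopf R Δ) : ∃ a b, R.mul a b ≠ 0 := by
  by_contra! H
  obtain ⟨x, hx⟩ := exists_ne (0 : V)
  exact hx (h.nondegenerate.1 x (H x))

theorem eq_counit (h : IsMultiplierHopf R Δ) {ε : V →ₗ[K] K}
    (hε : ∀ z, sliceL V ε (h.T1 z) = TensorProduct.lift R.mul z) : ε = h.counit := by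
  rcases subsingleton_or_nontrivial V with hV | hV
  · ext x
    rw [Subsingleton.elim x 0, map_zero, map_zero]
  obtain ⟨y, hy⟩ := exists_ne (0 : V)
  ext x
  have h1 := hε (h.T1.symm (x ⊗ₜ y))
  rw [← h.counit_T1, LinearEquiv.apply_symm_apply, sliceL_tmul, sliceL_tmul] at h1
  exact smul_left_injective K hy h1

theorem counit_mul (h : IsMultiplierHopf R Δ) (a b : V) :
    h.counit (R.mul a b) = h.counit a * h.counit b := by
  rcases subsingleton_or_nontrivial V with hV | hV
  · rw [Subsingleton.elim (R.mul a b) 0, Subsingleton.elim a 0, map_zero, zero_mul]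
  have h1 : ∀ a z, sliceL V h.counit (M.left (Δ a) z) = R.mul a (sliceL V h.counit z) := by
    intro a z
    obtain ⟨w, rfl⟩ := h.T1.surjective z
    rw [← h.T1_mul_left, h.counit_T1, h.counit_T1]
    induction w with
    | zero => simp
    | add x y hx hy => simp only [map_add, hx, hy]
    | tmul x y => simp [R.assoc]
  have h2 : ∀ b d w, sliceL V h.counit ((R.tensor R).mul w (b ⊗ₜ d))
      = h.counit b • R.mul (sliceL V h.counit w) d := by
    intro b d w
    obtain ⟨w, rfl⟩ := h.T1.surjective w
    rw [h.counit_T1]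
    induction w with
    | zero => simp
    | add x y hx hy => simp only [map_add, LinearMap.add_apply, smul_add, hx, hy]
    | tmul x y => rw [← h.left_comul, h1]; simp [R.assoc]
  obtain ⟨y, d, hyd⟩ := h.exists_mul_ne_zero
  have h3 := h2 b d (a ⊗ₜ y)
  simp only [tensor_mul_tmul, sliceL_tmul, map_smul, LinearMap.smul_apply, smul_smul] at h3
  rw [mul_comm]
  exact smul_left_injective K hyd h3

theorem exists_counit_eq_one [Nontrivial V] (h : IsMultiplierHopf R Δ) :
    ∃ e, h.counit e = 1 := by
  obtain ⟨a, b, hab⟩ := h.exists_mul_ne_zero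
  have h1 : h.counit ≠ 0 := by
    intro h0
    apply hab
    have := h.counit_T1 (a ⊗ₜ b)
    rw [h0] at this
    simpa [sliceL] using this.symm
  obtain ⟨x, hx⟩ := DFunLike.ne_iff.1 h1
  exact ⟨(h.counit x)⁻¹ • x, by simpa using inv_mul_cancel₀ hx⟩

theorem sliceL_counit_surjective (h : IsMultiplierHopf R Δ) :
    Function.Surjective (sliceL V h.counit) := by
  intro x
  rcases subsingleton_or_nontrivial V with hV | hV
  · exact ⟨0, Subsingleton.elim _ _⟩
  obtain ⟨e, he⟩ := h.exists_counit_eq_one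
  exact ⟨e ⊗ₜ x, by simp [he]⟩

theorem sliceR_counit_surjective (h : IsMultiplierHopf R Δ) :
    Function.Surjective (sliceR V h.counit) := by
  intro x
  obtain ⟨z, hz⟩ := h.sliceL_counit_surjective x
  exact ⟨TensorProduct.comm K V V z, by rw [sliceR_comm, hz]⟩

end Counit

section Antipode

/-- `S(a)b = (ε ⊗ ι)T₁⁻¹(a ⊗ b)`, the left action of the antipode with values in multipliers. -/
def antipodeL (h : IsMultiplierHopf R Δ) : V →ₗ[K] V →ₗ[K] V :=
  TensorProduct.curry (sliceL V h.counit ∘ₗ h.T1.symm.toLinearMap)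

/-- `bS(a) = (ι ⊗ ε)T₂⁻¹(b ⊗ a)`, as a function of `b` and `a`. -/
def antipodeR (h : IsMultiplierHopf R Δ) : V →ₗ[K] V →ₗ[K] V :=
  TensorProduct.curry (sliceR V h.counit ∘ₗ h.T2.symm.toLinearMap)

theorem lift_antipodeL (h : IsMultiplierHopf R Δ) (z : V ⊗[K] V) :
    TensorProduct.lift h.antipodeL (h.T1 z) = sliceL V h.counit z := by
  have : TensorProduct.lift h.antipodeL = sliceL V h.counit ∘ₗ h.T1.symm.toLinearMap :=
    TensorProduct.ext' fun _ _ => rfl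
  rw [this]
  simp

theorem lift_antipodeR (h : IsMultiplierHopf R Δ) (z : V ⊗[K] V) :
    TensorProduct.lift h.antipodeR (h.T2 z) = sliceR V h.counit z := by
  have : TensorProduct.lift h.antipodeR = sliceR V h.counit ∘ₗ h.T2.symm.toLinearMap :=
    TensorProduct.ext' fun _ _ => rfl
  rw [this]
  simp

/-- The left operator `b ↦ S(a)b` and the right operator `c ↦ cS(a)` form a multiplier. -/
theorem antipode_compat (h : IsMultiplierHopf R Δ) (a b c : V) :
    R.mul c (h.antipodeL a b) = R.mul (h.antipodeR c a) b := by
  have key : ∀ t : V ⊗[K] (V ⊗[K] V),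
      TensorProduct.lift (R.mul.compl₂ (TensorProduct.lift h.antipodeL)) t
        = TensorProduct.lift (R.mul ∘ₗ TensorProduct.lift h.antipodeR)
          ((TensorProduct.assoc K V V V).symm t) := by
    intro t
    have hsurj : ∃ z, TensorProduct.assoc K V V V (h.T2.toLinearMap.rTensor V
        ((TensorProduct.assoc K V V V).symm (h.T1.toLinearMap.lTensor V z))) = t := by
      refine ⟨h.T1.symm.toLinearMap.lTensor V (TensorProduct.assoc K V V V
        (h.T2.symm.toLinearMap.rTensor V ((TensorProduct.assoc K V V V).symm t))), ?_⟩
      have h1 : ∀ z, h.T1.toLinearMap.lTensor V (h.T1.symm.toLinearMap.lTensor V z) = z := by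
        intro z
        rw [← LinearMap.comp_apply, ← LinearMap.lTensor_comp]
        simp
      have h2 : ∀ z, h.T2.toLinearMap.rTensor V (h.T2.symm.toLinearMap.rTensor V z) = z := by
        intro z
        rw [← LinearMap.comp_apply, ← LinearMap.rTensor_comp]
        simp
      rw [h1, LinearEquiv.symm_apply_apply, h2, LinearEquiv.apply_symm_apply]
    obtain ⟨z, rfl⟩ := hsurj
    rw [LinearEquiv.symm_apply_apply, h.coassoc, LinearEquiv.apply_symm_apply]
    have h3 : ∀ w, TensorProduct.lift (R.mul.compl₂ (TensorProduct.lift h.antipodeL))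
        (h.T1.toLinearMap.lTensor V w)
        = TensorProduct.lift (R.mul.compl₂ (sliceL V h.counit)) w := by
      intro w
      induction w with
      | zero => simp
      | add x y hx hy => simp only [map_add, hx, hy]
      | tmul x y => simp [h.lift_antipodeL]
    rw [h3, ← h.coassoc]
    have h4 : ∀ w, TensorProduct.lift (R.mul ∘ₗ TensorProduct.lift h.antipodeR)
        (h.T2.toLinearMap.rTensor V w)
        = TensorProduct.lift (R.mul ∘ₗ sliceR V h.counit) w := by
      intro w
      induction w with
      | zero => simp
      | add x y hx hy => simp only [map_add, hx, hy]
      | tmul x y => simp [h.lift_antipodeR]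
    rw [h4]
    induction z with
    | zero => simp
    | add x y hx hy => simp only [map_add, hx, hy]
    | tmul x w =>
      induction w with
      | zero => simp
      | add x y hx hy => simp only [map_add, TensorProduct.tmul_add, hx, hy]
      | tmul y v =>
        have h5 : ∀ w, TensorProduct.lift (R.mul.compl₂ (sliceL V h.counit))
            (TensorProduct.assoc K V V V (w ⊗ₜ v)) = R.mul (sliceR V h.counit w) v := by
          intro w
          induction w with
          | zero => simp
          | add x y hx hy =>
            simp only [map_add, TensorProduct.add_tmul, LinearMap.add_apply, hx, hy]
          | tmul x y => simp
        have h6 : ∀ w, TensorProduct.lift (R.mul ∘ₗ sliceR V h.counit)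
            ((TensorProduct.assoc K V V V).symm (x ⊗ₜ w)) = R.mul x (sliceL V h.counit w) := by
          intro w
          induction w with
          | zero => simp
          | add x y hx hy =>
            simp only [map_add, TensorProduct.tmul_add, hx, hy]
          | tmul x y => simp
        rw [TensorProduct.assoc_symm_tmul, LinearMap.rTensor_tmul, LinearMap.lTensor_tmul, h5, h6]
        simp [h.counit_T1, h.counit_T2, R.assoc]
  simpa using key (c ⊗ₜ (a ⊗ₜ b))

/-- The antipode of a multiplier Hopf algebra, with values in the multiplier algebra. -/
def antipodeM (h : IsMultiplierHopf R Δ) : V →ₗ[K] R.M where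
  toFun a := ⟨(h.antipodeL a, MulOpposite.op (h.antipodeR.flip a)),
    fun c b => h.antipode_compat a b c⟩
  map_add' a b := M.ext (fun y => by simp [M.left]) (fun y => by simp [M.right])
  map_smul' a b := M.ext (fun y => by simp [M.left]) (fun y => by simp [M.right])

@[simp] theorem left_antipodeM (h : IsMultiplierHopf R Δ) (a b : V) :
    M.left (h.antipodeM a) b = h.antipodeL a b := rfl

@[simp] theorem right_antipodeM (h : IsMultiplierHopf R Δ) (a b : V) :
    M.right (h.antipodeM a) b = h.antipodeR b a := rfl

theorem antipodeL_mul_right (h : IsMultiplierHopf R Δ) (x y d : V) :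
    h.antipodeL x (R.mul y d) = R.mul (h.antipodeL x y) d :=
  M.left_mul_right h.nondegenerate (h.antipodeM x) y d

/-- The antipode is anti-multiplicative: `S(ux)v = S(x)(S(u)v)`. -/
theorem antipodeL_mul (h : IsMultiplierHopf R Δ) (u x v : V) :
    h.antipodeL (R.mul u x) v = h.antipodeL x (h.antipodeL u v) := by
  have h1 : ∀ a z, TensorProduct.lift h.antipodeL (M.left (Δ a) z)
      = h.counit a • TensorProduct.lift h.antipodeL z := by
    intro a z
    obtain ⟨w, rfl⟩ := h.T1.surjective z
    rw [← h.T1_mul_left, h.lift_antipodeL, h.lift_antipodeL, sliceL_rTensor]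
    induction w with
    | zero => simp
    | add x y hx hy => simp only [map_add, smul_add, hx, hy]
    | tmul x y => simp [h.counit_mul, smul_smul]
  refine h.nondegenerate.eq_of_mul_right fun d => ?_
  have h2 : ∀ w, TensorProduct.lift h.antipodeL ((R.tensor R).mul w (x ⊗ₜ d))
      = h.antipodeL x (R.mul (TensorProduct.lift h.antipodeL w) d) := by
    intro w
    obtain ⟨w, rfl⟩ := h.T1.surjective w
    rw [h.lift_antipodeL]
    induction w with
    | zero => simp
    | add x y hx hy => simp only [map_add, LinearMap.add_apply, hx, hy]
    | tmul a y => rw [← h.left_comul, h1]; simp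
  simpa [h.antipodeL_mul_right] using h2 (u ⊗ₜ v)

theorem antipodeM_mul (h : IsMultiplierHopf R Δ) (a b : V) :
    h.antipodeM (R.mul a b) = h.antipodeM b * h.antipodeM a :=
  M.ext_left h.nondegenerate fun y => by simp [h.antipodeL_mul]

end Antipode

section Regular

/-- `((a ⊗ 1)Δ(b))(c ⊗ 1) = (a ⊗ 1)(Δ(b)(c ⊗ 1))`, with `Δ'` the co-opposite of `Δ`. -/
theorem T2_mul_eq_mul_T1 (h : IsMultiplierHopf R Δ) (h' : IsMultiplierHopf R Δ')
    (hΔ : ∀ a, Δ' a = R.flip (Δ a)) (a b c : V) :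
    (R.mul a).lTensor V (h'.T1 (b ⊗ₜ c))
      = TensorProduct.comm K V V ((R.mul.flip c).rTensor V (h.T2 (a ⊗ₜ b))) := by
  refine h.nondegenerate_tensor.eq_of_mul_right fun y => ?_
  induction y with
  | zero => simp
  | add x y hx hy => rw [map_add, map_add, hx, hy]
  | tmul e f =>
    have h1 : ∀ z, (R.tensor R).mul ((R.mul a).lTensor V z) (e ⊗ₜ f)
        = (R.mul a).lTensor V ((R.tensor R).mul z (e ⊗ₜ f)) := by
      intro z
      induction z with
      | zero => simp
      | add x y hx hy => simp only [map_add, LinearMap.add_apply, hx, hy]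
      | tmul u v => simp [R.assoc]
    have h2 : ∀ z, (R.tensor R).mul (TensorProduct.comm K V V ((R.mul.flip c).rTensor V z))
        (e ⊗ₜ f) = TensorProduct.comm K V V ((R.tensor R).mul z (R.mul c f ⊗ₜ e)) := by
      intro z
      induction z with
      | zero => simp
      | add x y hx hy => simp only [map_add, LinearMap.add_apply, hx, hy]
      | tmul u v => simp [R.assoc]
    rw [h1, h2, h.mul_T2, ← h'.left_comul, hΔ, left_flip, TensorProduct.comm_tmul, lTensor_comm]

/-- `(Δ(a)(1 ⊗ b))(c ⊗ 1) = (Δ(a)(c ⊗ 1))(1 ⊗ b)`, with `Δ'` the co-opposite of `Δ`. -/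
theorem T1_mul_comm (h : IsMultiplierHopf R Δ) (h' : IsMultiplierHopf R Δ')
    (hΔ : ∀ a, Δ' a = R.flip (Δ a)) (a b c : V) :
    (R.mul.flip b).rTensor V (h'.T1 (a ⊗ₜ c))
      = TensorProduct.comm K V V ((R.mul.flip c).rTensor V (h.T1 (a ⊗ₜ b))) := by
  refine h.nondegenerate_tensor.eq_of_mul_right fun y => ?_
  induction y with
  | zero => simp
  | add x y hx hy => rw [map_add, map_add, hx, hy]
  | tmul e f =>
    have h1 : ∀ z, (R.tensor R).mul ((R.mul.flip b).rTensor V z) (e ⊗ₜ f)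
        = (R.tensor R).mul z (R.mul b e ⊗ₜ f) := by
      intro z
      induction z with
      | zero => simp
      | add x y hx hy => simp only [map_add, LinearMap.add_apply, hx, hy]
      | tmul u v => simp [R.assoc]
    have h2 : ∀ z, (R.tensor R).mul (TensorProduct.comm K V V ((R.mul.flip c).rTensor V z))
        (e ⊗ₜ f) = TensorProduct.comm K V V ((R.tensor R).mul z (R.mul c f ⊗ₜ e)) := by
      intro z
      induction z with
      | zero => simp
      | add x y hx hy => simp only [map_add, LinearMap.add_apply, hx, hy]
      | tmul u v => simp [R.assoc]
    rw [h1, h2, ← h'.left_comul, ← h.left_comul, hΔ, left_flip, TensorProduct.comm_tmul]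

theorem counit_cop (h : IsMultiplierHopf R Δ) (h' : IsMultiplierHopf R Δ')
    (hΔ : ∀ a, Δ' a = R.flip (Δ a)) : h.counit = h'.counit := by
  refine h'.eq_counit fun z => ?_
  induction z with
  | zero => simp
  | add x y hx hy => simp only [map_add, hx, hy]
  | tmul a b =>
    refine h.nondegenerate.eq_of_mul_left fun k => ?_
    rw [← sliceL_lTensor, T2_mul_eq_mul_T1 h h' hΔ, sliceL_comm, sliceR_rTensor, h.counit_T2]
    simp [R.assoc]

/-- `S(S'(b)a) = S(a)b`, where `S'` is the antipode of the co-opposite. Since the elements `S'(b)a`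
span the algebra, `S` takes values in the algebra. -/
theorem antipodeM_antipodeL (h : IsMultiplierHopf R Δ) (h' : IsMultiplierHopf R Δ')
    (hΔ : ∀ a, Δ' a = R.flip (Δ a)) (z : V ⊗[K] V) :
    h.antipodeM (TensorProduct.lift h'.antipodeL z)
      = R.of (TensorProduct.lift h.antipodeL (TensorProduct.comm K V V z)) := by
  obtain ⟨w, rfl⟩ := h'.T1.surjective z
  rw [h'.lift_antipodeL]
  induction w with
  | zero => simp
  | add x y hx hy => simp only [map_add, hx, hy]
  | tmul p q =>
    refine M.ext_left h.nondegenerate fun c => ?_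
    rw [left_of, sliceL_tmul, map_smul, M.left_smul, left_antipodeM]
    have h1 : ∀ z, R.mul (TensorProduct.lift h.antipodeL (TensorProduct.comm K V V z)) c
        = TensorProduct.lift h.antipodeL
          (TensorProduct.comm K V V ((R.mul.flip c).rTensor V z)) := by
      intro z
      induction z with
      | zero => simp
      | add x y hx hy => simp only [map_add, LinearMap.add_apply, hx, hy]
      | tmul u v => simp [h.antipodeL_mul_right]
    have h2 : ∀ z, TensorProduct.lift h.antipodeL ((R.mul.flip q).rTensor V z)
        = h.antipodeL q (TensorProduct.lift h.antipodeL z) := by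
      intro z
      induction z with
      | zero => simp
      | add x y hx hy => simp only [map_add, hx, hy]
      | tmul u v => simp [h.antipodeL_mul]
    have h3 : ∀ z : V ⊗[K] V, TensorProduct.comm K V V (TensorProduct.comm K V V z) = z := by
      intro z
      simp
    rw [h1, T1_mul_comm h h' hΔ, h3, h2, h.lift_antipodeL]
    simp [h.counit_cop h' hΔ]

theorem lift_antipodeL_surjective (h : IsMultiplierHopf R Δ) :
    Function.Surjective (TensorProduct.lift h.antipodeL) := by
  intro x
  obtain ⟨z, hz⟩ := h.sliceL_counit_surjective x
  exact ⟨h.T1 z, by rw [h.lift_antipodeL, hz]⟩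

/-- If the opposite comultiplication also defines a multiplier Hopf algebra, the antipode has values in
the algebra, not only in its multipliers. -/
theorem exists_of_eq_antipodeM (h : IsMultiplierHopf R Δ) (h' : IsMultiplierHopf R Δ')
    (hΔ : ∀ a, Δ' a = R.flip (Δ a)) : ∃ S : V →ₗ[K] V, ∀ a, R.of (S a) = h.antipodeM a := by
  have hr : ∀ a, h.antipodeM a ∈ LinearMap.range R.of := by
    intro a
    obtain ⟨z, rfl⟩ := h'.lift_antipodeL_surjective a
    exact ⟨_, (h.antipodeM_antipodeL h' hΔ z).symm⟩
  let e := LinearEquiv.ofInjective R.of (of_injective h.nondegenerate)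
  refine ⟨e.symm.toLinearMap ∘ₗ h.antipodeM.codRestrict _ hr, fun a => ?_⟩
  simp [e]

/-- The antipode of a regular multiplier Hopf algebra and the one of its co-opposite are mutually
inverse. -/
theorem antipode_comp (h : IsMultiplierHopf R Δ) (h' : IsMultiplierHopf R Δ')
    (hΔ : ∀ a, Δ' a = R.flip (Δ a)) {S S' : V →ₗ[K] V} (hS : ∀ a, R.of (S a) = h.antipodeM a)
    (hS' : ∀ a, R.of (S' a) = h'.antipodeM a) (a : V) : S (S' a) = a := by
  have hL : ∀ a b, h.antipodeL a b = R.mul (S a) b := fun a b => by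
    rw [← left_of, hS, left_antipodeM]
  have hR : ∀ a b, h.antipodeR b a = R.mul b (S a) := fun a b => by
    rw [← right_of, hS, right_antipodeM]
  have hL' : ∀ a b, h'.antipodeL a b = R.mul (S' a) b := fun a b => by
    rw [← left_of, hS', left_antipodeM]
  have h1 : ∀ b, R.mul (S b) (S (S' a)) = R.mul (S b) a := by
    intro b
    have h2 := h.antipodeM_antipodeL h' hΔ (a ⊗ₜ b)
    rw [TensorProduct.lift.tmul, hL', h.antipodeM_mul, ← hS, ← hS, TensorProduct.comm_tmul,
      TensorProduct.lift.tmul, hL] at h2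
    apply of_injective h.nondegenerate
    rw [← h2]
    exact M.ext (fun y => by simp [R.assoc]) (fun y => by simp [R.assoc])
  refine h.nondegenerate.eq_of_mul_left fun c => ?_
  obtain ⟨z, rfl⟩ := h.sliceR_counit_surjective c
  rw [← h.lift_antipodeR]
  generalize h.T2 z = w
  induction w with
  | zero => simp
  | add x y hx hy => simp only [map_add, LinearMap.add_apply, hx, hy]
  | tmul x y => simp [hR, R.assoc, h1]

end Regular

end IsMultiplierHopf

namespace RegularMHA

variable {K : Type*} [Field K] {V : Type*} [AddCommGroup V] [Module K V]

theorem cop_cop (H : RegularMHA K V) (a : V) :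
    H.comul a = H.toNUAlgebra.flip ((H.toNUAlgebra.flip ∘ₗ H.comul) a) :=
  (flip_flip _).symm

theorem exists_isCounit (H : RegularMHA K V) : ∃ ε, H.IsCounit ε :=
  ⟨H.isMultiplierHopf.counit, H.isMultiplierHopf.counit_mul,
    fun a b => H.isMultiplierHopf.counit_T1 (a ⊗ₜ b),
    fun a b => H.isMultiplierHopf.counit_T2 (a ⊗ₜ b)⟩

theorem isCounit_counit (H : RegularMHA K V) : H.IsCounit H.counit :=
  Classical.epsilon_spec H.exists_isCounit

theorem counit_eq (H : RegularMHA K V) {ε : V →ₗ[K] K}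
    (hε : ∀ a b, sliceL V ε (H.T₁ (a ⊗ₜ b)) = H.mul a b) : H.counit = ε := by
  have key : ∀ ε' : V →ₗ[K] K, (∀ a b, sliceL V ε' (H.T₁ (a ⊗ₜ b)) = H.mul a b) →
      ε' = H.isMultiplierHopf.counit := by
    intro ε' h'
    refine H.isMultiplierHopf.eq_counit fun z => ?_
    induction z with
    | zero => simp
    | add x y hx hy => simp only [map_add, hx, hy]
    | tmul a b => exact h' a b
  rw [key ε hε, key H.counit H.isCounit_counit.counit_left]

theorem counit_eq_isMultiplierHopf (H : RegularMHA K V) :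
    H.counit = H.isMultiplierHopf.counit :=
  H.counit_eq fun a b => H.isMultiplierHopf.counit_T1 (a ⊗ₜ b)

theorem counit_eq_cop (H : RegularMHA K V) : H.counit = H.isMultiplierHopf_cop.counit := by
  rw [H.counit_eq_isMultiplierHopf]
  exact H.isMultiplierHopf.counit_cop H.isMultiplierHopf_cop fun a => rfl

theorem exists_isAntipode (H : RegularMHA K V) : ∃ S, H.IsAntipode S := by
  obtain ⟨S, hS⟩ := H.isMultiplierHopf.exists_of_eq_antipodeM H.isMultiplierHopf_cop fun a => rfl
  obtain ⟨S', hS'⟩ := H.isMultiplierHopf_cop.exists_of_eq_antipodeM H.isMultiplierHopf H.cop_cop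
  refine ⟨LinearEquiv.ofLinearMap S S' (LinearMap.ext fun a => ?_) (LinearMap.ext fun a => ?_),
    fun a b => ?_, fun a b => ?_, fun a b => ?_⟩
  · exact H.isMultiplierHopf.antipode_comp H.isMultiplierHopf_cop (fun a => rfl) hS hS' a
  · exact H.isMultiplierHopf_cop.antipode_comp H.isMultiplierHopf H.cop_cop hS' hS a
  · apply of_injective H.isMultiplierHopf.nondegenerate
    rw [LinearEquiv.coe_ofLinearMap, hS, H.isMultiplierHopf.antipodeM_mul, ← hS, ← hS]
    exact M.ext (fun y => by simp [H.assoc]) (fun y => by simp [H.assoc])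
  · have h1 := H.isMultiplierHopf.lift_antipodeL (a ⊗ₜ b)
    rw [sliceL_tmul, ← H.counit_eq_isMultiplierHopf] at h1
    rw [← h1]
    change _ = TensorProduct.lift _ (H.T₁ (a ⊗ₜ b))
    generalize H.T₁ (a ⊗ₜ b) = z
    induction z with
    | zero => simp
    | add x y hx hy => simp only [map_add, hx, hy]
    | tmul u v =>
      rw [TensorProduct.lift.tmul, ← IsMultiplierHopf.left_antipodeM, ← hS]
      rfl
  · have h1 := H.isMultiplierHopf.lift_antipodeR (a ⊗ₜ b)
    rw [sliceR_tmul, ← H.counit_eq_isMultiplierHopf] at h1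
    rw [← h1]
    change _ = TensorProduct.lift _ (H.T₂ (a ⊗ₜ b))
    generalize H.T₂ (a ⊗ₜ b) = z
    induction z with
    | zero => simp
    | add x y hx hy => simp only [map_add, hx, hy]
    | tmul u v =>
      rw [TensorProduct.lift.tmul, ← IsMultiplierHopf.right_antipodeM, ← hS]
      rfl

theorem isAntipode_antipode (H : RegularMHA K V) : H.IsAntipode H.antipode :=
  Classical.epsilon_spec H.exists_isAntipode

/-- The antipode is determined by `m(S ⊗ ι)(Δ(a)(1 ⊗ b)) = ε(a)b`. -/
theorem antipode_eq (H : RegularMHA K V) {S : V →ₗ[K] V}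
    (hS : ∀ a b, TensorProduct.lift H.mul (S.rTensor V (H.T₁ (a ⊗ₜ b))) = H.counit a • b) (a : V) :
    H.antipode a = S a := by
  refine H.isMultiplierHopf.nondegenerate.eq_of_mul_right fun y => ?_
  obtain ⟨w, hw⟩ := H.T₁.surjective (a ⊗ₜ y)
  have key : ∀ w, TensorProduct.lift H.mul (H.antipode.toLinearMap.rTensor V (H.T₁ w))
      = TensorProduct.lift H.mul (S.rTensor V (H.T₁ w)) := by
    intro w
    induction w with
    | zero => simp
    | add x y hx hy => simp only [map_add, hx, hy]
    | tmul a b => rw [hS, H.isAntipode_antipode.antipode_left]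
  have key := key w
  rw [hw] at key
  simpa using key

end RegularMHA

/-! ### Modules with local units and their canonical maps -/

namespace NUAlgebra

variable {K : Type*} [Field K] {V W N N' P Q : Type*} [AddCommGroup V] [Module K V]
  [AddCommGroup W] [Module K W] [AddCommGroup N] [Module K N] [AddCommGroup N'] [Module K N']
  [AddCommGroup P] [Module K P] [AddCommGroup Q] [Module K Q]

/-- `act` makes `N` a left module over the algebra `R` in which every element has a local unit.
For an algebra with local units this is the same as `R N = N`. Right modules are modules over the
opposite algebra. -/
structure IsModule (R : NUAlgebra K V) (act : V →ₗ[K] N →ₗ[K] N) : Prop where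
  mul_act : ∀ h k n, act (R.mul h k) n = act h (act k n)
  exists_unit : ∀ n, ∃ e, act e n = n

namespace IsModule

variable {R : NUAlgebra K V} {S : NUAlgebra K W} {act : V →ₗ[K] N →ₗ[K] N}
  {act' : W →ₗ[K] N' →ₗ[K] N'}

/-- Finitely many elements have a common local unit. -/
theorem exists_unit_finset (h : R.IsModule act) (s : Finset N) :
    ∃ e, ∀ n ∈ s, act e n = n := by
  classical
  induction s using Finset.induction_on with
  | empty => exact ⟨0, by simp⟩
  | insert n₀ s _ ih =>
    obtain ⟨e₁, h₁⟩ := ih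
    obtain ⟨e₂, h₂⟩ := h.exists_unit (n₀ - act e₁ n₀)
    refine ⟨e₂ + e₁ - R.mul e₂ e₁, fun n hn => ?_⟩
    rw [map_sub, map_add, LinearMap.sub_apply, LinearMap.add_apply, h.mul_act]
    rcases Finset.mem_insert.1 hn with rfl | hn
    · rw [map_sub] at h₂
      rw [add_sub_right_comm, h₂, sub_add_cancel]
    · rw [h₁ n hn, add_sub_cancel_left]

theorem exists_unit_lTensor (h : R.IsModule act) (z : P ⊗[K] N) :
    ∃ e, (act e).lTensor P z = z := by
  classical
  obtain ⟨s, rfl⟩ := TensorProduct.exists_finset z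
  obtain ⟨e, he⟩ := h.exists_unit_finset (s.image Prod.snd)
  refine ⟨e, ?_⟩
  rw [map_sum]
  refine Finset.sum_congr rfl fun x hx => ?_
  rw [LinearMap.lTensor_tmul, he _ (Finset.mem_image_of_mem _ hx)]

theorem exists_unit_rTensor (h : R.IsModule act) (z : N ⊗[K] P) :
    ∃ e, (act e).rTensor P z = z := by
  obtain ⟨e, he⟩ := h.exists_unit_lTensor (TensorProduct.comm K N P z)
  refine ⟨e, (TensorProduct.comm K N P).injective ?_⟩
  rw [← lTensor_comm, he]

/-- A spanning action of an algebra with local units has local units. -/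
theorem of_surjective (hR : R.IsModule R.mul) (hmul : ∀ h k n, act (R.mul h k) n = act h (act k n))
    (hsurj : ∀ n, ∃ z : V ⊗[K] N, TensorProduct.lift act z = n) : R.IsModule act := by
  refine ⟨hmul, fun n => ?_⟩
  obtain ⟨z, rfl⟩ := hsurj n
  obtain ⟨e, he⟩ := hR.exists_unit_rTensor z
  refine ⟨e, ?_⟩
  conv_rhs => rw [← he]
  clear he
  induction z with
  | zero => simp
  | add x y hx hy => simp only [map_add, hx, hy]
  | tmul k n => simp [hmul]

theorem tensor (h : R.IsModule act) (h' : S.IsModule act') :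
    (R.tensor S).IsModule (TensorProduct.map₂ act act') := by
  refine ⟨fun x y z => ?_, fun z => ?_⟩
  · induction x with
    | zero => simp
    | add x₁ x₂ h₁ h₂ => simp only [map_add, LinearMap.add_apply, h₁, h₂]
    | tmul a b =>
      induction y with
      | zero => simp
      | add x₁ x₂ h₁ h₂ => simp only [map_add, LinearMap.add_apply, h₁, h₂]
      | tmul c d =>
        induction z with
        | zero => simp
        | add x₁ x₂ h₁ h₂ => simp only [map_add, h₁, h₂]
        | tmul e f => simp [h.mul_act, h'.mul_act]
  · obtain ⟨e, he⟩ := h.exists_unit_rTensor z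
    obtain ⟨f, hf⟩ := h'.exists_unit_lTensor z
    refine ⟨e ⊗ₜ f, ?_⟩
    rw [show TensorProduct.map₂ act act' (e ⊗ₜ f) = TensorProduct.map (act e) (act' f) by
      ext; simp, map_eq_rTensor_lTensor, hf, he]

/-- A module remains one when the action is restricted along an automorphism. -/
theorem comp (h : R.IsModule act) (σ : V ≃ₗ[K] V)
    (hσ : ∀ x y, σ (R.mul x y) = R.mul (σ x) (σ y)) : R.IsModule (act ∘ₗ σ.toLinearMap) := by
  refine ⟨fun x y n => by simp [hσ, h.mul_act], fun n => ?_⟩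
  obtain ⟨e, he⟩ := h.exists_unit n
  exact ⟨σ.symm e, by simpa using he⟩

theorem rTensor (h : R.IsModule act) :
    R.IsModule (LinearMap.rTensorHom P ∘ₗ act : V →ₗ[K] N ⊗[K] P →ₗ[K] N ⊗[K] P) := by
  refine ⟨fun x y z => ?_, fun z => ?_⟩
  · induction z with
    | zero => simp
    | add x₁ x₂ h₁ h₂ => simp only [map_add, h₁, h₂]
    | tmul e f => simp [h.mul_act]
  · obtain ⟨e, he⟩ := h.exists_unit_rTensor z
    exact ⟨e, by simpa using he⟩

theorem lTensor (h : R.IsModule act) :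
    R.IsModule (LinearMap.lTensorHom P ∘ₗ act : V →ₗ[K] P ⊗[K] N →ₗ[K] P ⊗[K] N) := by
  refine ⟨fun x y z => ?_, fun z => ?_⟩
  · induction z with
    | zero => simp
    | add x₁ x₂ h₁ h₂ => simp only [map_add, h₁, h₂]
    | tmul e f => simp [h.mul_act]
  · obtain ⟨e, he⟩ := h.exists_unit_lTensor z
    exact ⟨e, by simpa using he⟩

/-- Transport of a module structure along a linear isomorphism. -/
theorem conj (h : R.IsModule act) (e : N ≃ₗ[K] N') {act₂ : V →ₗ[K] N' →ₗ[K] N'}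
    (he : ∀ a n, act₂ a (e n) = e (act a n)) : R.IsModule act₂ := by
  refine ⟨fun x y z => ?_, fun z => ?_⟩
  · obtain ⟨n, rfl⟩ := e.surjective z
    rw [he, he, he, h.mul_act]
  · obtain ⟨n, rfl⟩ := e.surjective z
    obtain ⟨u, hu⟩ := h.exists_unit n
    exact ⟨u, by rw [he, hu]⟩

/-- Maps on `P ⊗ N` are determined by their values on the elements `p ⊗ h n`. -/
theorem ext_lTensor (h : R.IsModule act) {f g : P ⊗[K] N →ₗ[K] Q}
    (hfg : ∀ z n, f ((act.flip n).lTensor P z) = g ((act.flip n).lTensor P z)) : f = g := by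
  refine TensorProduct.ext' fun p n => ?_
  obtain ⟨e, he⟩ := h.exists_unit n
  simpa [he] using hfg (p ⊗ₜ e) n

/-- The functor `_ ⊗_R N`: a right `R`-linear map `P ⊗ R → Q ⊗ R` induces a map `P ⊗ N → Q ⊗ N`. -/
theorem exists_induced (hR : R.IsModule R.mul) (h : R.IsModule act)
    {F : P ⊗[K] V →ₗ[K] Q ⊗[K] V}
    (hF : ∀ k z, F ((R.mul.flip k).lTensor P z) = (R.mul.flip k).lTensor Q (F z)) :
    ∃ G : P ⊗[K] N →ₗ[K] Q ⊗[K] N,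
      ∀ z n, G ((act.flip n).lTensor P z) = (act.flip n).lTensor Q (F z) := by
  -- `π` is the surjection `p ⊗ h ⊗ n ↦ p ⊗ hn`; `F'` factors through it, because after inserting
  -- a local unit `e` of `h` it becomes `p ⊗ eh ⊗ n ↦ F(p ⊗ e)hn`.
  let π : (P ⊗[K] V) ⊗[K] N →ₗ[K] P ⊗[K] N :=
    TensorProduct.lift (LinearMap.lTensorHom P ∘ₗ act.flip).flip
  let F' : (P ⊗[K] V) ⊗[K] N →ₗ[K] Q ⊗[K] N :=
    TensorProduct.lift (LinearMap.lTensorHom Q ∘ₗ act.flip).flip ∘ₗ F.rTensor N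
  have hπ : ∀ z n, π (z ⊗ₜ n) = (act.flip n).lTensor P z := fun z n => by simp [π]
  have hF' : ∀ z n, F' (z ⊗ₜ n) = (act.flip n).lTensor Q (F z) := fun z n => by simp [F']
  have hker : ∀ w, π w = 0 → F' w = 0 := by
    intro w hw
    obtain ⟨e, he⟩ := (hR.lTensor (P := P)).exists_unit_rTensor w
    let G : P ⊗[K] N →ₗ[K] Q ⊗[K] N :=
      TensorProduct.lift (((LinearMap.lTensorHom Q ∘ₗ act.flip).flip) ∘ₗ F ∘ₗ
        (TensorProduct.mk K P V).flip e)
    have hG : ∀ w, F' (((LinearMap.lTensorHom P ∘ₗ R.mul) e).rTensor N w) = G (π w) := by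
      intro w
      induction w with
      | zero => simp
      | add x y hx hy => simp only [map_add, hx, hy]
      | tmul z n =>
        induction z with
        | zero => simp
        | add x y hx hy => simp only [map_add, TensorProduct.add_tmul, hx, hy]
        | tmul p k =>
          have h1 := hF k (p ⊗ₜ e)
          simp only [LinearMap.lTensor_tmul, LinearMap.flip_apply] at h1
          rw [hπ, LinearMap.rTensor_tmul, hF']
          simp only [LinearMap.comp_apply, LinearMap.coe_lTensorHom, LinearMap.lTensor_tmul, G, h1,
            TensorProduct.lift.tmul, LinearMap.flip_apply, TensorProduct.mk_apply]
          rw [← LinearMap.lTensor_comp_apply]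
          congr 2
          ext x
          simp [h.mul_act]
    rw [← he, hG, hw, map_zero]
  have hsurj : LinearMap.range π = ⊤ := by
    rw [LinearMap.range_eq_top]
    intro y
    induction y with
    | zero => exact ⟨0, map_zero _⟩
    | add x y hx hy =>
      obtain ⟨a, rfl⟩ := hx
      obtain ⟨b, rfl⟩ := hy
      exact ⟨a + b, map_add _ _ _⟩
    | tmul p n =>
      obtain ⟨e, he⟩ := h.exists_unit n
      exact ⟨(p ⊗ₜ e) ⊗ₜ n, by simp [hπ, he]⟩
  obtain ⟨s, hs⟩ := π.exists_rightInverse_of_surjective hsurj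
  refine ⟨F' ∘ₗ s, fun z n => ?_⟩
  rw [← hπ, ← hF', LinearMap.comp_apply, ← sub_eq_zero, ← map_sub]
  apply hker
  rw [map_sub, ← LinearMap.comp_apply, hs, LinearMap.id_apply, sub_self]

/-- The equivalence `V ⊗ N ≃ V ⊗ N` induced by a right `R`-linear equivalence `τ` of `V ⊗ V`. -/
theorem exists_inducedEquiv (hR : R.IsModule R.mul) (h : R.IsModule act)
    {τ : V ⊗[K] V ≃ₗ[K] V ⊗[K] V}
    (hτ : ∀ k z, τ ((R.mul.flip k).lTensor V z) = (R.mul.flip k).lTensor V (τ z)) :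
    ∃ G : V ⊗[K] N ≃ₗ[K] V ⊗[K] N,
      ∀ z n, G ((act.flip n).lTensor V z) = (act.flip n).lTensor V (τ z) := by
  have hτ' : ∀ k z, τ.symm ((R.mul.flip k).lTensor V z) = (R.mul.flip k).lTensor V (τ.symm z) := by
    intro k z
    apply τ.injective
    rw [hτ, LinearEquiv.apply_symm_apply, LinearEquiv.apply_symm_apply]
  obtain ⟨G, hG⟩ := exists_induced hR h (F := τ.toLinearMap) hτ
  obtain ⟨G', hG'⟩ := exists_induced hR h (F := τ.symm.toLinearMap) hτ'
  refine ⟨LinearEquiv.ofLinearMap G G' (h.ext_lTensor fun z n => ?_)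
    (h.ext_lTensor fun z n => ?_), fun z n => hG z n⟩
  · rw [LinearMap.comp_apply, hG', hG]
    simp
  · rw [LinearMap.comp_apply, hG, hG']
    simp

/-- A right `R`-linear endomorphism of `R` induces an endomorphism of every module. -/
theorem exists_extension (hR : R.IsModule R.mul) (h : R.IsModule act)
    {F : V →ₗ[K] V} (hF : ∀ x y, F (R.mul x y) = R.mul (F x) y) :
    ∃ G : N →ₗ[K] N, ∀ x n, G (act x n) = act (F x) n := by
  obtain ⟨G, hG⟩ := exists_induced (P := K) (Q := K) hR h (F := F.lTensor K) (by
    intro k z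
    rw [← LinearMap.lTensor_comp_apply, ← LinearMap.lTensor_comp_apply]
    congr 2
    ext x
    simp [hF])
  refine ⟨(TensorProduct.lid K N).toLinearMap ∘ₗ G ∘ₗ (TensorProduct.lid K N).symm.toLinearMap,
    fun x n => ?_⟩
  have := hG (1 ⊗ₜ x) n
  simp only [LinearMap.lTensor_tmul, LinearMap.flip_apply] at this
  simp [this]

theorem ext_act (h : R.IsModule act) {f g : N →ₗ[K] Q} (hfg : ∀ x n, f (act x n) = g (act x n)) :
    f = g := by
  ext n
  obtain ⟨e, he⟩ := h.exists_unit n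
  rw [← he, hfg]

end IsModule

/-- The algebra `R` is non-degenerate and has left and right local units. -/
structure HasLocalUnits (R : NUAlgebra K V) : Prop where
  nondegenerate : R.Nondegenerate
  left : R.IsModule R.mul
  right : R.opp.IsModule R.opp.mul

theorem isModule_tensor_opp {R : NUAlgebra K V} {S : NUAlgebra K W} {act : V ⊗[K] W →ₗ[K] N →ₗ[K] N}
    (h : (R.opp.tensor S.opp).IsModule act) : (R.tensor S).opp.IsModule act :=
  ⟨fun x y n => by rw [← h.mul_act, tensor_opp_mul]; rfl, h.exists_unit⟩

theorem HasLocalUnits.tensor {R : NUAlgebra K V} {S : NUAlgebra K W} (hR : R.HasLocalUnits)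
    (hS : S.HasLocalUnits) : (R.tensor S).HasLocalUnits := by
  refine ⟨hR.nondegenerate.tensor hS.nondegenerate, hR.left.tensor hS.left,
    ⟨fun x y n => ((R.tensor S).opp.assoc x y n), fun z => ?_⟩⟩
  obtain ⟨e, he⟩ := (hR.right.tensor hS.right).exists_unit z
  exact ⟨e, by rw [opp_mul, ← tensor_opp_mul]; exact he⟩

/-- A non-degenerate homomorphism `R → M(Y)`: it is given by a left and a right action of `R` on `Y`,
for which `Y` is a unital module on both sides. -/
structure NondegHom (R : NUAlgebra K V) (Y : NUAlgebra K N) where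
  l : V →ₗ[K] N →ₗ[K] N
  r : V →ₗ[K] N →ₗ[K] N
  isModule_l : R.IsModule l
  isModule_r : R.opp.IsModule r
  compat : ∀ h x y, Y.mul x (l h y) = Y.mul (r h x) y

namespace NondegHom

variable {R : NUAlgebra K V} {S : NUAlgebra K W} {Y : NUAlgebra K N} {Y' : NUAlgebra K N'}

theorem l_mul (j : R.NondegHom Y) (hY : Y.Nondegenerate) (h : V) (x y : N) :
    j.l h (Y.mul x y) = Y.mul (j.l h x) y :=
  hY.eq_of_mul_left fun z => by rw [j.compat, ← Y.assoc, ← j.compat, Y.assoc]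

theorem r_mul (j : R.NondegHom Y) (hY : Y.Nondegenerate) (h : V) (x y : N) :
    j.r h (Y.mul x y) = Y.mul x (j.r h y) :=
  hY.eq_of_mul_right fun z => by rw [← j.compat, Y.assoc, j.compat, Y.assoc]

/-- The tensor product `R ⊗ S → M(Y ⊗ Y')` of non-degenerate homomorphisms. -/
def tensor (j : R.NondegHom Y) (j' : S.NondegHom Y') : (R.tensor S).NondegHom (Y.tensor Y') where
  l := TensorProduct.map₂ j.l j'.l
  r := TensorProduct.map₂ j.r j'.r
  isModule_l := j.isModule_l.tensor j'.isModule_l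
  isModule_r := isModule_tensor_opp (j.isModule_r.tensor j'.isModule_r)
  compat h x y := by
    induction h with
    | zero => simp
    | add x₁ x₂ h₁ h₂ => simp only [map_add, LinearMap.add_apply, h₁, h₂]
    | tmul a b =>
      induction x with
      | zero => simp
      | add x₁ x₂ h₁ h₂ => simp only [map_add, LinearMap.add_apply, h₁, h₂]
      | tmul c d =>
        induction y with
        | zero => simp
        | add x₁ x₂ h₁ h₂ => simp only [map_add, h₁, h₂]
        | tmul e f => simp [j.compat, j'.compat]

/-- Precomposition of a non-degenerate homomorphism with an automorphism. -/
def comp (j : R.NondegHom Y) (σ : V ≃ₗ[K] V) (hσ : ∀ x y, σ (R.mul x y) = R.mul (σ x) (σ y)) :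
    R.NondegHom Y where
  l := j.l ∘ₗ σ.toLinearMap
  r := j.r ∘ₗ σ.toLinearMap
  isModule_l := j.isModule_l.comp σ hσ
  isModule_r := j.isModule_r.comp σ fun x y => hσ y x
  compat h x y := j.compat (σ h) x y

theorem exists_extend (j : R.NondegHom Y) (hR : R.HasLocalUnits) (m : R.M) : ∃ m' : Y.M,
    (∀ x y, M.left m' (j.l x y) = j.l (M.left m x) y) ∧
    (∀ x y, M.right m' (j.r x y) = j.r (M.right m x) y) := by
  obtain ⟨L, hL⟩ := IsModule.exists_extension hR.left j.isModule_l (F := M.left m)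
    (M.left_mul_right hR.nondegenerate m)
  obtain ⟨L', hL'⟩ := IsModule.exists_extension (R := R.opp) hR.right j.isModule_r
    (F := M.right m) (fun x y => M.right_mul_left hR.nondegenerate m y x)
  refine ⟨⟨(L, MulOpposite.op L'), fun x y => ?_⟩, hL, hL'⟩
  obtain ⟨e, he⟩ := j.isModule_r.exists_unit x
  obtain ⟨f, hf⟩ := j.isModule_l.exists_unit y
  -- with `x = x e` and `y = f y`, both sides are `x ((e m f) y)`
  change Y.mul x (L y) = Y.mul (L' x) y
  conv_lhs => rw [← he, ← hf, hL, ← j.compat, ← j.isModule_l.mul_act, M.compat,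
    j.isModule_l.mul_act, j.compat, hf]
  conv_rhs => rw [← he, hL']

/-- The extension of a non-degenerate homomorphism `R → M(Y)` to the multiplier algebra of `R`. -/
def extend (j : R.NondegHom Y) (hR : R.HasLocalUnits) : R.M →ₗ[K] Y.M where
  toFun m := (j.exists_extend hR m).choose
  map_add' m n := by
    refine M.ext (LinearMap.congr_fun (j.isModule_l.ext_act fun x y => ?_))
      (LinearMap.congr_fun (j.isModule_r.ext_act fun x y => ?_))
    · refine ((j.exists_extend hR (m + n)).choose_spec.1 x y).trans ?_
      rw [M.left_add, M.left_add, map_add, LinearMap.add_apply,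
        (j.exists_extend hR m).choose_spec.1, (j.exists_extend hR n).choose_spec.1]
    · refine ((j.exists_extend hR (m + n)).choose_spec.2 x y).trans ?_
      rw [M.right_add, M.right_add, map_add, LinearMap.add_apply,
        (j.exists_extend hR m).choose_spec.2, (j.exists_extend hR n).choose_spec.2]
  map_smul' c m := by
    refine M.ext (LinearMap.congr_fun (j.isModule_l.ext_act fun x y => ?_))
      (LinearMap.congr_fun (j.isModule_r.ext_act fun x y => ?_))
    · refine ((j.exists_extend hR (c • m)).choose_spec.1 x y).trans ?_
      rw [M.left_smul, RingHom.id_apply, M.left_smul, map_smul, LinearMap.smul_apply,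
        (j.exists_extend hR m).choose_spec.1]
    · refine ((j.exists_extend hR (c • m)).choose_spec.2 x y).trans ?_
      rw [M.right_smul, RingHom.id_apply, M.right_smul, map_smul, LinearMap.smul_apply,
        (j.exists_extend hR m).choose_spec.2]

theorem left_extend (j : R.NondegHom Y) (hR : R.HasLocalUnits) (m : R.M) (x : V) (y : N) :
    M.left (j.extend hR m) (j.l x y) = j.l (M.left m x) y :=
  (j.exists_extend hR m).choose_spec.1 x y

theorem right_extend (j : R.NondegHom Y) (hR : R.HasLocalUnits) (m : R.M) (x : V) (y : N) :
    M.right (j.extend hR m) (j.r x y) = j.r (M.right m x) y :=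
  (j.exists_extend hR m).choose_spec.2 x y

theorem extend_mul (j : R.NondegHom Y) (hR : R.HasLocalUnits) (m n : R.M) :
    j.extend hR (m * n) = j.extend hR m * j.extend hR n :=
  M.ext (LinearMap.congr_fun (j.isModule_l.ext_act fun x y => by simp [left_extend]))
    (LinearMap.congr_fun (j.isModule_r.ext_act fun x y => by simp [right_extend]))

end NondegHom

end NUAlgebra

namespace IsMultiplierHopf

variable {K : Type*} [Field K] {V N N' : Type*} [AddCommGroup V] [Module K V]
  [AddCommGroup N] [Module K N] [AddCommGroup N'] [Module K N']
  {R : NUAlgebra K V} {Δ Δ' : V →ₗ[K] (R.tensor R).M}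

theorem T1_flip_mul (h : IsMultiplierHopf R Δ) (k : V) (z : V ⊗[K] V) :
    h.T1 ((R.mul.flip k).lTensor V z) = (R.mul.flip k).lTensor V (h.T1 z) := by
  induction z with
  | zero => simp
  | add x y hx hy => simp only [map_add, hx, hy]
  | tmul x y => exact h.T1_mul_right x y k

/-- The map `a ⊗ b ↦ (b ⊗ 1)Δ(a)`, with the two legs of the result interchanged. -/
def T2flip (h : IsMultiplierHopf R Δ) : (V ⊗[K] V) ≃ₗ[K] (V ⊗[K] V) :=
  (TensorProduct.comm K V V).trans (h.T2.trans (TensorProduct.comm K V V))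

theorem T2flip_tmul (h : IsMultiplierHopf R Δ) (a b : V) :
    h.T2flip (a ⊗ₜ b) = TensorProduct.comm K V V (h.T2 (b ⊗ₜ a)) := rfl

theorem T2flip_mul (h : IsMultiplierHopf R Δ) (k : V) (z : V ⊗[K] V) :
    h.T2flip ((R.opp.mul.flip k).lTensor V z) = (R.opp.mul.flip k).lTensor V (h.T2flip z) := by
  induction z with
  | zero => simp
  | add x y hx hy => simp only [map_add, hx, hy]
  | tmul x y =>
    rw [LinearMap.lTensor_tmul, T2flip_tmul, T2flip_tmul, lTensor_comm]
    exact congrArg _ (h.T2_mul_left y x k)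

variable {act : V →ₗ[K] N →ₗ[K] N} {act' : V →ₗ[K] N' →ₗ[K] N'}

/-- For a left module `N`, the canonical map `a ⊗ n ↦ a₍₁₎ ⊗ a₍₂₎n`. -/
def canL (h : IsMultiplierHopf R Δ) (hR : R.HasLocalUnits) (hN : R.IsModule act) :
    V ⊗[K] N ≃ₗ[K] V ⊗[K] N :=
  (IsModule.exists_inducedEquiv hR.left hN h.T1_flip_mul).choose

theorem canL_act (h : IsMultiplierHopf R Δ) (hR : R.HasLocalUnits) (hN : R.IsModule act)
    (z : V ⊗[K] V) (n : N) :
    h.canL hR hN ((act.flip n).lTensor V z) = (act.flip n).lTensor V (h.T1 z) :=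
  (IsModule.exists_inducedEquiv hR.left hN h.T1_flip_mul).choose_spec z n

theorem canL_tmul_act (h : IsMultiplierHopf R Δ) (hR : R.HasLocalUnits) (hN : R.IsModule act)
    (a e : V) (n : N) :
    h.canL hR hN (a ⊗ₜ act e n) = (act.flip n).lTensor V (h.T1 (a ⊗ₜ e)) :=
  h.canL_act hR hN (a ⊗ₜ e) n

/-- For a right module `N`, the canonical map `a ⊗ n ↦ a₍₂₎ ⊗ na₍₁₎`. -/
def canR (h : IsMultiplierHopf R Δ) (hR : R.HasLocalUnits) (hN : R.opp.IsModule act) :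
    V ⊗[K] N ≃ₗ[K] V ⊗[K] N :=
  (IsModule.exists_inducedEquiv hR.right hN h.T2flip_mul).choose

theorem canR_act (h : IsMultiplierHopf R Δ) (hR : R.HasLocalUnits) (hN : R.opp.IsModule act)
    (z : V ⊗[K] V) (n : N) :
    h.canR hR hN ((act.flip n).lTensor V z) = (act.flip n).lTensor V (h.T2flip z) :=
  (IsModule.exists_inducedEquiv hR.right hN h.T2flip_mul).choose_spec z n

theorem canR_tmul_act (h : IsMultiplierHopf R Δ) (hR : R.HasLocalUnits) (hN : R.opp.IsModule act)
    (a e : V) (n : N) : h.canR hR hN (a ⊗ₜ act e n)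
      = (act.flip n).lTensor V (TensorProduct.comm K V V (h.T2 (e ⊗ₜ a))) :=
  h.canR_act hR hN (a ⊗ₜ e) n

theorem canL_natural (h : IsMultiplierHopf R Δ) (hR : R.HasLocalUnits) (hN : R.IsModule act)
    (hN' : R.IsModule act') {f : N →ₗ[K] N'} (hf : ∀ a n, f (act a n) = act' a (f n))
    (z : V ⊗[K] N) : h.canL hR hN' (f.lTensor V z) = f.lTensor V (h.canL hR hN z) := by
  have key : (h.canL hR hN').toLinearMap ∘ₗ f.lTensor V
      = f.lTensor V ∘ₗ (h.canL hR hN).toLinearMap := by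
    refine hN.ext_lTensor fun z n => ?_
    simp only [LinearMap.comp_apply, LinearEquiv.coe_coe, canL_act]
    rw [← LinearMap.lTensor_comp_apply, ← LinearMap.lTensor_comp_apply,
      show f ∘ₗ act.flip n = act'.flip (f n) from LinearMap.ext fun a => hf a n, canL_act]
  exact LinearMap.congr_fun key z

theorem canR_natural (h : IsMultiplierHopf R Δ) (hR : R.HasLocalUnits) (hN : R.opp.IsModule act)
    (hN' : R.opp.IsModule act') {f : N →ₗ[K] N'} (hf : ∀ a n, f (act a n) = act' a (f n))
    (z : V ⊗[K] N) : h.canR hR hN' (f.lTensor V z) = f.lTensor V (h.canR hR hN z) := by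
  have key : (h.canR hR hN').toLinearMap ∘ₗ f.lTensor V
      = f.lTensor V ∘ₗ (h.canR hR hN).toLinearMap := by
    refine hN.ext_lTensor fun z n => ?_
    simp only [LinearMap.comp_apply, LinearEquiv.coe_coe, canR_act]
    rw [← LinearMap.lTensor_comp_apply, ← LinearMap.lTensor_comp_apply,
      show f ∘ₗ act.flip n = act'.flip (f n) from LinearMap.ext fun a => hf a n, canR_act]
  exact LinearMap.congr_fun key z

/-- A slice `(f ⊗ ι)(Δ(a)(1 ⊗ k)) = g(a)k` of the coproduct gives `f(a₍₁₎)a₍₂₎n = g(a)n`. -/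
theorem sliceL_canL (h : IsMultiplierHopf R Δ) (hR : R.HasLocalUnits) (hN : R.IsModule act)
    {f : V →ₗ[K] K} {g : V →ₗ[K] V} (hfg : ∀ a k, sliceL V f (h.T1 (a ⊗ₜ k)) = R.mul (g a) k)
    (a : V) (n : N) : sliceL N f (h.canL hR hN (a ⊗ₜ n)) = act (g a) n := by
  obtain ⟨e, he⟩ := hN.exists_unit n
  conv_lhs => rw [← he]
  rw [canL_tmul_act, sliceL_lTensor, hfg, LinearMap.flip_apply, hN.mul_act, he]

theorem counit_canL (h : IsMultiplierHopf R Δ) (hR : R.HasLocalUnits) (hN : R.IsModule act)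
    (a : V) (n : N) : sliceL N h.counit (h.canL hR hN (a ⊗ₜ n)) = act a n :=
  h.sliceL_canL hR hN (g := LinearMap.id) (fun a k => h.counit_T1 (a ⊗ₜ k)) a n

/-- The form `S(a₍₁₎)a₍₂₎n = ε(a)n` of the antipode identity on a module. -/
theorem lift_canL (h : IsMultiplierHopf R Δ) (hR : R.HasLocalUnits) (hN : R.IsModule act)
    {S : V →ₗ[K] V} (hS : ∀ a b, TensorProduct.lift R.mul (S.rTensor V (h.T1 (a ⊗ₜ b)))
      = h.counit a • b) (a : V) (n : N) :
    TensorProduct.lift (act ∘ₗ S) (h.canL hR hN (a ⊗ₜ n)) = h.counit a • n := by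
  obtain ⟨e, he⟩ := hN.exists_unit n
  conv_lhs => rw [← he]
  rw [canL_tmul_act]
  have key : ∀ z, TensorProduct.lift (act ∘ₗ S) ((act.flip n).lTensor V z)
      = act (TensorProduct.lift R.mul (S.rTensor V z)) n := by
    intro z
    induction z with
    | zero => simp
    | add x y hx hy => simp only [map_add, LinearMap.add_apply, hx, hy]
    | tmul x y => simp [hN.mul_act]
  rw [key, hS, map_smul, LinearMap.smul_apply, he]

end IsMultiplierHopf

namespace RegularMHA

variable {K : Type*} [Field K] {V : Type*} [AddCommGroup V] [Module K V]

theorem exists_left_unit (H : RegularMHA K V) (a : V) : ∃ e, H.mul e a = a := by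
  rcases subsingleton_or_nontrivial V with hV | hV
  · exact ⟨0, Subsingleton.elim _ _⟩
  have h := H.isMultiplierHopf
  obtain ⟨p, hp⟩ := h.exists_counit_eq_one
  -- `Δ(p)(1 ⊗ a)` lies in `V ⊗ Va`, since `(k ⊗ 1)Δ(p)(1 ⊗ a)` does for all `k`
  have hex : Function.Exact (H.mul.flip a) (LinearMap.range (H.mul.flip a)).mkQ :=
    LinearMap.exact_iff.2 (Submodule.ker_mkQ _)
  have h1 : (LinearMap.range (H.mul.flip a)).mkQ.lTensor V (H.T₁ (p ⊗ₜ a)) = 0 := by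
    refine rTensor_joint (f := fun k => H.mul k) h.nondegenerate.2 fun k => ?_
    have h2 := h.mul_T1_eq_T2_mul k p a
    rw [← LinearMap.comp_apply, LinearMap.rTensor_comp_lTensor, ← LinearMap.lTensor_comp_rTensor,
      LinearMap.comp_apply]
    rw [map_zero]
    refine (congrArg _ h2).trans ?_
    exact (lTensor_exact V hex (Submodule.mkQ_surjective _)).apply_apply_eq_zero _
  obtain ⟨z, hz⟩ := (lTensor_exact V hex (Submodule.mkQ_surjective _) _).1 h1
  have h3 := H.isAntipode_antipode.antipode_left p a
  rw [← hz, H.counit_eq_isMultiplierHopf, hp, one_smul] at h3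
  refine ⟨TensorProduct.lift H.mul (H.antipode.toLinearMap.rTensor V z), ?_⟩
  conv_rhs => rw [← h3]
  clear hz h3
  induction z with
  | zero => simp
  | add x y hx hy => simp only [map_add, LinearMap.add_apply, hx, hy]
  | tmul x y => simp [H.assoc]

theorem exists_right_unit (H : RegularMHA K V) (a : V) : ∃ e, H.mul a e = a := by
  rcases subsingleton_or_nontrivial V with hV | hV
  · exact ⟨0, Subsingleton.elim _ _⟩
  have h := H.isMultiplierHopf
  obtain ⟨p, hp⟩ := h.exists_counit_eq_one
  have hex : Function.Exact (H.mul a) (LinearMap.range (H.mul a)).mkQ :=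
    LinearMap.exact_iff.2 (Submodule.ker_mkQ _)
  have h1 : (LinearMap.range (H.mul a)).mkQ.rTensor V (H.T₂ (a ⊗ₜ p)) = 0 := by
    refine lTensor_joint (f := fun k => H.mul.flip k) h.nondegenerate.1 fun k => ?_
    have h2 := h.mul_T1_eq_T2_mul a p k
    rw [← LinearMap.comp_apply, LinearMap.lTensor_comp_rTensor, ← LinearMap.rTensor_comp_lTensor,
      LinearMap.comp_apply, map_zero]
    refine (congrArg _ h2.symm).trans ?_
    exact (rTensor_exact V hex (Submodule.mkQ_surjective _)).apply_apply_eq_zero _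
  obtain ⟨z, hz⟩ := (rTensor_exact V hex (Submodule.mkQ_surjective _) _).1 h1
  have h3 := H.isAntipode_antipode.antipode_right a p
  rw [← hz, H.counit_eq_isMultiplierHopf, hp, one_smul] at h3
  refine ⟨TensorProduct.lift H.mul (H.antipode.toLinearMap.lTensor V z), ?_⟩
  conv_rhs => rw [← h3]
  clear hz h3
  induction z with
  | zero => simp
  | add x y hx hy => simp only [map_add, hx, hy]
  | tmul x y => simp [H.assoc]

/-- Regular multiplier Hopf algebras have local units. -/
theorem hasLocalUnits (H : RegularMHA K V) : H.HasLocalUnits :=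
  ⟨H.isMultiplierHopf.nondegenerate, ⟨H.assoc, H.exists_left_unit⟩,
    ⟨H.opp.assoc, H.exists_right_unit⟩⟩

end RegularMHA

/-! ### Pairings -/

namespace IsMultiplierHopf

variable {K : Type*} [Field K] {V : Type*} [AddCommGroup V] [Module K V]
  {R : NUAlgebra K V} {Δ Δ' : V →ₗ[K] (R.tensor R).M}

/-- `Δ(a)(e ⊗ f) = (Δ(a)(1 ⊗ f))(e ⊗ 1)`. -/
theorem left_comul_tmul (h : IsMultiplierHopf R Δ) (a e f : V) :
    M.left (Δ a) (e ⊗ₜ f) = (R.mul.flip e).rTensor V (h.T1 (a ⊗ₜ f)) := by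
  refine h.nondegenerate_tensor.eq_of_mul_right fun y => ?_
  induction y with
  | zero => simp
  | add x y hx hy => rw [map_add, map_add, hx, hy]
  | tmul g k =>
    rw [← M.left_mul_right h.nondegenerate_tensor, tensor_mul_tmul, h.left_comul]
    generalize h.T1 (a ⊗ₜ f) = z
    induction z with
    | zero => simp
    | add x y hx hy => simp only [map_add, LinearMap.add_apply, hx, hy]
    | tmul u v => simp [R.assoc]

/-- `(e ⊗ f)Δ(a) = (1 ⊗ f)((e ⊗ 1)Δ(a))`. -/
theorem right_comul_tmul (h : IsMultiplierHopf R Δ) (a e f : V) :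
    M.right (Δ a) (e ⊗ₜ f) = (R.mul f).lTensor V (h.T2 (e ⊗ₜ a)) := by
  refine h.nondegenerate_tensor.eq_of_mul_left fun y => ?_
  induction y with
  | zero => simp
  | add x y hx hy => rw [map_add, LinearMap.add_apply, hx, hy, LinearMap.add_apply]
  | tmul g k =>
    rw [← M.right_mul_left h.nondegenerate_tensor, tensor_mul_tmul, h.right_comul]
    generalize h.T2 (e ⊗ₜ a) = z
    induction z with
    | zero => simp
    | add x y hx hy => simp only [map_add, hx, hy]
    | tmul u v => simp [R.assoc]

theorem counit_T1_right (h : IsMultiplierHopf R Δ) (a b : V) :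
    sliceR V h.counit (h.T1 (a ⊗ₜ b)) = h.counit b • a := by
  refine h.nondegenerate.eq_of_mul_left fun c => ?_
  rw [← sliceR_rTensor, h.mul_T1_eq_T2_mul, sliceR_lTensor,
    show h.counit ∘ₗ R.mul.flip b = h.counit b • h.counit from
      LinearMap.ext fun x => by simp [h.counit_mul, mul_comm]]
  have : sliceR V (h.counit b • h.counit) = h.counit b • sliceR V h.counit := by
    apply TensorProduct.ext'
    intro x y
    simp [smul_smul]
  rw [this, LinearMap.smul_apply, h.counit_T2]
  simp

theorem T1_congr (h : IsMultiplierHopf R Δ) (α : V ≃ₗ[K] V)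
    (hα : ∀ x y, α (R.mul x y) = R.mul (α x) (α y))
    (hΔ : ∀ a z, M.left (Δ (α a)) (TensorProduct.congr α α z)
      = TensorProduct.congr α α (M.left (Δ a) z)) (a b : V) :
    h.T1 (α a ⊗ₜ α b) = TensorProduct.congr α α (h.T1 (a ⊗ₜ b)) := by
  refine h.nondegenerate_tensor.eq_of_mul_right fun y => ?_
  obtain ⟨y, rfl⟩ := (TensorProduct.congr α α).surjective y
  induction y with
  | zero => simp
  | add x y hx hy => rw [map_add, map_add, hx, hy, map_add]
  | tmul e f =>
    rw [← congr_mul R α α hα hα, ← h.left_comul, ← hΔ]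
    simp [← h.left_comul, hα]

theorem T2_congr (h : IsMultiplierHopf R Δ) (α : V ≃ₗ[K] V)
    (hα : ∀ x y, α (R.mul x y) = R.mul (α x) (α y))
    (hΔ : ∀ a z, M.left (Δ (α a)) (TensorProduct.congr α α z)
      = TensorProduct.congr α α (M.left (Δ a) z)) (a b : V) :
    h.T2 (α a ⊗ₜ α b) = TensorProduct.congr α α (h.T2 (a ⊗ₜ b)) := by
  refine h.nondegenerate_tensor.eq_of_mul_right fun y => ?_
  obtain ⟨y, rfl⟩ := (TensorProduct.congr α α).surjective y
  rw [← congr_mul R α α hα hα, h.mul_T2, h.mul_T2, hΔ]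
  generalize M.left (Δ b) y = z
  induction z with
  | zero => simp
  | add x y hx hy => simp only [map_add, hx, hy]
  | tmul u v => simp [hα]

end IsMultiplierHopf

namespace RegularMHA

variable {K : Type*} [Field K] {V : Type*} [AddCommGroup V] [Module K V]

theorem of_antipode_symm (H : RegularMHA K V) (a : V) :
    H.of (H.antipode.symm a) = H.isMultiplierHopf_cop.antipodeM a := by
  obtain ⟨S, hS⟩ := H.isMultiplierHopf.exists_of_eq_antipodeM H.isMultiplierHopf_cop fun a => rfl
  obtain ⟨S', hS'⟩ := H.isMultiplierHopf_cop.exists_of_eq_antipodeM H.isMultiplierHopf H.cop_cop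
  have h1 : ∀ a, H.antipode a = S a := by
    refine H.antipode_eq fun a b => ?_
    have h1 := H.isMultiplierHopf.lift_antipodeL (a ⊗ₜ b)
    rw [sliceL_tmul, ← H.counit_eq_isMultiplierHopf] at h1
    rw [← h1]
    change _ = TensorProduct.lift _ (H.T₁ (a ⊗ₜ b))
    generalize H.T₁ (a ⊗ₜ b) = z
    induction z with
    | zero => simp
    | add x y hx hy => simp only [map_add, hx, hy]
    | tmul u v =>
      rw [TensorProduct.lift.tmul, ← IsMultiplierHopf.left_antipodeM, ← hS]
      rfl
  rw [← hS']
  congr 1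
  rw [LinearEquiv.symm_apply_eq, h1]
  exact (H.isMultiplierHopf.antipode_comp H.isMultiplierHopf_cop (fun a => rfl) hS hS' a).symm

/-- The antipode identity `S⁻¹(a₍₂₎)a₍₁₎b = ε(a)b`. -/
theorem antipode_symm_left (H : RegularMHA K V) (a b : V) :
    TensorProduct.lift H.mul (H.antipode.symm.toLinearMap.rTensor V
      (H.isMultiplierHopf_cop.T1 (a ⊗ₜ b))) = H.isMultiplierHopf_cop.counit a • b := by
  have h1 := H.isMultiplierHopf_cop.lift_antipodeL (a ⊗ₜ b)
  rw [sliceL_tmul] at h1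
  rw [← h1]
  generalize H.isMultiplierHopf_cop.T1 (a ⊗ₜ b) = z
  induction z with
  | zero => simp
  | add x y hx hy => simp only [map_add, hx, hy]
  | tmul u v =>
    rw [TensorProduct.lift.tmul, ← IsMultiplierHopf.left_antipodeM, ← H.of_antipode_symm]
    rfl

/-- The antipode identity `ab₍₂₎S⁻¹(b₍₁₎) = ε(b)a`. -/
theorem antipode_symm_right (H : RegularMHA K V) (a b : V) :
    TensorProduct.lift H.mul (H.antipode.symm.toLinearMap.lTensor V
      (H.isMultiplierHopf_cop.T2 (a ⊗ₜ b))) = H.isMultiplierHopf_cop.counit b • a := by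
  have h1 := H.isMultiplierHopf_cop.lift_antipodeR (a ⊗ₜ b)
  rw [sliceR_tmul] at h1
  rw [← h1]
  generalize H.isMultiplierHopf_cop.T2 (a ⊗ₜ b) = z
  induction z with
  | zero => simp
  | add x y hx hy => simp only [map_add, hx, hy]
  | tmul u v =>
    rw [TensorProduct.lift.tmul, ← IsMultiplierHopf.right_antipodeM, ← H.of_antipode_symm]
    rfl

theorem hopfAut_cop (H : RegularMHA K V) (α : H.hopfAut) (a : V) (z : V ⊗[K] V) :
    M.left ((H.flip ∘ₗ H.comul) (α.1 a)) (TensorProduct.congr α.1 α.1 z)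
      = TensorProduct.congr α.1 α.1 (M.left ((H.flip ∘ₗ H.comul) a) z) := by
  have hc : ∀ z, TensorProduct.comm K V V (TensorProduct.congr α.1 α.1 z)
      = TensorProduct.congr α.1 α.1 (TensorProduct.comm K V V z) := fun z => comm_map _ _ z
  rw [LinearMap.comp_apply, LinearMap.comp_apply, left_flip, left_flip, hc, (α.2.2 a _).1, hc]

end RegularMHA

namespace Pairing

variable {K : Type*} {A : Type*} {B : Type*} [Field K] [AddCommGroup A] [Module K A]
  [AddCommGroup B] [Module K B] {𝒜 : RegularMHA K A} {ℬ : RegularMHA K B}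

/-- The pairing with the two algebras interchanged. -/
def symm (P : Pairing 𝒜 ℬ) : Pairing ℬ 𝒜 where
  form := P.form.flip
  nondegenerate_left := P.nondegenerate_right
  nondegenerate_right := P.nondegenerate_left
  lactA := P.lactB
  ractA := P.ractB
  lactB := P.lactA
  ractB := P.ractA
  lactA_spec := P.lactB_spec
  ractA_spec := P.ractB_spec
  lactB_spec := P.lactA_spec
  ractB_spec := P.ractA_spec
  form_mul_right a b b' := P.form_mul_left b b' a
  form_mul_right' a b b' := P.form_mul_left' b b' a
  form_mul_left a a' b := P.form_mul_right b a a'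
  form_mul_left' a a' b := P.form_mul_right' b a a'

/-- The pairing `⟨a, α(b)⟩`, for a Hopf automorphism `α`. -/
def twist (P : Pairing 𝒜 ℬ) (α : ℬ.hopfAut) : Pairing 𝒜 ℬ where
  form := P.form.compl₂ α.1.toLinearMap
  nondegenerate_left a ha := P.nondegenerate_left a fun b => by
    simpa using ha (α.1.symm b)
  nondegenerate_right b hb := α.1.injective (by
    rw [map_zero]; exact P.nondegenerate_right _ fun a => by simpa using hb a)
  lactA := P.lactA ∘ₗ α.1.toLinearMap
  ractA := P.ractA.compl₂ α.1.toLinearMap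
  lactB := (P.lactB.compl₂ α.1.toLinearMap).compr₂ α.1.symm.toLinearMap
  ractB := (P.ractB ∘ₗ α.1.toLinearMap).compr₂ α.1.symm.toLinearMap
  lactA_spec b a a' := P.lactA_spec (α.1 b) a a'
  ractA_spec a b a' := P.ractA_spec a (α.1 b) a'
  lactB_spec a b b' := by
    apply α.1.injective
    have h1 := ℬ.isMultiplierHopf_cop.T1_congr α.1 α.2.1 (ℬ.hopfAut_cop α) b b'
    have h2 := P.lactB_spec a (α.1 b) (α.1 b')
    simp only [α.2.1, LinearMap.compr₂_apply, LinearMap.compl₂_apply, LinearEquiv.coe_coe,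
      LinearEquiv.apply_symm_apply, h2]
    change TensorProduct.rid K B ((P.form a).lTensor B (TensorProduct.comm K B B
      (ℬ.isMultiplierHopf_cop.T1 (α.1 b ⊗ₜ α.1 b')))) = α.1 (TensorProduct.rid K B
      (((P.form.compl₂ α.1.toLinearMap) a).lTensor B (TensorProduct.comm K B B
      (ℬ.isMultiplierHopf_cop.T1 (b ⊗ₜ b')))))
    rw [h1]
    generalize ℬ.isMultiplierHopf_cop.T1 (b ⊗ₜ b') = z
    induction z with
    | zero => simp
    | add x y hx hy => simp only [map_add, hx, hy]
    | tmul u v => simp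
  ractB_spec b a b' := by
    apply α.1.injective
    have h1 := ℬ.isMultiplierHopf.T1_congr α.1 α.2.1 (fun a z => (α.2.2 a z).1) b b'
    have h2 := P.ractB_spec (α.1 b) a (α.1 b')
    simp only [α.2.1, LinearMap.compr₂_apply, LinearMap.comp_apply, LinearEquiv.coe_coe,
      LinearEquiv.apply_symm_apply, h2]
    change TensorProduct.lid K B ((P.form a).rTensor B
      (ℬ.isMultiplierHopf.T1 (α.1 b ⊗ₜ α.1 b'))) = α.1 (TensorProduct.lid K B
      (((P.form.compl₂ α.1.toLinearMap) a).rTensor B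
      (ℬ.isMultiplierHopf.T1 (b ⊗ₜ b'))))
    rw [h1]
    generalize ℬ.isMultiplierHopf.T1 (b ⊗ₜ b') = z
    induction z with
    | zero => simp
    | add x y hx hy => simp only [map_add, hx, hy]
    | tmul u v => simp
  form_mul_right a b b' := by simp [α.2.1, P.form_mul_right]
  form_mul_right' a b b' := by simp [α.2.1, P.form_mul_right']
  form_mul_left a a' b := by simp [P.form_mul_left]
  form_mul_left' a a' b := by simp [P.form_mul_left']

section Basic

variable (P Q : Pairing 𝒜 ℬ)

theorem extA {a a' : A} (h : ∀ b, P.form a b = P.form a' b) : a = a' := by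
  rw [← sub_eq_zero]
  exact P.nondegenerate_left _ fun b => by rw [map_sub, LinearMap.sub_apply, h, sub_self]

theorem lactA_mul (b b' : B) (a : A) : P.lactA (ℬ.mul b b') a = P.lactA b (P.lactA b' a) :=
  P.extA fun c => by
    rw [← P.form_mul_right, ← P.form_mul_right, ← P.form_mul_right, ℬ.assoc]

theorem ractA_mul (b b' : B) (a : A) : P.ractA a (ℬ.mul b b') = P.ractA (P.ractA a b) b' :=
  P.extA fun c => by
    rw [← P.form_mul_right', ← P.form_mul_right', ← P.form_mul_right', ℬ.assoc]

theorem lactA_ractA (b b' : B) (a : A) :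
    P.lactA b (P.ractA a b') = P.ractA (P.lactA b a) b' :=
  P.extA fun c => by
    rw [← P.form_mul_right, ← P.form_mul_right', ← P.form_mul_right', ← P.form_mul_right, ℬ.assoc]

theorem ractB_mul (a a' : A) (b : B) : P.ractB b (𝒜.mul a a') = P.ractB (P.ractB b a) a' :=
  P.symm.ractA_mul a a' b

/-! The following four identities express slices of `Δ(b)(1 ⊗ c)`, `Δ(b)(c ⊗ 1)`, `(c ⊗ 1)Δ(b)` and
`(1 ⊗ c)Δ(b)` through the actions. -/

theorem sliceL_T1 (x : A) (b c : B) :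
    sliceL B (P.form x) (ℬ.isMultiplierHopf.T1 (b ⊗ₜ c)) = ℬ.mul (P.ractB b x) c :=
  (P.ractB_spec b x c).symm

theorem sliceL_T1_cop (x : A) (b c : B) :
    sliceL B (P.form x) (ℬ.isMultiplierHopf_cop.T1 (b ⊗ₜ c)) = ℬ.mul (P.lactB x b) c := by
  rw [P.lactB_spec, ← sliceR_comm]
  rfl

theorem form_comp_mul_flip (x : A) (c : B) : P.form x ∘ₗ ℬ.mul.flip c = P.form (P.lactA c x) :=
  LinearMap.ext fun b => P.form_mul_right x b c

theorem form_comp_mul (x : A) (c : B) : P.form x ∘ₗ ℬ.mul c = P.form (P.ractA x c) :=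
  LinearMap.ext fun b => P.form_mul_right' x c b

theorem sliceR_T1 (x : A) (b c : B) :
    sliceR B (P.form x) (ℬ.isMultiplierHopf.T1 (b ⊗ₜ c)) = P.lactB (P.lactA c x) b := by
  refine ℬ.isMultiplierHopf.nondegenerate.eq_of_mul_right fun d => ?_
  have h := ℬ.isMultiplierHopf_cop.T1_mul_comm ℬ.isMultiplierHopf ℬ.cop_cop b d c
  have h' : ∀ z, ℬ.mul (sliceR B (P.form x) z) d
      = sliceR B (P.form x) ((ℬ.mul.flip d).rTensor B z) := fun z => by
    rw [sliceR_rTensor]; rfl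
  rw [h', h, sliceR_comm, sliceL_rTensor, form_comp_mul_flip, sliceL_T1_cop]

theorem sliceR_T1_cop (x : A) (b c : B) :
    sliceR B (P.form x) (ℬ.isMultiplierHopf_cop.T1 (b ⊗ₜ c)) = P.ractB b (P.lactA c x) := by
  refine ℬ.isMultiplierHopf.nondegenerate.eq_of_mul_right fun d => ?_
  have h := ℬ.isMultiplierHopf.T1_mul_comm ℬ.isMultiplierHopf_cop (fun a => rfl) b d c
  have h' : ∀ z, ℬ.mul (sliceR B (P.form x) z) d
      = sliceR B (P.form x) ((ℬ.mul.flip d).rTensor B z) := fun z => by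
    rw [sliceR_rTensor]; rfl
  rw [h', h, sliceR_comm, sliceL_rTensor, form_comp_mul_flip, sliceL_T1]

theorem sliceL_T2 (x : A) (b c : B) :
    sliceL B (P.form x) (ℬ.isMultiplierHopf.T2 (c ⊗ₜ b)) = P.ractB b (P.ractA x c) := by
  refine ℬ.isMultiplierHopf.nondegenerate.eq_of_mul_right fun d => ?_
  have h := ℬ.isMultiplierHopf.mul_T1_eq_T2_mul c b d
  rw [← sliceL_T1, ← form_comp_mul, ← sliceL_rTensor, h, sliceL_lTensor]
  rfl

theorem sliceR_T2_cop (x : A) (b c : B) :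
    sliceR B (P.form x) (ℬ.isMultiplierHopf_cop.T2 (c ⊗ₜ b)) = ℬ.mul c (P.ractB b x) := by
  refine ℬ.isMultiplierHopf.nondegenerate.eq_of_mul_right fun d => ?_
  have h := ℬ.isMultiplierHopf_cop.T2_mul_eq_mul_T1 ℬ.isMultiplierHopf ℬ.cop_cop c b d
  rw [ℬ.assoc, ← sliceL_T1, ← sliceL_lTensor, h, sliceL_comm, sliceR_rTensor]
  rfl

/-- `B ▶ A = A`, and `A` is a left `B`-module. -/
theorem isModule_lactA : ℬ.IsModule P.lactA := by
  refine IsModule.of_surjective ℬ.hasLocalUnits.left P.lactA_mul fun n => ?_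
  rcases subsingleton_or_nontrivial A with hA | hA
  · exact ⟨0, Subsingleton.elim _ _⟩
  obtain ⟨x, hx⟩ := exists_ne (0 : A)
  obtain ⟨b, hb⟩ : ∃ b, P.form x b ≠ 0 := by
    by_contra! H
    exact hx (P.nondegenerate_left x H)
  -- every element of `A` is a slice `(ι ⊗ ⟨·, b⟩)(Δ(a)(1 ⊗ c)) = (c ▶ b) ▶ a`
  have key : ∀ w, sliceR A (P.form.flip b) (𝒜.isMultiplierHopf.T1 w)
      = TensorProduct.lift P.lactA (TensorProduct.comm K A B
        ((P.lactB.flip b).lTensor A w)) := by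
    intro w
    induction w with
    | zero => simp
    | add x y hx hy => simp only [map_add, hx, hy]
    | tmul a c =>
      rw [LinearMap.lTensor_tmul, TensorProduct.comm_tmul, TensorProduct.lift.tmul]
      exact P.symm.sliceR_T1 b a c
  obtain ⟨w, hw⟩ := 𝒜.isMultiplierHopf.T1.surjective (n ⊗ₜ ((P.form x b)⁻¹ • x))
  exact ⟨_, by rw [← key, hw]; simp [hb]⟩

/-- `A ◀ B = A`, and `A` is a right `B`-module. -/
theorem isModule_ractA : ℬ.opp.IsModule P.ractA.flip := by
  refine IsModule.of_surjective (R := ℬ.opp) ℬ.hasLocalUnits.right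
    (fun b b' a => P.ractA_mul b' b a) fun n => ?_
  rcases subsingleton_or_nontrivial A with hA | hA
  · exact ⟨0, Subsingleton.elim _ _⟩
  obtain ⟨x, hx⟩ := exists_ne (0 : A)
  obtain ⟨b, hb⟩ : ∃ b, P.form x b ≠ 0 := by
    by_contra! H
    exact hx (P.nondegenerate_left x H)
  have key : ∀ w, sliceR A (P.form.flip b) (𝒜.isMultiplierHopf_cop.T1 w)
      = TensorProduct.lift P.ractA.flip (TensorProduct.comm K A B
        ((P.lactB.flip b).lTensor A w)) := by
    intro w
    induction w with
    | zero => simp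
    | add x y hx hy => simp only [map_add, hx, hy]
    | tmul a c =>
      rw [LinearMap.lTensor_tmul, TensorProduct.comm_tmul, TensorProduct.lift.tmul]
      exact P.symm.sliceR_T1_cop b a c
  obtain ⟨w, hw⟩ := 𝒜.isMultiplierHopf_cop.T1.surjective (n ⊗ₜ ((P.form x b)⁻¹ • x))
  exact ⟨_, by rw [← key, hw]; simp [hb]⟩

/-- The left and right actions of `A` on `B` commute, also if they come from different pairings. -/
theorem lactB_ractB (u x : A) (b : B) :
    P.lactB u (Q.ractB b x) = Q.ractB (P.lactB u b) x := by
  obtain ⟨l, hl⟩ := P.isModule_lactA.exists_unit u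
  obtain ⟨k, hk⟩ := Q.isModule_ractA.exists_unit x
  rw [LinearMap.flip_apply] at hk
  -- apply `⟨x, ·⟩ ⊗ ι ⊗ ⟨u, ·⟩` to the two sides of the coassociativity law at `k ⊗ b ⊗ l`
  have h := congrArg (fun z => sliceR B (P.form u) ((sliceL B (Q.form x)).rTensor B z))
    (ℬ.isMultiplierHopf.coassoc (k ⊗ₜ (b ⊗ₜ l)))
  have h1 : ∀ z, sliceR B (P.form u) ((sliceL B (Q.form x)).rTensor B
      (ℬ.isMultiplierHopf.T2.toLinearMap.rTensor B ((TensorProduct.assoc K B B B).symm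
        (k ⊗ₜ z)))) = Q.ractB (sliceR B (P.form u) z) x := by
    intro z
    induction z with
    | zero => simp
    | add x y hx hy => simp only [map_add, TensorProduct.tmul_add, LinearMap.add_apply, hx, hy]
    | tmul v w => simp [Q.sliceL_T2, hk]
  have h2 : ∀ z : B ⊗[K] B, sliceR B (P.form u) ((sliceL B (Q.form x)).rTensor B
      ((TensorProduct.assoc K B B B).symm (ℬ.isMultiplierHopf.T1.toLinearMap.lTensor B
        (TensorProduct.assoc K B B B (z ⊗ₜ l))))) = P.lactB u (sliceL B (Q.form x) z) := by
    intro z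
    induction z with
    | zero => simp
    | add x y hx hy => simp only [map_add, TensorProduct.add_tmul, hx, hy]
    | tmul v w =>
      have h3 : ∀ z : B ⊗[K] B, sliceR B (P.form u) ((sliceL B (Q.form x)).rTensor B
          ((TensorProduct.assoc K B B B).symm (v ⊗ₜ z))) = Q.form x v • sliceR B (P.form u) z := by
        intro z
        induction z with
        | zero => simp
        | add x y hx hy => simp only [map_add, TensorProduct.tmul_add, smul_add, hx, hy]
        | tmul v w => simp [smul_smul, mul_comm]
      simp [h3, P.sliceR_T1, hl]
  simp only [LinearMap.lTensor_tmul, TensorProduct.assoc_symm_tmul, LinearMap.rTensor_tmul] at h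
  rw [h1, LinearEquiv.coe_coe, LinearEquiv.coe_coe, h2, P.sliceR_T1, Q.sliceL_T2, hl, hk] at h
  exact h.symm

theorem lactA_ractA' (u x : B) (a : A) :
    P.lactA u (Q.ractA a x) = Q.ractA (P.lactA u a) x :=
  P.symm.lactB_ractB Q.symm u x a

theorem counit_ractB (b : B) (x : A) : ℬ.counit (P.ractB b x) = P.form x b := by
  rcases subsingleton_or_nontrivial B with hB | hB
  · rw [Subsingleton.elim b 0]; simp
  have h := ℬ.isMultiplierHopf
  obtain ⟨k, hk⟩ := h.exists_counit_eq_one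
  have h1 := congrArg ℬ.isMultiplierHopf.counit (P.sliceL_T1 x b k)
  have h2 : ∀ z : B ⊗[K] B, ℬ.isMultiplierHopf.counit (sliceL B (P.form x) z)
      = P.form x (sliceR B ℬ.isMultiplierHopf.counit z) := by
    intro z
    induction z with
    | zero => simp
    | add x y hx hy => simp only [map_add, hx, hy]
    | tmul v w => simp [mul_comm]
  rw [h2, h.counit_T1_right, h.counit_mul, hk, one_smul, mul_one] at h1
  rw [ℬ.counit_eq_isMultiplierHopf, h1]

end Basic

end Pairing

/-! ### The twist map of two pairings -/

theorem RegularMHA.counit_hopfAut {K : Type*} [Field K] {V : Type*} [AddCommGroup V] [Module K V]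
    (H : RegularMHA K V) (α : H.hopfAut) (a : V) : H.counit (α.1 a) = H.counit a := by
  have h : H.counit = H.counit ∘ₗ α.1.toLinearMap := by
    refine H.counit_eq fun a b => α.1.injective ?_
    have h1 := H.isMultiplierHopf.counit_T1 (α.1 a ⊗ₜ α.1 b)
    rw [H.isMultiplierHopf.T1_congr α.1 α.2.1 (fun a z => (α.2.2 a z).1),
      ← H.counit_eq_isMultiplierHopf] at h1
    rw [α.2.1]
    refine Eq.trans ?_ (h1.trans (TensorProduct.lift.tmul _ _))
    change _ = sliceL V H.counit (TensorProduct.congr α.1 α.1 (H.T₁ (a ⊗ₜ b)))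
    generalize H.T₁ (a ⊗ₜ b) = z
    induction z with
    | zero => simp
    | add x y hx hy => simp only [map_add, hx, hy]
    | tmul x y => simp
  exact (LinearMap.congr_fun h a).symm

theorem RegularMHA.antipode_hopfAut {K : Type*} [Field K] {V : Type*} [AddCommGroup V] [Module K V]
    (H : RegularMHA K V) (α : H.hopfAut) (a : V) :
    H.antipode (α.1 a) = α.1 (H.antipode a) := by
  have h := H.antipode_eq (S := α.1.symm.toLinearMap ∘ₗ H.antipode.toLinearMap ∘ₗ α.1.toLinearMap)
    (fun a b => α.1.injective ?_) a
  · rw [h]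
    simp
  · have h1 := H.isAntipode_antipode.antipode_left (α.1 a) (α.1 b)
    rw [H.counit_hopfAut] at h1
    rw [map_smul, ← h1]
    have h2 := H.isMultiplierHopf.T1_congr α.1 α.2.1 (fun a z => (α.2.2 a z).1) a b
    change H.T₁ _ = TensorProduct.congr α.1 α.1 (H.T₁ _) at h2
    rw [h2]
    generalize H.T₁ (a ⊗ₜ b) = z
    induction z with
    | zero => simp
    | add x y hx hy => simp only [map_add, hx, hy]
    | tmul x y => simp [α.2.1]

namespace Pairing

variable {K : Type*} {A : Type*} {B : Type*} [Field K] [AddCommGroup A] [Module K A]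
  [AddCommGroup B] [Module K B] {𝒜 : RegularMHA K A} {ℬ : RegularMHA K B}

/-- The map `b ⊗ a ↦ (b₍₁₎ ▶ a) ⊗ b₍₂₎`. -/
def L (P : Pairing 𝒜 ℬ) : B ⊗[K] A ≃ₗ[K] A ⊗[K] B :=
  (ℬ.isMultiplierHopf_cop.canL ℬ.hasLocalUnits P.isModule_lactA).trans (TensorProduct.comm K B A)

/-- The map `b ⊗ a ↦ b₍₁₎ ⊗ (a ◀ b₍₂₎)`. In terms of `Δ(a)` it is `b ⊗ a ↦ (a₍₁₎ ▶ b) ⊗ a₍₂₎`. -/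
def R (P : Pairing 𝒜 ℬ) : B ⊗[K] A ≃ₗ[K] B ⊗[K] A :=
  (TensorProduct.comm K B A).trans P.symm.L

/-- The map `b₍₁₎ ⊗ (a ◀ b₍₂₎) ↦ (b₍₁₎ ▶ a) ⊗ b₍₂₎`, in which `▶` belongs to the pairing `P` and `◀` to
the pairing `Q`. -/
def T (P Q : Pairing 𝒜 ℬ) : B ⊗[K] A ≃ₗ[K] A ⊗[K] B := Q.R.symm.trans P.L

variable (P Q : Pairing 𝒜 ℬ)

@[simp] theorem T_R (z : B ⊗[K] A) : T P Q (Q.R z) = P.L z := by simp [T]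

theorem T_symm : T Q.symm P.symm = (T P Q).symm := by
  ext z
  obtain ⟨w, rfl⟩ := P.L.surjective z
  rw [(LinearEquiv.symm_apply_eq (T P Q)).2 (T_R P Q w).symm]
  have h : P.L w = P.symm.R (TensorProduct.comm K B A w) := by
    simp [R, symm]
  rw [h, T_R]
  rfl

theorem L_tmul_lactA (b e : B) (a : A) : P.L (b ⊗ₜ P.lactA e a) = TensorProduct.comm K B A
    ((P.lactA.flip a).lTensor B (ℬ.isMultiplierHopf_cop.T1 (b ⊗ₜ e))) :=
  congrArg _ (ℬ.isMultiplierHopf_cop.canL_tmul_act ℬ.hasLocalUnits P.isModule_lactA b e a)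

theorem sliceR_L (x : A) (b : B) (a : A) :
    sliceR A (Q.form x) (P.L (b ⊗ₜ a)) = P.lactA (Q.lactB x b) a := by
  refine (sliceR_comm _ _).trans ?_
  exact ℬ.isMultiplierHopf_cop.sliceL_canL ℬ.hasLocalUnits P.isModule_lactA
    (g := Q.lactB x) (fun b k => Q.sliceL_T1_cop x b k) b a

theorem sliceL_L (y : B) (b : B) (a : A) :
    sliceL B (P.form.flip y) (P.L (b ⊗ₜ a)) = P.ractB b (P.ractA a y) := by
  obtain ⟨e, he⟩ := P.isModule_lactA.exists_unit a
  have h : P.form.flip y ∘ₗ P.lactA.flip a = P.form (P.ractA a y) := LinearMap.ext fun c => by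
    rw [← P.form_comp_mul]
    exact (P.form_mul_right a y c).symm
  conv_lhs => rw [← he]
  rw [L_tmul_lactA, sliceL_comm, sliceR_lTensor, h, sliceR_T1_cop, lactA_ractA, he]

theorem sliceL_R (x : A) (b : B) (a : A) :
    sliceL A (P.form x) (P.R (b ⊗ₜ a)) = P.ractA a (P.ractB b x) :=
  P.symm.sliceL_L x a b

/-- Elements of `A ⊗ N` are separated by the functionals `⟨·, y⟩`. -/
theorem tensor_extA {N : Type*} [AddCommGroup N] [Module K N] {z z' : A ⊗[K] N}
    (h : ∀ y, sliceL N (P.form.flip y) z = sliceL N (P.form.flip y) z') : z = z' :=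
  sliceL_joint (f := fun y => P.form.flip y) P.nondegenerate_left h

theorem tensor_extB {N : Type*} [AddCommGroup N] [Module K N] {z z' : B ⊗[K] N}
    (h : ∀ x, sliceL N (P.form x) z = sliceL N (P.form x) z') : z = z' :=
  P.symm.tensor_extA h

/-- Elements of `N ⊗ B` are separated by the functionals `⟨x, ·⟩`. -/
theorem tensor_extB' {N : Type*} [AddCommGroup N] [Module K N] {z z' : N ⊗[K] B}
    (h : ∀ x, sliceR N (P.form x) z = sliceR N (P.form x) z') : z = z' :=
  sliceR_joint (f := fun x => P.form x) P.nondegenerate_right h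

theorem L_ractA (y : B) (z : B ⊗[K] A) :
    (Q.ractA.flip y).rTensor B (P.L z) = P.L ((Q.ractA.flip y).lTensor B z) := by
  refine (rTensor_comm _ _).trans (congrArg _ (Eq.symm ?_))
  exact ℬ.isMultiplierHopf_cop.canL_natural ℬ.hasLocalUnits P.isModule_lactA P.isModule_lactA
    (fun b a => (lactA_ractA' P Q b y a).symm) z

theorem L_lactB (x : A) (z : B ⊗[K] A) :
    (Q.lactB x).lTensor A (P.L z) = P.L ((Q.lactB x).rTensor A z) := by
  induction z with
  | zero => simp
  | add z w hz hw => simp only [map_add, hz, hw]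
  | tmul b a =>
    refine P.tensor_extA fun y => ?_
    rw [sliceL_lTensor, sliceL_L, LinearMap.rTensor_tmul, sliceL_L, lactB_ractB]

theorem R_ractB (x : A) (z : B ⊗[K] A) :
    (Q.ractB.flip x).rTensor A (P.R z) = P.R ((Q.ractB.flip x).rTensor A z) := by
  refine (L_ractA P.symm Q.symm x (TensorProduct.comm K B A z)).trans ?_
  exact congrArg _ (lTensor_comm _ _)

theorem R_lactA (y : B) (z : B ⊗[K] A) :
    (Q.lactA y).lTensor B (P.R z) = P.R ((Q.lactA y).lTensor B z) := by
  refine (L_lactB P.symm Q.symm y (TensorProduct.comm K B A z)).trans ?_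
  exact congrArg _ (rTensor_comm _ _)

theorem L_mul_right (b k : B) (a : A) : (ℬ.mul.flip k).lTensor A (P.L (b ⊗ₜ a))
    = (P.lactA.flip a).rTensor B (ℬ.isMultiplierHopf.T1 (b ⊗ₜ k)) := by
  obtain ⟨e, he⟩ := P.isModule_lactA.exists_unit a
  have h := ℬ.isMultiplierHopf.T1_mul_comm ℬ.isMultiplierHopf_cop (fun a => rfl) b k e
  conv_lhs => rw [← he]
  rw [L_tmul_lactA, lTensor_comm, ← LinearMap.comp_apply, LinearMap.rTensor_comp_lTensor,
    ← LinearMap.lTensor_comp_rTensor, LinearMap.comp_apply, h, lTensor_comm,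
    ← LinearMap.rTensor_comp_apply]
  rw [show P.lactA.flip a ∘ₗ ℬ.mul.flip e = P.lactA.flip a from
    LinearMap.ext fun c => by simp [lactA_mul, he]]
  exact (TensorProduct.comm K A B).symm_apply_apply _

/-- `b ▶ (aa') = ∑ (b₍₁₎ ▶ a)(b₍₂₎ ▶ a')`. -/
theorem lactA_mul_right (b : B) (a a' : A) : P.lactA b (𝒜.mul a a')
    = TensorProduct.lift (𝒜.mul.compl₂ (P.lactA.flip a')) (P.L (b ⊗ₜ a)) := by
  refine 𝒜.isMultiplierHopf.nondegenerate.eq_of_mul_right fun c => ?_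
  have h1 : sliceL A (P.form.flip b) _ = 𝒜.mul (P.lactA b (𝒜.mul a a')) c :=
    P.symm.sliceL_T1_cop b (𝒜.mul a a') c
  have h2 := 𝒜.isMultiplierHopf_cop.T1_mul_left a (a' ⊗ₜ c)
  have h3 : ∀ b', 𝒜.mul (P.lactA b' a') c = sliceL A (P.form.flip b')
      (𝒜.isMultiplierHopf_cop.T1 (a' ⊗ₜ c)) := fun b' => (P.symm.sliceL_T1_cop b' a' c).symm
  rw [LinearMap.rTensor_tmul] at h2
  rw [← h1, h2]
  obtain ⟨s, hs⟩ := TensorProduct.exists_finset (𝒜.isMultiplierHopf_cop.T1 (a' ⊗ₜ c))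
  have h4 : ∀ w, 𝒜.mul (TensorProduct.lift (𝒜.mul.compl₂ (P.lactA.flip a')) w) c
      = ∑ x ∈ s, 𝒜.mul (sliceR A (P.form x.1) w) x.2 := by
    intro w
    induction w with
    | zero => simp
    | add x y hx hy =>
      simp only [map_add, LinearMap.add_apply, hx, hy, Finset.sum_add_distrib]
    | tmul u v => simp [𝒜.assoc, h3, hs]
  rw [h4, hs, map_sum, map_sum]
  refine Finset.sum_congr rfl fun x _ => ?_
  rw [IsMultiplierHopf.left_comul_tmul, sliceL_rTensor, sliceR_L]
  have h5 : P.form.flip b ∘ₗ 𝒜.mul.flip x.1 = P.form.flip (P.lactB x.1 b) :=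
    P.symm.form_comp_mul_flip b x.1
  rw [h5]
  exact P.symm.sliceL_T1_cop _ _ _

/-- `(bb') ◀ a = ∑ (b ◀ (b'₍₁₎ ▶ a))b'₍₂₎`. -/
theorem ractB_mul_left (b b' : B) (a : A) : P.ractB (ℬ.mul b b') a
    = TensorProduct.lift (ℬ.mul ∘ₗ P.ractB b) (P.L (b' ⊗ₜ a)) := by
  refine ℬ.isMultiplierHopf.nondegenerate.eq_of_mul_right fun c => ?_
  have h2 := ℬ.isMultiplierHopf.T1_mul_left b (b' ⊗ₜ c)
  rw [LinearMap.rTensor_tmul] at h2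
  have h3 : ∀ w, ℬ.mul (TensorProduct.lift (ℬ.mul ∘ₗ P.ractB b) w) c
      = TensorProduct.lift (ℬ.mul ∘ₗ P.ractB b) ((ℬ.mul.flip c).lTensor A w) := by
    intro w
    induction w with
    | zero => simp
    | add x y hx hy => simp only [map_add, LinearMap.add_apply, hx, hy]
    | tmul u v => simp [ℬ.assoc]
  rw [← sliceL_T1, h2, h3, L_mul_right]
  generalize ℬ.isMultiplierHopf.T1 (b' ⊗ₜ c) = z
  induction z with
  | zero => simp
  | add x y hx hy => simp only [map_add, hx, hy]
  | tmul e f =>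
    rw [ℬ.isMultiplierHopf.left_comul_tmul, sliceL_rTensor, form_comp_mul_flip, sliceL_T1]
    simp

theorem L_mul_lact (b : B) (a a' : A) : P.L (b ⊗ₜ 𝒜.mul a a')
    = TensorProduct.lift ((LinearMap.rTensorHom B ∘ₗ 𝒜.mul).compl₂
        (P.L.toLinearMap ∘ₗ (TensorProduct.mk K B A).flip a')) (P.L (b ⊗ₜ a)) := by
  refine P.tensor_extB' fun x => ?_
  have h : ∀ w : A ⊗[K] B, sliceR A (P.form x)
      (TensorProduct.lift ((LinearMap.rTensorHom B ∘ₗ 𝒜.mul).compl₂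
        (P.L.toLinearMap ∘ₗ (TensorProduct.mk K B A).flip a')) w)
      = TensorProduct.lift (𝒜.mul.compl₂ (P.lactA.flip a')) ((P.lactB x).lTensor A w) := by
    intro w
    induction w with
    | zero => simp
    | add x y hx hy => simp only [map_add, hx, hy]
    | tmul u v => simp [sliceR_rTensor, sliceR_L]
  rw [h, sliceR_L, L_lactB, LinearMap.rTensor_tmul, lactA_mul_right]

theorem L_mul_ract (b b' : B) (a : A) : P.L (ℬ.mul b b' ⊗ₜ a)
    = TensorProduct.lift ((LinearMap.lTensorHom A ∘ₗ ℬ.mul.flip).flip ∘ₗ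
        (P.L.toLinearMap ∘ₗ TensorProduct.mk K B A b)) (P.L (b' ⊗ₜ a)) := by
  refine P.tensor_extA fun y => ?_
  have h : ∀ w : A ⊗[K] B, sliceL B (P.form.flip y)
      (TensorProduct.lift ((LinearMap.lTensorHom A ∘ₗ ℬ.mul.flip).flip ∘ₗ
        (P.L.toLinearMap ∘ₗ TensorProduct.mk K B A b)) w)
      = TensorProduct.lift (ℬ.mul ∘ₗ P.ractB b) ((P.ractA.flip y).rTensor B w) := by
    intro w
    induction w with
    | zero => simp
    | add x y hx hy => simp only [map_add, hx, hy]
    | tmul u v => simp [sliceL_lTensor, sliceL_L]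
  rw [h, sliceL_L, L_ractA, LinearMap.lTensor_tmul, ractB_mul_left]
  rfl

/-- The maps `b ⊗ a ↦ (b₍₁₎ ▶ a) ⊗ b₍₂₎` and `b ⊗ a' ↦ b₍₁₎ ⊗ (a' ◀ b₍₂₎)` commute, on
`b ⊗ a ⊗ a'`. -/
theorem L_R_comm (b : B) (a a' : A) :
    TensorProduct.assoc K A B A ((P.L.toLinearMap ∘ₗ (TensorProduct.mk K B A).flip a).rTensor A
      (Q.R (b ⊗ₜ a')))
    = (Q.R.toLinearMap ∘ₗ (TensorProduct.mk K B A).flip a').lTensor A (P.L (b ⊗ₜ a)) := by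
  refine P.tensor_extA fun y => ?_
  have h : ∀ w : B ⊗[K] A, sliceL (B ⊗[K] A) (P.form.flip y) (TensorProduct.assoc K A B A
      ((P.L.toLinearMap ∘ₗ (TensorProduct.mk K B A).flip a).rTensor A w))
      = (P.ractB.flip (P.ractA a y)).rTensor A w := by
    intro w
    induction w with
    | zero => simp
    | add x y hx hy => simp only [map_add, hx, hy]
    | tmul u v =>
      have h' : ∀ w : A ⊗[K] B, sliceL (B ⊗[K] A) (P.form.flip y)
          (TensorProduct.assoc K A B A (w ⊗ₜ v)) = sliceL B (P.form.flip y) w ⊗ₜ v := by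
        intro w
        induction w with
        | zero => simp
        | add x y hx hy => simp only [map_add, TensorProduct.add_tmul, hx, hy]
        | tmul u v => simp [TensorProduct.smul_tmul']
      simp [h', sliceL_L]
  rw [h, R_ractB, sliceL_lTensor, sliceL_L]
  simp

/-- Compatibility of the twist map with the product of `A`: `T(T⁻¹(z)(1 ⊗ a')) = ∑ a T(b ⊗ a')`
for `z = ∑ a ⊗ b`. -/
theorem T_mul_A (z : A ⊗[K] B) (a' : A) :
    T P Q ((𝒜.mul.flip a').lTensor B ((T P Q).symm z))
      = TensorProduct.lift ((LinearMap.rTensorHom B ∘ₗ 𝒜.mul).compl₂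
        ((T P Q).toLinearMap ∘ₗ (TensorProduct.mk K B A).flip a')) z := by
  obtain ⟨w, rfl⟩ := P.L.surjective z
  rw [(LinearEquiv.symm_apply_eq (T P Q)).2 (T_R P Q w).symm]
  induction w with
  | zero => simp
  | add x y hx hy => simp only [map_add, hx, hy]
  | tmul b a =>
    -- both sides are linear in `b ⊗ a'`, so that `b ⊗ a'` may be replaced by `Q.R (b ⊗ a')`
    let ν : A ⊗[K] (B ⊗[K] A) →ₗ[K] A ⊗[K] B :=
      TensorProduct.lift ((LinearMap.rTensorHom B ∘ₗ 𝒜.mul).compl₂ (T P Q).toLinearMap)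
    have key : (T P Q).toLinearMap ∘ₗ TensorProduct.lift
          ((LinearMap.lTensorHom B ∘ₗ 𝒜.mul.flip).flip ∘ₗ
            Q.R.toLinearMap ∘ₗ (TensorProduct.mk K B A).flip a)
        = ν ∘ₗ (TensorProduct.assoc K A B A).toLinearMap ∘ₗ
          (P.L.toLinearMap ∘ₗ (TensorProduct.mk K B A).flip a).rTensor A := by
      rw [← LinearMap.cancel_right Q.R.surjective]
      refine TensorProduct.ext' fun b a' => ?_
      have h1 := L_mul_ract Q.symm a a' b
      have h2 : ∀ w : A ⊗[K] B,
          ν ((Q.R.toLinearMap ∘ₗ (TensorProduct.mk K B A).flip a').lTensor A w)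
          = TensorProduct.lift ((LinearMap.rTensorHom B ∘ₗ 𝒜.mul).compl₂
            (P.L.toLinearMap ∘ₗ (TensorProduct.mk K B A).flip a')) w := by
        intro w
        induction w with
        | zero => simp
        | add x y hx hy => simp only [map_add, hx, hy]
        | tmul u v => simp [ν]
      have h3 := congrArg ν (L_R_comm P Q b a a')
      rw [h2, ← L_mul_lact] at h3
      refine Eq.trans ?_ h3.symm
      rw [← T_R P Q]
      exact congrArg (T P Q) h1.symm
    have h := LinearMap.congr_fun key (b ⊗ₜ a')
    have h4 : ∀ w : A ⊗[K] B, ν (TensorProduct.assoc K A B A (w ⊗ₜ a'))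
        = TensorProduct.lift ((LinearMap.rTensorHom B ∘ₗ 𝒜.mul).compl₂
          ((T P Q).toLinearMap ∘ₗ (TensorProduct.mk K B A).flip a')) w := by
      intro w
      induction w with
      | zero => simp
      | add x y hx hy => simp only [map_add, TensorProduct.add_tmul, hx, hy]
      | tmul u v => simp [ν]
    rw [← h4]
    exact h

/-- Compatibility of the twist map with the product of `B`: `T((b ⊗ 1)T⁻¹(z)) = ∑ T(b ⊗ a)b'` for
`z = ∑ a ⊗ b'`. -/
theorem T_mul_B (z : A ⊗[K] B) (b : B) :
    T P Q ((ℬ.mul b).rTensor A ((T P Q).symm z))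
      = TensorProduct.lift ((LinearMap.lTensorHom A ∘ₗ ℬ.mul.flip).flip ∘ₗ
        ((T P Q).toLinearMap ∘ₗ TensorProduct.mk K B A b)) z := by
  induction z with
  | zero => simp
  | add x y hx hy => simp only [map_add, hx, hy]
  | tmul a b' =>
    have h := T_mul_A Q.symm P.symm (b ⊗ₜ a) b'
    rw [T_symm, LinearEquiv.symm_apply_eq] at h
    exact h.symm

/-- `∑ (a ◀ b₍₂₎) ◀ S⁻¹(b₍₁₎) = ε(b)a`. -/
theorem lift_R (b : B) (a : A) :
    TensorProduct.lift (P.ractA.flip ∘ₗ ℬ.antipode.symm.toLinearMap) (P.R (b ⊗ₜ a))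
      = ℬ.counit b • a := by
  obtain ⟨e, he⟩ := P.isModule_ractA.exists_unit a
  rw [LinearMap.flip_apply] at he
  have h1 : P.R (b ⊗ₜ P.ractA a e) = (P.ractA a).lTensor B
      (TensorProduct.comm K B B (ℬ.isMultiplierHopf_cop.T2 (e ⊗ₜ b))) := by
    refine P.tensor_extB fun x => ?_
    rw [sliceL_R, sliceL_lTensor, sliceL_comm, sliceR_T2_cop, ractA_mul]
  have h2 : ∀ z, TensorProduct.lift (P.ractA.flip ∘ₗ ℬ.antipode.symm.toLinearMap)
      ((P.ractA a).lTensor B (TensorProduct.comm K B B z)) = P.ractA a (TensorProduct.lift ℬ.mul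
        (ℬ.antipode.symm.toLinearMap.lTensor B z)) := by
    intro w
    induction w with
    | zero => simp
    | add x y hx hy => simp only [map_add, hx, hy]
    | tmul u v => simp [ractA_mul]
  conv_lhs => rw [← he]
  rw [h1, h2, ℬ.antipode_symm_right, map_smul, he, ℬ.counit_eq_cop]

/-- The inverse of `b ⊗ a ↦ b₍₁₎ ⊗ (a ◀ b₍₂₎)` is `b ⊗ a ↦ b₍₁₎ ⊗ (a ◀ S⁻¹(b₍₂₎))`. -/
theorem R_symm_mul_right (b b' : B) (a : A) :
    (ℬ.mul.flip b').rTensor A (P.R.symm (b ⊗ₜ a))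
      = (P.ractA a ∘ₗ ℬ.antipode.symm.toLinearMap).lTensor B (ℬ.T₃ (b ⊗ₜ b')) := by
  let G : B ⊗[K] A →ₗ[K] B ⊗[K] A := TensorProduct.lift (LinearMap.flip
    (LinearMap.flip (LinearMap.lTensorHom B ∘ₗ (LinearMap.lcomp K A ℬ.antipode.symm.toLinearMap)
      ∘ₗ P.ractA) ∘ₗ ℬ.T₃.toLinearMap ∘ₗ (TensorProduct.mk K B B).flip b') |>.flip)
  have hG : ∀ b a, G (b ⊗ₜ a)
      = (P.ractA a ∘ₗ ℬ.antipode.symm.toLinearMap).lTensor B (ℬ.T₃ (b ⊗ₜ b')) := fun b a => by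
    simp [G]
    rfl
  have key : ∀ z, G (P.R z) = (ℬ.mul.flip b').rTensor A z := by
    intro z
    induction z with
    | zero => simp
    | add x y hx hy => simp only [map_add, hx, hy]
    | tmul b a =>
      refine P.tensor_extB fun x => ?_
      have h1 : ∀ w, sliceL A (P.form x) (G w)
          = TensorProduct.lift (P.ractA.flip ∘ₗ ℬ.antipode.symm.toLinearMap)
            ((P.ractB.flip (P.lactA b' x)).rTensor A w) := by
        intro w
        induction w with
        | zero => simp
        | add x y hx hy => simp only [map_add, hx, hy]
        | tmul u v =>
          rw [hG, sliceL_lTensor]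
          have h2 : sliceL B (P.form x) (ℬ.T₃ (u ⊗ₜ b')) = P.ractB u (P.lactA b' x) := by
            rw [← sliceR_T1_cop, ← sliceL_comm]
            rfl
          rw [h2]
          simp
      rw [h1, R_ractB, LinearMap.rTensor_tmul, lift_R, LinearMap.flip_apply, counit_ractB,
        sliceL_rTensor, form_comp_mul_flip, sliceL_tmul]
  rw [← hG, ← key, LinearEquiv.apply_symm_apply]

/-- Coassociativity: multiplying the first leg of the coproduct of `b` commutes with acting on `a` by
its last leg. -/
theorem T₃_R (e : B) (z : B ⊗[K] A) :
    Q.R.toLinearMap.lTensor B (TensorProduct.assoc K B B A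
      ((ℬ.T₃.toLinearMap ∘ₗ (TensorProduct.mk K B B).flip e).rTensor A z))
    = TensorProduct.assoc K B B A
      ((ℬ.T₃.toLinearMap ∘ₗ (TensorProduct.mk K B B).flip e).rTensor A (Q.R z)) := by
  have h1 : ∀ x b, sliceL B (Q.form x) (ℬ.T₃ (b ⊗ₜ e)) = Q.ractB b (Q.lactA e x) := fun x b => by
    rw [← sliceR_T1_cop, ← sliceL_comm]
    rfl
  have h2 : ∀ x (z : B ⊗[K] B) (a : A), sliceL (B ⊗[K] A) (Q.form x)
      (TensorProduct.assoc K B B A (z ⊗ₜ a)) = sliceL B (Q.form x) z ⊗ₜ a := by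
    intro x z a
    induction z with
    | zero => simp
    | add x y hx hy => simp only [map_add, TensorProduct.add_tmul, hx, hy]
    | tmul u v => simp [TensorProduct.smul_tmul']
  have h3 : ∀ x z, sliceL (B ⊗[K] A) (Q.form x) (TensorProduct.assoc K B B A
      ((ℬ.T₃.toLinearMap ∘ₗ (TensorProduct.mk K B B).flip e).rTensor A z))
      = (Q.ractB.flip (Q.lactA e x)).rTensor A z := by
    intro x z
    induction z with
    | zero => simp
    | add x y hx hy => simp only [map_add, hx, hy]
    | tmul u v => simp [h1, h2]
  refine Q.tensor_extB fun x => ?_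
  rw [sliceL_lTensor, h3, h3, R_ractB]
  rfl

/-- The formula `T(b ⊗ (e ▶ a))(1 ⊗ b') = ∑ (b₍₁₎e ▶ a ◀ S⁻¹(b₍₃₎)) ⊗ b₍₂₎b'`. -/
theorem T_formula (b e b' : B) (a : A) :
    (ℬ.mul.flip b').lTensor A (T P Q (b ⊗ₜ P.lactA e a))
      = (TensorProduct.lift ((Q.ractA ∘ₗ P.lactA.flip a).compl₂
          ℬ.antipode.symm.toLinearMap)).rTensor B
        (TensorProduct.comm K B (B ⊗[K] B) (TensorProduct.leftComm K B B B
          ((ℬ.T₃.toLinearMap ∘ₗ (TensorProduct.mk K B B).flip b').lTensor B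
            (ℬ.T₃ (b ⊗ₜ e))))) := by
  -- `Ξ (x ⊗ (w ⊗ a)) = (x ▶ a) ⊗ wb'`
  let Ξ : B ⊗[K] (B ⊗[K] A) →ₗ[K] A ⊗[K] B := (TensorProduct.comm K B A).toLinearMap ∘ₗ
    TensorProduct.lift (LinearMap.lTensorHom B ∘ₗ P.lactA) ∘ₗ
      ((ℬ.mul.flip b').rTensor A).lTensor B
  have hl : ∀ z, (ℬ.mul.flip b').lTensor A (P.L ((P.lactA e).lTensor B z))
      = Ξ (TensorProduct.assoc K B B A
        ((ℬ.T₃.toLinearMap ∘ₗ (TensorProduct.mk K B B).flip e).rTensor A z)) := by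
    intro z
    induction z with
    | zero => simp
    | add x y hx hy => simp only [map_add, hx, hy]
    | tmul b a =>
      have h : ∀ t, (ℬ.mul.flip b').lTensor A (TensorProduct.comm K B A
          ((P.lactA.flip a).lTensor B t)) = Ξ (TensorProduct.assoc K B B A
            (TensorProduct.comm K B B t ⊗ₜ a)) := by
        intro t
        induction t with
        | zero => simp
        | add x y hx hy => simp only [map_add, TensorProduct.add_tmul, hx, hy]
        | tmul u v => simp [Ξ]
      rw [LinearMap.lTensor_tmul, L_tmul_lactA, h]
      rfl
  have hr : ∀ t, (TensorProduct.lift ((Q.ractA ∘ₗ P.lactA.flip a).compl₂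
          ℬ.antipode.symm.toLinearMap)).rTensor B
        (TensorProduct.comm K B (B ⊗[K] B) (TensorProduct.leftComm K B B B
          ((ℬ.T₃.toLinearMap ∘ₗ (TensorProduct.mk K B B).flip b').lTensor B t)))
      = Ξ (Q.R.symm.toLinearMap.lTensor B (TensorProduct.assoc K B B A (t ⊗ₜ a))) := by
    intro t
    induction t with
    | zero => simp
    | add x y hx hy => simp only [map_add, TensorProduct.add_tmul, hx, hy]
    | tmul x w =>
      have h : ∀ t, (TensorProduct.lift ((Q.ractA ∘ₗ P.lactA.flip a).compl₂
          ℬ.antipode.symm.toLinearMap)).rTensor B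
          (TensorProduct.comm K B (B ⊗[K] B) (TensorProduct.leftComm K B B B (x ⊗ₜ t)))
          = TensorProduct.comm K B A ((P.lactA x).lTensor B
            ((Q.ractA a ∘ₗ ℬ.antipode.symm.toLinearMap).lTensor B t)) := by
        intro t
        induction t with
        | zero => simp
        | add x y hx hy => simp only [map_add, TensorProduct.tmul_add, hx, hy]
        | tmul u v => simp [lactA_ractA']
      rw [LinearMap.lTensor_tmul, h]
      simp only [LinearMap.comp_apply, LinearMap.flip_apply, TensorProduct.mk_apply,
        LinearEquiv.coe_coe]
      rw [← R_symm_mul_right]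
      simp [Ξ]
  rw [hr]
  have h1 := T₃_R Q e (Q.R.symm (b ⊗ₜ a))
  rw [LinearEquiv.apply_symm_apply] at h1
  have h2 : ∀ t : B ⊗[K] (B ⊗[K] A),
      Q.R.symm.toLinearMap.lTensor B (Q.R.toLinearMap.lTensor B t) = t := fun t => by
    rw [← LinearMap.lTensor_comp_apply]
    simp
  have h3 := congrArg (Q.R.symm.toLinearMap.lTensor B) h1
  rw [h2] at h3
  have h4 : T P Q (b ⊗ₜ P.lactA e a) = P.L ((P.lactA e).lTensor B (Q.R.symm (b ⊗ₜ a))) := by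
    refine congrArg P.L ((LinearEquiv.symm_apply_eq _).2 ?_)
    rw [← R_lactA, LinearEquiv.apply_symm_apply]
    rfl
  rw [h4, hl, h3]
  rfl

/-- The twist map `T_p` for `p = (α, β)`. -/
theorem isTwist_iff (p : ℬ.AutPair) (T' : B ⊗[K] A →ₗ[K] A ⊗[K] B) :
    P.IsTwist p T' ↔ T' = (T (P.twist p.fst) (P.twist p.snd)).toLinearMap := by
  have hs : ∀ a t, P.sandwich p a t
      = (TensorProduct.lift (((P.twist p.snd).ractA ∘ₗ (P.twist p.fst).lactA.flip a).compl₂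
          ℬ.antipode.symm.toLinearMap)).rTensor B
        (TensorProduct.comm K B (B ⊗[K] B) (TensorProduct.leftComm K B B B t)) := by
    intro a t
    have hS : ∀ b, ℬ.antipode.symm (p.snd.1 b) = p.snd.1 (ℬ.antipode.symm b) := fun b => by
      rw [LinearEquiv.symm_apply_eq, ℬ.antipode_hopfAut, LinearEquiv.apply_symm_apply]
    have : (P.ractA ∘ₗ P.lactA.flip a ∘ₗ p.fst.1.toLinearMap).compl₂
        (ℬ.antipode.symm.toLinearMap ∘ₗ p.snd.1.toLinearMap)
        = ((P.twist p.snd).ractA ∘ₗ (P.twist p.fst).lactA.flip a).compl₂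
          ℬ.antipode.symm.toLinearMap := by
      ext b b'
      simp [twist, hS]
    rw [sandwich, this]
    rfl
  have h : P.IsTwist p (T (P.twist p.fst) (P.twist p.snd)).toLinearMap := by
    intro b e a b'
    rw [hs, ← T_formula]
    simp [twist]
  refine ⟨fun h' => TensorProduct.ext' fun b a => ?_, fun h' => h' ▸ h⟩
  obtain ⟨e, he⟩ := P.isModule_lactA.exists_unit a
  refine lTensor_joint (f := fun b' => ℬ.mul.flip b') ℬ.isMultiplierHopf.nondegenerate.1
    fun b' => ?_
  rw [← he, h', h]

end Pairing

/-! ### Twisted tensor products -/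

/-- A bijective twist map `T : S ⊗ R → R ⊗ S` for the algebras `R` and `S`, that is, one which is
compatible with the products of `R` and `S`. The compatibility conditions are stated with `T⁻¹`:
`T(T⁻¹(z)(1 ⊗ a')) = ∑ a T(b ⊗ a')` and `T((b' ⊗ 1)T⁻¹(z)) = ∑ T(b' ⊗ a)b` for `z = ∑ a ⊗ b`. -/
structure TwistMap {K A B : Type*} [Field K] [AddCommGroup A] [Module K A] [AddCommGroup B]
    [Module K B] (R : NUAlgebra K A) (S : NUAlgebra K B) where
  T : B ⊗[K] A ≃ₗ[K] A ⊗[K] B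
  mul_A : ∀ z a', T ((R.mul.flip a').lTensor B (T.symm z))
    = TensorProduct.lift ((LinearMap.rTensorHom B ∘ₗ R.mul).compl₂
        (T.toLinearMap ∘ₗ (TensorProduct.mk K B A).flip a')) z
  mul_B : ∀ z b', T ((S.mul b').rTensor A (T.symm z))
    = TensorProduct.lift ((LinearMap.lTensorHom A ∘ₗ S.mul.flip).flip ∘ₗ
        (T.toLinearMap ∘ₗ TensorProduct.mk K B A b')) z
  unitsA : R.HasLocalUnits
  unitsB : S.HasLocalUnits

namespace TwistMap

variable {K A B : Type*} [Field K] [AddCommGroup A] [Module K A] [AddCommGroup B]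
    [Module K B] {R : NUAlgebra K A} {S : NUAlgebra K B} (t : TwistMap R S)

/-- Left multiplication by `a ⋈ 1`. -/
def lA (_ : TwistMap R S) : A →ₗ[K] A ⊗[K] B →ₗ[K] A ⊗[K] B := LinearMap.rTensorHom B ∘ₗ R.mul

/-- Right multiplication by `1 ⋈ b`. -/
def rB (_ : TwistMap R S) : B →ₗ[K] A ⊗[K] B →ₗ[K] A ⊗[K] B := LinearMap.lTensorHom A ∘ₗ S.mul.flip

/-- Left multiplication by `1 ⋈ b`. -/
def lB : B →ₗ[K] A ⊗[K] B →ₗ[K] A ⊗[K] B :=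
  t.T.conj.toLinearMap ∘ₗ LinearMap.rTensorHom A ∘ₗ S.mul

/-- Right multiplication by `a ⋈ 1`. -/
def rA : A →ₗ[K] A ⊗[K] B →ₗ[K] A ⊗[K] B :=
  t.T.conj.toLinearMap ∘ₗ LinearMap.lTensorHom B ∘ₗ R.mul.flip

@[simp] theorem lA_tmul (a a' : A) (b : B) : t.lA a (a' ⊗ₜ b) = R.mul a a' ⊗ₜ b := by simp [lA]

@[simp] theorem rB_tmul (b b' : B) (a : A) : t.rB b (a ⊗ₜ b') = a ⊗ₜ S.mul b' b := by simp [rB]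

theorem lB_T (b : B) (z : B ⊗[K] A) : t.lB b (t.T z) = t.T ((S.mul b).rTensor A z) := by
  simp [lB, LinearEquiv.conj_apply]

theorem rA_T (a : A) (z : B ⊗[K] A) : t.rA a (t.T z) = t.T ((R.mul.flip a).lTensor B z) := by
  simp [rA, LinearEquiv.conj_apply]

theorem lB_tmul (b b' : B) (a : A) : t.lB b (a ⊗ₜ b') = t.rB b' (t.T (b ⊗ₜ a)) := by
  have h := t.mul_B (a ⊗ₜ b') b
  rw [← t.lB_T, LinearEquiv.apply_symm_apply] at h
  rw [h]
  simp [rB]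

theorem rA_tmul (a a' : A) (b : B) : t.rA a (a' ⊗ₜ b) = t.lA a' (t.T (b ⊗ₜ a)) := by
  have h := t.mul_A (a' ⊗ₜ b) a
  rw [← t.rA_T, LinearEquiv.apply_symm_apply] at h
  rw [h]
  simp [lA]

theorem isModule_lA : R.IsModule t.lA := t.unitsA.left.rTensor

theorem isModule_rB : S.opp.IsModule t.rB := t.unitsB.right.lTensor

theorem isModule_lB : S.IsModule t.lB := t.unitsB.left.rTensor.conj t.T t.lB_T

theorem isModule_rA : R.opp.IsModule t.rA := t.unitsA.right.lTensor.conj t.T t.rA_T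

theorem lA_rB (a : A) (b : B) (z : A ⊗[K] B) : t.lA a (t.rB b z) = t.rB b (t.lA a z) := by
  induction z with
  | zero => simp
  | add x y hx hy => simp only [map_add, hx, hy]
  | tmul u v => simp

/-- The covariance relation `(1 ⋈ b)(a ⋈ 1) = T(b ⊗ a)`. -/
theorem lB_lA (b : B) (a : A) (z : A ⊗[K] B) : t.lB b (t.lA a z)
    = TensorProduct.lift ((LinearMap.mul K (Module.End K (A ⊗[K] B))).compl₁₂ t.lA t.lB)
        (t.T (b ⊗ₜ a)) z := by
  induction z with
  | zero => simp
  | add x y hx hy => simp only [map_add, hx, hy]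
  | tmul a' b' =>
    have h := t.rA_T a' (b ⊗ₜ a)
    rw [LinearMap.lTensor_tmul, LinearMap.flip_apply] at h
    rw [lA_tmul, lB_tmul, ← h]
    generalize t.T (b ⊗ₜ a) = w
    induction w with
    | zero => simp
    | add x y hx hy => simp only [map_add, LinearMap.add_apply, hx, hy]
    | tmul u v => simp [rA_tmul, lB_tmul, lA_rB]

/-- The twisted tensor product, on the space `A ⊗ B`, with `(a ⊗ b)(a' ⊗ b') = a T(b ⊗ a') b'`. -/
def algebra : NUAlgebra K (A ⊗[K] B) where
  mul := TensorProduct.lift ((LinearMap.mul K (Module.End K (A ⊗[K] B))).compl₁₂ t.lA t.lB)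
  assoc x y z := by
    set m := TensorProduct.lift ((LinearMap.mul K (Module.End K (A ⊗[K] B))).compl₁₂ t.lA t.lB)
      with hm
    have hA : ∀ a y z, m (t.lA a y) z = t.lA a (m y z) := by
      intro a y z
      induction y with
      | zero => simp
      | add x y hx hy => simp only [map_add, LinearMap.add_apply, hx, hy]
      | tmul u v => simp [hm, t.isModule_lA.mul_act]
    have hr : ∀ b y z, m (t.rB b y) z = m y (t.lB b z) := by
      intro b y z
      induction y with
      | zero => simp
      | add x y hx hy => simp only [map_add, LinearMap.add_apply, hx, hy]
      | tmul u v => simp [hm, t.isModule_lB.mul_act]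
    have hB : ∀ b y z, m (t.lB b y) z = t.lB b (m y z) := by
      intro b y z
      induction y with
      | zero => simp
      | add x y hx hy => simp only [map_add, LinearMap.add_apply, hx, hy]
      | tmul u v =>
        rw [lB_tmul, hr]
        refine (t.lB_lA b u (t.lB v z)).symm.trans ?_
        simp [hm]
    induction x with
    | zero => simp
    | add x y hx hy => simp only [map_add, LinearMap.add_apply, hx, hy]
    | tmul u v =>
      have h : ∀ z, m (u ⊗ₜ v) z = t.lA u (t.lB v z) := fun z => by simp [hm]
      rw [h, h, hA, hB]

theorem mul_tmul (a : A) (b : B) (z : A ⊗[K] B) :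
    t.algebra.mul (a ⊗ₜ b) z = t.lA a (t.lB b z) := by simp [algebra]

theorem mul_tmul_right (a : A) (b : B) (z : A ⊗[K] B) :
    t.algebra.mul z (a ⊗ₜ b) = t.rB b (t.rA a z) := by
  induction z with
  | zero => simp
  | add x y hx hy => simp only [map_add, LinearMap.add_apply, hx, hy]
  | tmul u v => rw [mul_tmul, lB_tmul, rA_tmul, lA_rB]

theorem mul_tmul_tmul (a a' : A) (b b' : B) : t.algebra.mul (a ⊗ₜ b) (a' ⊗ₜ b')
    = TensorProduct.map (R.mul a) (S.mul.flip b') (t.T (b ⊗ₜ a')) := by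
  rw [mul_tmul, lB_tmul, map_eq_rTensor_lTensor]
  rfl

theorem nondegenerate : t.algebra.Nondegenerate := by
  constructor
  · intro x hx
    rw [← t.T.symm.map_eq_zero_iff]
    refine lTensor_joint (f := fun a => R.mul.flip a) t.unitsA.nondegenerate.1 fun a => ?_
    rw [map_zero]
    have h : t.rA a x = 0 := by
      refine lTensor_joint (f := fun b => S.mul.flip b) t.unitsB.nondegenerate.1 fun b => ?_
      rw [map_zero]
      exact (t.mul_tmul_right a b x).symm.trans (hx _)
    rw [← t.T.apply_symm_apply x, rA_T] at h
    exact (t.T.map_eq_zero_iff).1 h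
  · intro x hx
    rw [← t.T.symm.map_eq_zero_iff]
    refine rTensor_joint (f := fun b => S.mul b) t.unitsB.nondegenerate.2 fun b => ?_
    rw [map_zero]
    have h : t.lB b x = 0 := by
      refine rTensor_joint (f := fun a => R.mul a) t.unitsA.nondegenerate.2 fun a => ?_
      rw [map_zero]
      exact (t.mul_tmul a b x).symm.trans (hx _)
    rw [← t.T.apply_symm_apply x, lB_T] at h
    exact (t.T.map_eq_zero_iff).1 h

/-- The embedding `a ↦ a ⋈ 1` of `R` into the multiplier algebra of the twisted tensor product. -/
def homA : R.NondegHom t.algebra where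
  l := t.lA
  r := t.rA
  isModule_l := t.isModule_lA
  isModule_r := t.isModule_rA
  compat a x y := by
    induction y with
    | zero => simp
    | add x y hx hy => simp only [map_add, hx, hy]
    | tmul u v =>
      rw [lA_tmul, mul_tmul_right, mul_tmul_right]
      exact congrArg _ (t.isModule_rA.mul_act u a x)

/-- The embedding `b ↦ 1 ⋈ b` of `S` into the multiplier algebra of the twisted tensor product. -/
def homB : S.NondegHom t.algebra where
  l := t.lB
  r := t.rB
  isModule_l := t.isModule_lB
  isModule_r := t.isModule_rB
  compat b x y := by
    induction x with
    | zero => simp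
    | add x y hx hy => simp only [map_add, LinearMap.add_apply, hx, hy]
    | tmul u v => rw [rB_tmul, mul_tmul, mul_tmul, t.isModule_lB.mul_act]

section Lift

variable {E : Type*} [Semiring E] [Module K E] [SMulCommClass K E E] [IsScalarTower K E E]

/-- The map `a ⊗ b ↦ π(a)θ(b)`, for linear maps `π` and `θ` into an algebra. -/
def prodMap (π : A →ₗ[K] E) (θ : B →ₗ[K] E) : A ⊗[K] B →ₗ[K] E :=
  TensorProduct.lift ((LinearMap.mul K E).compl₁₂ π θ)

@[simp] theorem prodMap_tmul (π : A →ₗ[K] E) (θ : B →ₗ[K] E) (a : A) (b : B) :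
    prodMap π θ (a ⊗ₜ b) = π a * θ b := by simp [prodMap]

/-- A covariant pair of homomorphisms into an algebra `E`, `θ(b)π(a) = ∑ π(aᵢ)θ(bᵢ)` for
`T(b ⊗ a) = ∑ aᵢ ⊗ bᵢ`, gives a homomorphism `a ⊗ b ↦ π(a)θ(b)` of the twisted tensor product. -/
theorem prodMap_mul {π : A →ₗ[K] E} {θ : B →ₗ[K] E}
    (hπ : ∀ a a', π (R.mul a a') = π a * π a') (hθ : ∀ b b', θ (S.mul b b') = θ b * θ b')
    (h : ∀ b a, θ b * π a = prodMap π θ (t.T (b ⊗ₜ a))) (x y : A ⊗[K] B) :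
    prodMap π θ (t.algebra.mul x y) = prodMap π θ x * prodMap π θ y := by
  induction x with
  | zero => simp
  | add x y hx hy => simp only [map_add, LinearMap.add_apply, add_mul, hx, hy]
  | tmul a b =>
    induction y with
    | zero => simp
    | add x y hx hy => simp only [map_add, mul_add, hx, hy]
    | tmul a' b' =>
      rw [mul_tmul_tmul]
      have hl : ∀ z, prodMap π θ (TensorProduct.map (R.mul a) (S.mul.flip b') z)
          = π a * prodMap π θ z * θ b' := by
        intro z
        induction z with
        | zero => simp
        | add x y hx hy => simp only [map_add, mul_add, add_mul, hx, hy]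
        | tmul u v => simp [hπ, hθ, mul_assoc]
      rw [hl, ← h]
      simp [mul_assoc]

end Lift

end TwistMap

/-- The twist map of two pairings of regular multiplier Hopf algebras. -/
def Pairing.twistMap {K A B : Type*} [Field K] [AddCommGroup A] [Module K A]
    [AddCommGroup B] [Module K B] {𝒜 : RegularMHA K A} {ℬ : RegularMHA K B} (P Q : Pairing 𝒜 ℬ) :
    TwistMap 𝒜.toNUAlgebra ℬ.toNUAlgebra where
  T := T P Q
  mul_A := T_mul_A P Q
  mul_B := T_mul_B P Q
  unitsA := 𝒜.hasLocalUnits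
  unitsB := ℬ.hasLocalUnits

/-! ### Covariant pairs of actions -/

namespace Pairing

variable {K : Type*} {A : Type*} {B : Type*} [Field K] [AddCommGroup A] [Module K A]
  [AddCommGroup B] [Module K B] {𝒜 : RegularMHA K A} {ℬ : RegularMHA K B}
  {N N' : Type*} [AddCommGroup N] [Module K N] [AddCommGroup N'] [Module K N']

/-- The map `a ⊗ b ↦ π(a)θ(b)`. -/
def mulMap {A B : Type*} [AddCommGroup A] [Module K A] [AddCommGroup B] [Module K B]
    (π : A →ₗ[K] N →ₗ[K] N) (θ : B →ₗ[K] N →ₗ[K] N) : A ⊗[K] B →ₗ[K] N →ₗ[K] N :=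
  TensorProduct.lift ((LinearMap.mul K (Module.End K N)).compl₁₂ π θ)

@[simp] theorem mulMap_tmul (π : A →ₗ[K] N →ₗ[K] N) (θ : B →ₗ[K] N →ₗ[K] N) (a : A) (b : B)
    (n : N) : mulMap π θ (a ⊗ₜ b) n = π a (θ b n) := by simp [mulMap]

/-- The commutation relation `∑ θ(b₍₁₎)π(a ◀ b₍₂₎) = ∑ π(b₍₁₎ ▶ a)θ(b₍₂₎)` between actions of `A` and
`B`. -/
def Covariant (P Q : Pairing 𝒜 ℬ) (π : A →ₗ[K] N →ₗ[K] N) (θ : B →ₗ[K] N →ₗ[K] N) : Prop :=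
  ∀ z, mulMap θ π (Q.R z) = mulMap π θ (P.L z)

theorem twist_twist (P : Pairing 𝒜 ℬ) (α φ : ℬ.hopfAut) :
    (P.twist α).twist φ = P.twist (α * φ) := rfl

theorem twist_L (P : Pairing 𝒜 ℬ) (φ : ℬ.hopfAut) (b : B) (a : A) :
    φ.1.toLinearMap.lTensor A ((P.twist φ).L (b ⊗ₜ a)) = P.L (φ.1 b ⊗ₜ a) := by
  refine (P.twist φ).tensor_extA fun y => ?_
  rw [sliceL_lTensor, sliceL_L]
  refine Eq.trans ?_ (P.sliceL_L (φ.1 y) _ _).symm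
  simp [twist]

theorem twist_R (P : Pairing 𝒜 ℬ) (φ : ℬ.hopfAut) (b : B) (a : A) :
    φ.1.toLinearMap.rTensor A ((P.twist φ).R (b ⊗ₜ a)) = P.R (φ.1 b ⊗ₜ a) := by
  refine P.tensor_extB fun x => ?_
  rw [sliceL_rTensor, sliceL_R]
  refine Eq.trans ((P.twist φ).sliceL_R x b a) ?_
  simp [twist]

theorem Covariant.twist {P Q : Pairing 𝒜 ℬ} {π : A →ₗ[K] N →ₗ[K] N} {θ : B →ₗ[K] N →ₗ[K] N}
    (h : Covariant P Q π θ) (φ : ℬ.hopfAut) :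
    Covariant (P.twist φ) (Q.twist φ) π (θ ∘ₗ φ.1.toLinearMap) := by
  have h1 : ∀ z : A ⊗[K] B, mulMap π (θ ∘ₗ φ.1.toLinearMap) z
      = mulMap π θ (φ.1.toLinearMap.lTensor A z) := by
    intro z
    induction z with
    | zero => simp
    | add x y hx hy => simp only [map_add, hx, hy]
    | tmul u v => ext; simp
  have h2 : ∀ z : B ⊗[K] A, mulMap (θ ∘ₗ φ.1.toLinearMap) π z
      = mulMap θ π (φ.1.toLinearMap.rTensor A z) := by
    intro z
    induction z with
    | zero => simp
    | add x y hx hy => simp only [map_add, hx, hy]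
    | tmul u v => ext; simp
  intro z
  induction z with
  | zero => simp
  | add x y hx hy => simp only [map_add, hx, hy]
  | tmul b a => rw [h1, h2, twist_L, twist_R, h]

/-- The covariance relation in terms of the twist map: `θ(b)π(a) = ∑ π(aᵢ)θ(bᵢ)` for
`T(b ⊗ a) = ∑ aᵢ ⊗ bᵢ`. -/
theorem covariant_iff {P Q : Pairing 𝒜 ℬ} {π : A →ₗ[K] N →ₗ[K] N} {θ : B →ₗ[K] N →ₗ[K] N} :
    Covariant P Q π θ ↔ ∀ b a n, θ b (π a n) = mulMap π θ (T P Q (b ⊗ₜ a)) n := by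
  constructor
  · intro h b a n
    have := h (Q.R.symm (b ⊗ₜ a))
    rw [LinearEquiv.apply_symm_apply] at this
    rw [← mulMap_tmul, this]
    rfl
  · intro h z
    rw [← T_R P Q]
    generalize Q.R z = w
    induction w with
    | zero => simp
    | add x y hx hy => simp only [map_add, hx, hy]
    | tmul b a => ext n; rw [mulMap_tmul, h]

/-- Left multiplications by `A` and `B` on their twisted tensor product are covariant. -/
theorem covariant_twistMap (P Q : Pairing 𝒜 ℬ) :
    Covariant P Q (twistMap P Q).lA (twistMap P Q).lB :=
  covariant_iff.2 fun b a n => (twistMap P Q).lB_lA b a n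

section Can

variable (P Q : Pairing 𝒜 ℬ) {π : A →ₗ[K] N →ₗ[K] N} {θ : B →ₗ[K] N →ₗ[K] N}
  (hπ : 𝒜.IsModule π) (hθ : ℬ.IsModule θ)

/-- For the action `θ` of `B` on `N`, the map `b ⊗ n ↦ b₍₁₎ ⊗ θ(b₍₂₎)n`. -/
abbrev canB (hθ : ℬ.IsModule θ) : B ⊗[K] N ≃ₗ[K] B ⊗[K] N :=
  ℬ.isMultiplierHopf.canL ℬ.hasLocalUnits hθ

/-- For the action `π` of `A` on `N`, the map `a ⊗ n ↦ a₍₂₎ ⊗ π(a₍₁₎)n`. -/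
abbrev canA (hπ : 𝒜.IsModule π) : A ⊗[K] N ≃ₗ[K] A ⊗[K] N :=
  𝒜.isMultiplierHopf_cop.canL 𝒜.hasLocalUnits hπ

theorem sliceL_canB (x : A) (z : B ⊗[K] N) :
    sliceL N (P.form x) (canB hθ z) = TensorProduct.lift (θ ∘ₗ P.ractB.flip x) z := by
  induction z with
  | zero => simp
  | add x y hx hy => simp only [map_add, hx, hy]
  | tmul b n =>
    exact ℬ.isMultiplierHopf.sliceL_canL ℬ.hasLocalUnits hθ (g := P.ractB.flip x)
      (fun b k => P.sliceL_T1 x b k) b n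

theorem sliceL_canA (y : B) (z : A ⊗[K] N) :
    sliceL N (P.form.flip y) (canA hπ z) = TensorProduct.lift (π ∘ₗ P.lactA y) z := by
  induction z with
  | zero => simp
  | add x y hx hy => simp only [map_add, hx, hy]
  | tmul a n =>
    exact 𝒜.isMultiplierHopf_cop.sliceL_canL 𝒜.hasLocalUnits hπ (g := P.lactA y)
      (fun a k => P.symm.sliceL_T1_cop y a k) a n

theorem canB_ractB (x : A) (b : B) (n : N) :
    (P.ractB.flip x).rTensor N (canB hθ (b ⊗ₜ n)) = canB hθ (P.ractB b x ⊗ₜ n) := by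
  refine P.tensor_extB fun x' => ?_
  rw [sliceL_rTensor, sliceL_canB]
  have h : P.form x' ∘ₗ P.ractB.flip x = P.form (𝒜.mul x x') :=
    LinearMap.ext fun b => (P.form_mul_left' x x' b).symm
  rw [h, sliceL_canB]
  simp [ractB_mul]

/-- `∑ π(b₍₁₎ ▶ a)θ(b₍₂₎)`, computed with the coproduct of `b` in two ways. -/
theorem lift_canB (b : B) (a : A) (n : N) :
    TensorProduct.lift (π ∘ₗ P.lactA.flip a) (canB hθ (b ⊗ₜ n)) = mulMap π θ (P.L (b ⊗ₜ a)) n := by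
  obtain ⟨e, he⟩ := hθ.exists_unit n
  have h1 : ∀ w : A ⊗[K] B, mulMap π θ w n = mulMap π θ ((ℬ.mul.flip e).lTensor A w) n := by
    intro w
    induction w with
    | zero => simp
    | add x y hx hy => simp only [map_add, LinearMap.add_apply, hx, hy]
    | tmul u v => simp [hθ.mul_act, he]
  rw [h1, L_mul_right]
  conv_lhs => rw [← he]
  rw [IsMultiplierHopf.canL_tmul_act]
  generalize ℬ.isMultiplierHopf.T1 (b ⊗ₜ e) = z
  induction z with
  | zero => simp
  | add x y hx hy => simp only [map_add, LinearMap.add_apply, hx, hy]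
  | tmul u v => simp

/-- `∑ (b₍₁₎ ▶ a) ⊗ (b₍₂₎ ◀ x)e = ∑ ((x ▶ b₍₁₎) ▶ a) ⊗ b₍₂₎e`. -/
theorem L_ractB_mul (x a : A) (b e : B) :
    (ℬ.mul.flip e ∘ₗ P.ractB.flip x).lTensor A (P.L (b ⊗ₜ a))
      = (P.lactA.flip a ∘ₗ P.lactB x).rTensor B (ℬ.isMultiplierHopf.T1 (b ⊗ₜ e)) := by
  refine P.tensor_extA fun y => ?_
  have h : P.form.flip y ∘ₗ P.lactA.flip a ∘ₗ P.lactB x = P.form (𝒜.mul (P.ractA a y) x) :=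
    LinearMap.ext fun c => by
      rw [P.form_mul_left, ← P.form_mul_right']
      exact (P.form_mul_right a y _).symm
  rw [sliceL_lTensor, sliceL_L, sliceL_rTensor, h, sliceL_T1, ractB_mul]
  rfl

theorem lift_canB_lactA (x a : A) (b y : B) (n : N) :
    TensorProduct.lift (π ∘ₗ P.lactA y ∘ₗ P.lactA.flip a ∘ₗ P.lactB x) (canB hθ (b ⊗ₜ n))
      = mulMap (π ∘ₗ P.lactA y) (θ ∘ₗ P.ractB.flip x) (P.L (b ⊗ₜ a)) n := by
  obtain ⟨e, he⟩ := hθ.exists_unit n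
  have h1 : ∀ w : A ⊗[K] B, mulMap (π ∘ₗ P.lactA y) (θ ∘ₗ P.ractB.flip x) w n
      = mulMap (π ∘ₗ P.lactA y) θ ((ℬ.mul.flip e ∘ₗ P.ractB.flip x).lTensor A w) n := by
    intro w
    induction w with
    | zero => simp
    | add x y hx hy => simp only [map_add, LinearMap.add_apply, hx, hy]
    | tmul u v => simp [hθ.mul_act, he]
  rw [h1, L_ractB_mul]
  conv_lhs => rw [← he]
  rw [IsMultiplierHopf.canL_tmul_act]
  generalize ℬ.isMultiplierHopf.T1 (b ⊗ₜ e) = z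
  induction z with
  | zero => simp
  | add x y hx hy => simp only [map_add, LinearMap.add_apply, hx, hy]
  | tmul u v => simp

/-- `(canB)₁₃` on `B ⊗ (A ⊗ N)`. -/
def canB13 (hθ : ℬ.IsModule θ) : B ⊗[K] (A ⊗[K] N) →ₗ[K] B ⊗[K] (A ⊗[K] N) :=
  (TensorProduct.leftComm K A B N).toLinearMap ∘ₗ (canB hθ).toLinearMap.lTensor A ∘ₗ
    (TensorProduct.leftComm K B A N).toLinearMap

/-- `(canA)₁₃` on `A ⊗ (B ⊗ N)`. -/
def canA13 (hπ : 𝒜.IsModule π) : A ⊗[K] (B ⊗[K] N) →ₗ[K] A ⊗[K] (B ⊗[K] N) :=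
  (TensorProduct.leftComm K B A N).toLinearMap ∘ₗ (canA hπ).toLinearMap.lTensor B ∘ₗ
    (TensorProduct.leftComm K A B N).toLinearMap

theorem sliceL_sliceL_leftComm {V W : Type*} [AddCommGroup V] [Module K V] [AddCommGroup W]
    [Module K W] (f : V →ₗ[K] K) (g : W →ₗ[K] K) (z : V ⊗[K] (W ⊗[K] N)) :
    sliceL N f (sliceL _ g (TensorProduct.leftComm K V W N z)) = sliceL N g (sliceL _ f z) := by
  induction z with
  | zero => simp
  | add x y hx hy => simp only [map_add, hx, hy]
  | tmul v u =>
    induction u with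
    | zero => simp
    | add x y hx hy => simp only [map_add, TensorProduct.tmul_add, hx, hy]
    | tmul w n => simp [smul_smul, mul_comm]

theorem sliceL_leftComm {V W : Type*} [AddCommGroup V] [Module K V] [AddCommGroup W]
    [Module K W] (g : W →ₗ[K] K) (z : V ⊗[K] (W ⊗[K] N)) :
    sliceL _ g (TensorProduct.leftComm K V W N z) = (sliceL N g).lTensor V z := by
  induction z with
  | zero => simp
  | add x y hx hy => simp only [map_add, hx, hy]
  | tmul v u =>
    induction u with
    | zero => simp
    | add x y hx hy => simp only [map_add, TensorProduct.tmul_add, hx, hy]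
    | tmul w n => simp

theorem sliceL_assoc {V W : Type*} [AddCommGroup V] [Module K V] [AddCommGroup W]
    [Module K W] (f : V →ₗ[K] K) (z : V ⊗[K] W) (n : N) :
    sliceL _ f (TensorProduct.assoc K V W N (z ⊗ₜ n)) = sliceL W f z ⊗ₜ n := by
  induction z with
  | zero => simp
  | add x y hx hy => simp only [map_add, TensorProduct.add_tmul, hx, hy]
  | tmul v u => simp [TensorProduct.smul_tmul']

theorem canA_canB13 (b : B) (a : A) (n : N) :
    (canA hπ).toLinearMap.lTensor B (canB13 hθ (b ⊗ₜ (a ⊗ₜ n)))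
      = ((canA hπ).toLinearMap ∘ₗ TensorProduct.mk K A N a).lTensor B (canB hθ (b ⊗ₜ n)) := by
  simp only [canB13, LinearMap.comp_apply, LinearEquiv.coe_coe, TensorProduct.leftComm_tmul,
    LinearMap.lTensor_tmul]
  generalize canB hθ (b ⊗ₜ n) = z
  induction z with
  | zero => simp
  | add x y hx hy => simp only [map_add, TensorProduct.tmul_add, hx, hy]
  | tmul v u => simp

/-- The covariance relation for the canonical maps of `N`: with `X = (canB)₁₃` and `Y = (canA)₂₃`
on `B ⊗ A ⊗ N`, one has `XYR' = RYX`, where `R` belongs to `Q` and `R'` to `Q'`. Slicing by `x` and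
`y` gives back the relation for the elements `b ◀ x` and `y ▶ a`. -/
theorem canB_canA_R {Q' : Pairing 𝒜 ℬ} (h : Covariant Q Q' π θ) (b : B) (a : A) (n : N) :
    canB13 hθ ((canA hπ).toLinearMap.lTensor B (TensorProduct.assoc K B A N (Q'.R (b ⊗ₜ a) ⊗ₜ n)))
      = TensorProduct.assoc K B A N (Q.R.toLinearMap.rTensor N ((TensorProduct.assoc K B A N).symm
        ((canA hπ).toLinearMap.lTensor B (canB13 hθ (b ⊗ₜ (a ⊗ₜ n)))))) := by
  refine Q.tensor_extB fun x => Q.tensor_extA fun y => ?_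
  have h1 : ∀ w : B ⊗[K] A, sliceL N (Q.form.flip y) (sliceL _ (Q.form x) (canB13 hθ
      ((canA hπ).toLinearMap.lTensor B (TensorProduct.assoc K B A N (w ⊗ₜ n)))))
      = mulMap θ π ((Q.ractB.flip x).rTensor A ((Q.lactA y).lTensor B w)) n := by
    intro w
    rw [canB13, LinearMap.comp_apply, LinearMap.comp_apply, LinearEquiv.coe_coe,
      sliceL_sliceL_leftComm, sliceL_lTensor, LinearEquiv.coe_coe, sliceL_canB, LinearEquiv.coe_coe,
      sliceL_leftComm]
    induction w with
    | zero => simp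
    | add x y hx hy => simp only [map_add, TensorProduct.add_tmul, LinearMap.add_apply, hx, hy]
    | tmul u v => simp [sliceL_canA]
  have h2 : ∀ w : B ⊗[K] N, sliceL N (Q.form.flip y) (sliceL _ (Q.form x)
      (TensorProduct.assoc K B A N (Q.R.toLinearMap.rTensor N ((TensorProduct.assoc K B A N).symm
        (((canA hπ).toLinearMap ∘ₗ TensorProduct.mk K A N a).lTensor B w)))))
      = TensorProduct.lift (π ∘ₗ Q.lactA.flip (Q.lactA y a)) ((Q.ractB.flip x).rTensor N w) := by
    intro w
    induction w with
    | zero => simp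
    | add x y hx hy => simp only [map_add, hx, hy]
    | tmul b' n' =>
      have h3 : ∀ u : A ⊗[K] N, sliceL N (Q.form.flip y) (sliceL _ (Q.form x)
          (TensorProduct.assoc K B A N (Q.R.toLinearMap.rTensor N
            ((TensorProduct.assoc K B A N).symm (b' ⊗ₜ u)))))
          = sliceL N (Q.form.flip (ℬ.mul (Q.ractB b' x) y)) u := by
        intro u
        induction u with
        | zero => simp
        | add x y hx hy => simp only [map_add, TensorProduct.tmul_add, hx, hy]
        | tmul a' n' =>
          simp [sliceL_assoc, sliceL_R, Q.form_mul_right']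
      rw [LinearMap.lTensor_tmul, h3, LinearMap.comp_apply, LinearEquiv.coe_coe, sliceL_canA]
      simp [lactA_mul]
  rw [h1, canA_canB13, h2, R_lactA, R_ractB, h, canB_ractB, lift_canB]
  rfl

theorem L_canA_canB (b : B) (a : A) (n : N) :
    TensorProduct.assoc K A B N (P.L.toLinearMap.rTensor N ((TensorProduct.assoc K B A N).symm
        ((canA hπ).toLinearMap.lTensor B (canB13 hθ (b ⊗ₜ (a ⊗ₜ n))))))
      = canA13 hπ ((canB hθ).toLinearMap.lTensor A
        (TensorProduct.assoc K A B N (P.L (b ⊗ₜ a) ⊗ₜ n))) := by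
  refine P.tensor_extA fun y => P.tensor_extB fun x => ?_
  have h1 : ∀ w : A ⊗[K] B, sliceL N (P.form x) (sliceL _ (P.form.flip y) (canA13 hπ
      ((canB hθ).toLinearMap.lTensor A (TensorProduct.assoc K A B N (w ⊗ₜ n)))))
      = mulMap (π ∘ₗ P.lactA y) (θ ∘ₗ P.ractB.flip x) w n := by
    intro w
    rw [canA13, LinearMap.comp_apply, LinearMap.comp_apply, LinearEquiv.coe_coe,
      sliceL_sliceL_leftComm, sliceL_lTensor, LinearEquiv.coe_coe, sliceL_canA, LinearEquiv.coe_coe,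
      sliceL_leftComm]
    induction w with
    | zero => simp
    | add x y hx hy => simp only [map_add, TensorProduct.add_tmul, LinearMap.add_apply, hx, hy]
    | tmul u v => simp [sliceL_canB]
  have h2 : ∀ w : B ⊗[K] N, sliceL N (P.form x) (sliceL _ (P.form.flip y)
      (TensorProduct.assoc K A B N (P.L.toLinearMap.rTensor N ((TensorProduct.assoc K B A N).symm
        (((canA hπ).toLinearMap ∘ₗ TensorProduct.mk K A N a).lTensor B w)))))
      = TensorProduct.lift (π ∘ₗ P.lactA y ∘ₗ P.lactA.flip a ∘ₗ P.lactB x) w := by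
    intro w
    induction w with
    | zero => simp
    | add x y hx hy => simp only [map_add, hx, hy]
    | tmul b' n' =>
      have h3 : ∀ u : A ⊗[K] N, sliceL N (P.form x) (sliceL _ (P.form.flip y)
          (TensorProduct.assoc K A B N (P.L.toLinearMap.rTensor N
            ((TensorProduct.assoc K B A N).symm (b' ⊗ₜ u)))))
          = sliceL N (P.form.flip (ℬ.mul y (P.lactB x b'))) u := by
        intro u
        induction u with
        | zero => simp
        | add x y hx hy => simp only [map_add, TensorProduct.tmul_add, hx, hy]
        | tmul a' n' =>
          simp [sliceL_assoc, sliceL_L, P.form_mul_right', P.form_mul_left, ← P.form_mul_left']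
      rw [LinearMap.lTensor_tmul, h3, LinearMap.comp_apply, LinearEquiv.coe_coe, sliceL_canA]
      simp [lactA_mul]
  rw [h1, canA_canB13, h2, lift_canB_lactA]

/-- The tensor product of covariant actions, the middle pairing being the same one: the operators
`U(a) = π(a₍₂₎) ⊗ π'(a₍₁₎)` and `W(b) = θ(b₍₁₎) ⊗ θ'(b₍₂₎)` are covariant again. -/
theorem Covariant.tensor {P Q Q' : Pairing 𝒜 ℬ} {π' : A →ₗ[K] N' →ₗ[K] N'}
    {θ' : B →ₗ[K] N' →ₗ[K] N'} (h : Covariant P Q π θ) (h' : Covariant Q Q' π' θ')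
    (hπ' : 𝒜.IsModule π') (hθ' : ℬ.IsModule θ')
    {U : A →ₗ[K] N ⊗[K] N' →ₗ[K] N ⊗[K] N'} {W : B →ₗ[K] N ⊗[K] N' →ₗ[K] N ⊗[K] N'}
    (hU : ∀ a v n, U a (v ⊗ₜ n) = (π.flip v).rTensor N' (canA hπ' (a ⊗ₜ n)))
    (hW : ∀ b v n, W b (v ⊗ₜ n) = (θ.flip v).rTensor N' (canB hθ' (b ⊗ₜ n))) :
    Covariant P Q' U W := by
  intro z
  refine TensorProduct.ext' fun v n => ?_
  -- `U(a)W(b)(v ⊗ n)` and `W(b)U(a)(v ⊗ n)` through the maps `canA` and `canB`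
  have hUW : ∀ w : A ⊗[K] B, mulMap U W w (v ⊗ₜ n) = ((mulMap π θ).flip v).rTensor N'
      ((TensorProduct.assoc K A B N').symm (canA13 hπ' ((canB hθ').toLinearMap.lTensor A
        (TensorProduct.assoc K A B N' (w ⊗ₜ n))))) := by
    intro w
    induction w with
    | zero => simp
    | add x y hx hy => simp only [map_add, TensorProduct.add_tmul, LinearMap.add_apply, hx, hy]
    | tmul a b =>
      simp only [mulMap_tmul, hW, TensorProduct.assoc_tmul, LinearMap.lTensor_tmul, canA13,
        LinearMap.comp_apply, LinearEquiv.coe_coe]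
      generalize canB hθ' (b ⊗ₜ n) = s
      induction s with
      | zero => simp
      | add x y hx hy => simp only [map_add, TensorProduct.tmul_add, hx, hy]
      | tmul b' n' =>
        simp only [LinearMap.rTensor_tmul, LinearMap.flip_apply, hU, TensorProduct.leftComm_tmul,
          LinearMap.lTensor_tmul, LinearEquiv.coe_coe]
        generalize canA hπ' (a ⊗ₜ n') = s
        induction s with
        | zero => simp
        | add x y hx hy => simp only [map_add, TensorProduct.tmul_add, hx, hy]
        | tmul a' n' => simp
  have hWU : ∀ w : B ⊗[K] A, mulMap W U w (v ⊗ₜ n) = ((mulMap θ π).flip v).rTensor N'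
      ((TensorProduct.assoc K B A N').symm (canB13 hθ' ((canA hπ').toLinearMap.lTensor B
        (TensorProduct.assoc K B A N' (w ⊗ₜ n))))) := by
    intro w
    induction w with
    | zero => simp
    | add x y hx hy => simp only [map_add, TensorProduct.add_tmul, LinearMap.add_apply, hx, hy]
    | tmul b a =>
      simp only [mulMap_tmul, hU, TensorProduct.assoc_tmul, LinearMap.lTensor_tmul, canB13,
        LinearMap.comp_apply, LinearEquiv.coe_coe]
      generalize canA hπ' (a ⊗ₜ n) = s
      induction s with
      | zero => simp
      | add x y hx hy => simp only [map_add, TensorProduct.tmul_add, hx, hy]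
      | tmul a' n' =>
        simp only [LinearMap.rTensor_tmul, LinearMap.flip_apply, hW, TensorProduct.leftComm_tmul,
          LinearMap.lTensor_tmul, LinearEquiv.coe_coe]
        generalize canB hθ' (b ⊗ₜ n') = s
        induction s with
        | zero => simp
        | add x y hx hy => simp only [map_add, TensorProduct.tmul_add, hx, hy]
        | tmul b' n' => simp
  have hc : ((mulMap θ π).flip v) ∘ₗ Q.R.toLinearMap = ((mulMap π θ).flip v) ∘ₗ P.L.toLinearMap :=
    LinearMap.ext fun z => LinearMap.congr_fun (h z) v
  rw [hUW, hWU]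
  induction z with
  | zero => simp
  | add x y hx hy => simp only [map_add, TensorProduct.add_tmul, hx, hy]
  | tmul b a =>
    rw [canB_canA_R Q hπ' hθ' h', ← L_canA_canB, LinearEquiv.symm_apply_apply,
      LinearEquiv.symm_apply_apply, ← LinearMap.rTensor_comp_apply, ← LinearMap.rTensor_comp_apply,
      hc]

end Can

end Pairing

/-! ### Coassociativity of the canonical maps -/

namespace IsMultiplierHopf

variable {K : Type*} [Field K] {V N N' : Type*} [AddCommGroup V] [Module K V]
  [AddCommGroup N] [Module K N] [AddCommGroup N'] [Module K N']
  {R : NUAlgebra K V} {Δ Δ' : V →ₗ[K] (R.tensor R).M}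
  {act act' : V →ₗ[K] N →ₗ[K] N}

/-- Coassociativity: on `V ⊗ N`, for a bimodule `N`, the maps `a ⊗ n ↦ a₍₂₎ ⊗ na₍₁₎` and
`a ⊗ n ↦ a₍₁₎ ⊗ a₍₂₎n` commute. -/
theorem canR_canL (h : IsMultiplierHopf R Δ) (hR : R.HasLocalUnits)
    (hN : R.opp.IsModule act) (hN' : R.IsModule act')
    (hc : ∀ a b n, act a (act' b n) = act' b (act a n)) (z : V ⊗[K] N) :
    h.canR hR hN (h.canL hR hN' z) = h.canL hR hN' (h.canR hR hN z) := by
  induction z with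
  | zero => simp only [map_zero]
  | add x y hx hy => simp only [map_add, hx, hy]
  | tmul a n =>
    obtain ⟨e, he⟩ := hN.exists_unit n
    obtain ⟨f, hf⟩ := hN'.exists_unit n
    have hco := h.coassoc (e ⊗ₜ (a ⊗ₜ f))
    -- the map `(x ⊗ y) ⊗ z ↦ y ⊗ z(nx)`
    let Θ : (V ⊗[K] V) ⊗[K] V →ₗ[K] V ⊗[K] N :=
      TensorProduct.lift (LinearMap.flip (LinearMap.lTensorHom V ∘ₗ act')) |>.comp
        (((act.flip n).lTensor V ∘ₗ (TensorProduct.comm K V V).toLinearMap).rTensor V)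
    have hΘ : ∀ x y z, Θ ((x ⊗ₜ y) ⊗ₜ z) = y ⊗ₜ act' z (act x n) := fun x y z => by simp [Θ]
    have h1 := congrArg Θ hco
    rw [LinearMap.lTensor_tmul, TensorProduct.assoc_symm_tmul, LinearMap.rTensor_tmul] at h1
    have hl : ∀ z : V ⊗[K] V, h.canR hR hN ((act'.flip n).lTensor V z)
        = Θ (h.T2.toLinearMap.rTensor V ((TensorProduct.assoc K V V V).symm (e ⊗ₜ z))) := by
      intro z
      induction z with
      | zero => simp
      | add x y hx hy => simp only [map_add, TensorProduct.tmul_add, hx, hy]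
      | tmul x y =>
        rw [LinearMap.lTensor_tmul, LinearMap.flip_apply]
        conv_lhs => rw [← he]
        rw [← hc, canR_tmul_act, TensorProduct.assoc_symm_tmul, LinearMap.rTensor_tmul,
          LinearEquiv.coe_coe]
        generalize h.T2 (e ⊗ₜ x) = w
        induction w with
        | zero => simp
        | add x y hx hy => simp only [map_add, TensorProduct.add_tmul, hx, hy]
        | tmul u v => simp [hΘ, hc]
    have hr : ∀ z : V ⊗[K] V, h.canL hR hN' ((act.flip n).lTensor V (TensorProduct.comm K V V z))
        = Θ ((TensorProduct.assoc K V V V).symm (h.T1.toLinearMap.lTensor V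
          (TensorProduct.assoc K V V V (z ⊗ₜ f)))) := by
      intro z
      induction z with
      | zero => simp
      | add x y hx hy => simp only [map_add, TensorProduct.add_tmul, hx, hy]
      | tmul x y =>
        rw [TensorProduct.comm_tmul, LinearMap.lTensor_tmul, LinearMap.flip_apply]
        conv_lhs => rw [← hf]
        rw [hc, canL_tmul_act, TensorProduct.assoc_tmul, LinearMap.lTensor_tmul,
          LinearEquiv.coe_coe]
        generalize h.T1 (y ⊗ₜ f) = w
        induction w with
        | zero => simp
        | add x y hx hy => simp only [map_add, TensorProduct.tmul_add, hx, hy]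
        | tmul u v => simp [hΘ]
    have h2 : h.canL hR hN' (a ⊗ₜ n) = (act'.flip n).lTensor V (h.T1 (a ⊗ₜ f)) := by
      conv_lhs => rw [← hf]
      exact h.canL_tmul_act hR hN' a f n
    have h3 : h.canR hR hN (a ⊗ₜ n)
        = (act.flip n).lTensor V (TensorProduct.comm K V V (h.T2 (e ⊗ₜ a))) := by
      conv_lhs => rw [← he]
      exact h.canR_tmul_act hR hN a e n
    rw [h2, h3, hl, hr]
    rw [LinearEquiv.coe_coe] at h1
    exact h1

variable {Y : NUAlgebra K N} {Y' : NUAlgebra K N'}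

theorem left_extend_comul (h : IsMultiplierHopf R Δ) (hR : R.HasLocalUnits)
    (j : R.NondegHom Y) (j' : R.NondegHom Y') (a : V) (v : N) (n : N') :
    M.left ((j.tensor j').extend (hR.tensor hR) (Δ a)) (v ⊗ₜ n)
      = (j.l.flip v).rTensor N' (h.canL hR j'.isModule_l (a ⊗ₜ n)) := by
  obtain ⟨e, he⟩ := j.isModule_l.exists_unit v
  obtain ⟨f, hf⟩ := j'.isModule_l.exists_unit n
  have h1 := (j.tensor j').left_extend (hR.tensor hR) (Δ a) (e ⊗ₜ f) (v ⊗ₜ n)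
  rw [show (j.tensor j').l (e ⊗ₜ f) (v ⊗ₜ n) = v ⊗ₜ n by simp [NondegHom.tensor, he, hf],
    h.left_comul_tmul] at h1
  rw [h1]
  conv_rhs => rw [← hf]
  rw [canL_tmul_act]
  generalize h.T1 (a ⊗ₜ f) = z
  induction z with
  | zero => simp
  | add x y hx hy => simp only [map_add, LinearMap.add_apply, hx, hy]
  | tmul x y => simp [NondegHom.tensor, j.isModule_l.mul_act, he]

theorem right_extend_comul (h : IsMultiplierHopf R Δ) (hR : R.HasLocalUnits)
    (j : R.NondegHom Y) (j' : R.NondegHom Y') (a : V) (v : N) (n : N') :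
    M.right ((j.tensor j').extend (hR.tensor hR) (Δ a)) (v ⊗ₜ n)
      = TensorProduct.comm K N' N
        ((j'.r.flip n).rTensor N (h.canR hR j.isModule_r (a ⊗ₜ v))) := by
  obtain ⟨e, he⟩ := j.isModule_r.exists_unit v
  obtain ⟨f, hf⟩ := j'.isModule_r.exists_unit n
  have h1 := (j.tensor j').right_extend (hR.tensor hR) (Δ a) (e ⊗ₜ f) (v ⊗ₜ n)
  rw [show (j.tensor j').r (e ⊗ₜ f) (v ⊗ₜ n) = v ⊗ₜ n by simp [NondegHom.tensor, he, hf],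
    h.right_comul_tmul] at h1
  rw [h1]
  conv_rhs => rw [← he]
  rw [canR_tmul_act]
  generalize h.T2 (e ⊗ₜ a) = z
  induction z with
  | zero => simp
  | add x y hx hy => simp only [map_add, LinearMap.add_apply, hx, hy]
  | tmul x y =>
    have h2 := j'.isModule_r.mul_act y f n
    rw [hf, opp_mul] at h2
    simp [NondegHom.tensor, h2]

end IsMultiplierHopf

section Legs

variable {K : Type*} [Field K] {A B N N' : Type*} [AddCommGroup A] [Module K A]
  [AddCommGroup B] [Module K B] [AddCommGroup N] [Module K N] [AddCommGroup N'] [Module K N']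

/-- The endomorphism `G₁₃` of `(A ⊗ B) ⊗ N`, for an endomorphism `G` of `A ⊗ N`. -/
def legA (B : Type*) [AddCommGroup B] [Module K B] (G : A ⊗[K] N ≃ₗ[K] A ⊗[K] N) :
    (A ⊗[K] B) ⊗[K] N ≃ₗ[K] (A ⊗[K] B) ⊗[K] N :=
  (TensorProduct.rightComm K A B N).trans
    ((G.rTensor B).trans (TensorProduct.rightComm K A N B))

/-- The endomorphism `G₂₃` of `(A ⊗ B) ⊗ N`, for an endomorphism `G` of `B ⊗ N`. -/
def legB (A : Type*) [AddCommGroup A] [Module K A] (G : B ⊗[K] N ≃ₗ[K] B ⊗[K] N) :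
    (A ⊗[K] B) ⊗[K] N ≃ₗ[K] (A ⊗[K] B) ⊗[K] N :=
  (TensorProduct.assoc K A B N).trans
    ((G.lTensor A).trans (TensorProduct.assoc K A B N).symm)

end Legs

/-! ### Canonical maps for actions of two algebras -/

section Legs

variable {K : Type*} [Field K] {A B N N' : Type*} [AddCommGroup A] [Module K A]
  [AddCommGroup B] [Module K B] [AddCommGroup N] [Module K N] [AddCommGroup N'] [Module K N']

/-- The endomorphism `φ₂` of `(A ⊗ B) ⊗ N`, for an endomorphism `φ` of `B`. -/
def legMid (A N : Type*) [AddCommGroup A] [Module K A] [AddCommGroup N] [Module K N] (φ : B ≃ₗ[K] B) :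
    (A ⊗[K] B) ⊗[K] N ≃ₗ[K] (A ⊗[K] B) ⊗[K] N := (φ.lTensor A).rTensor N

@[simp] theorem legMid_tmul (φ : B ≃ₗ[K] B) (a : A) (b : B) (n : N) :
    legMid A N φ ((a ⊗ₜ b) ⊗ₜ n) = (a ⊗ₜ φ b) ⊗ₜ n := rfl

theorem legA_tmul (G : A ⊗[K] N ≃ₗ[K] A ⊗[K] N) (a : A) (b : B) (n : N) :
    legA B G ((a ⊗ₜ b) ⊗ₜ n) = TensorProduct.rightComm K A N B (G (a ⊗ₜ n) ⊗ₜ b) := rfl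

theorem legB_tmul (G : B ⊗[K] N ≃ₗ[K] B ⊗[K] N) (a : A) (b : B) (n : N) :
    legB A G ((a ⊗ₜ b) ⊗ₜ n) = (TensorProduct.assoc K A B N).symm (a ⊗ₜ G (b ⊗ₜ n)) := rfl

theorem ext_threefold {Q : Type*} [AddCommGroup Q] [Module K Q] {f g : (A ⊗[K] B) ⊗[K] N →ₗ[K] Q}
    (h : ∀ a b n, f ((a ⊗ₜ b) ⊗ₜ n) = g ((a ⊗ₜ b) ⊗ₜ n)) (z : (A ⊗[K] B) ⊗[K] N) : f z = g z :=
  LinearMap.congr_fun (TensorProduct.ext_threefold h) z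

theorem legA_comm {G G' : A ⊗[K] N ≃ₗ[K] A ⊗[K] N} (h : ∀ z, G (G' z) = G' (G z))
    (z : (A ⊗[K] B) ⊗[K] N) : legA B G (legA B G' z) = legA B G' (legA B G z) := by
  have key : ∀ w : (A ⊗[K] N) ⊗[K] B, G.rTensor B (G'.rTensor B w) = G'.rTensor B (G.rTensor B w) := by
    intro w
    induction w with
    | zero => simp
    | add x y hx hy => simp only [map_add, hx, hy]
    | tmul u v => simp [h]
  have hs : ∀ w : (A ⊗[K] N) ⊗[K] B,
      TensorProduct.rightComm K A B N (TensorProduct.rightComm K A N B w) = w := fun w =>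
    (TensorProduct.rightComm K A B N).apply_symm_apply w
  simp only [legA, LinearEquiv.trans_apply, hs, key]

theorem legB_comm {G G' : B ⊗[K] N ≃ₗ[K] B ⊗[K] N} (h : ∀ z, G (G' z) = G' (G z))
    (z : (A ⊗[K] B) ⊗[K] N) : legB A G (legB A G' z) = legB A G' (legB A G z) := by
  have key : ∀ w : A ⊗[K] (B ⊗[K] N), G.lTensor A (G'.lTensor A w) = G'.lTensor A (G.lTensor A w) := by
    intro w
    induction w with
    | zero => simp
    | add x y hx hy => simp only [map_add, hx, hy]
    | tmul u v => simp [h]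
  simp only [legB, LinearEquiv.trans_apply, LinearEquiv.apply_symm_apply, key]

theorem legA_legMid (G : A ⊗[K] N ≃ₗ[K] A ⊗[K] N) (φ : B ≃ₗ[K] B) (z : (A ⊗[K] B) ⊗[K] N) :
    legA B G (legMid A N φ z) = legMid A N φ (legA B G z) := by
  refine ext_threefold (f := (legA B G).toLinearMap ∘ₗ (legMid A N φ).toLinearMap)
    (g := (legMid A N φ).toLinearMap ∘ₗ (legA B G).toLinearMap) (fun a b n => ?_) z
  simp only [LinearMap.comp_apply, LinearEquiv.coe_coe, legMid_tmul, legA_tmul]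
  generalize G (a ⊗ₜ n) = w
  induction w with
  | zero => simp
  | add x y hx hy => simp only [map_add, TensorProduct.add_tmul, hx, hy]
  | tmul u v => simp

theorem legB_legMid {G G' : B ⊗[K] N ≃ₗ[K] B ⊗[K] N} {φ : B ≃ₗ[K] B}
    (h : ∀ z, G (φ.rTensor N z) = φ.rTensor N (G' z)) (z : (A ⊗[K] B) ⊗[K] N) :
    legB A G (legMid A N φ z) = legMid A N φ (legB A G' z) := by
  refine ext_threefold (f := (legB A G).toLinearMap ∘ₗ (legMid A N φ).toLinearMap)
    (g := (legMid A N φ).toLinearMap ∘ₗ (legB A G').toLinearMap) (fun a b n => ?_) z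
  have h1 := h (b ⊗ₜ n)
  rw [LinearEquiv.rTensor_tmul] at h1
  simp only [LinearMap.comp_apply, LinearEquiv.coe_coe, legMid_tmul, legB_tmul, h1]
  generalize G' (b ⊗ₜ n) = w
  induction w with
  | zero => simp
  | add x y hx hy => simp only [map_add, TensorProduct.tmul_add, hx, hy]
  | tmul u v => simp

theorem legA_natural {G : A ⊗[K] N ≃ₗ[K] A ⊗[K] N} {G' : A ⊗[K] N' ≃ₗ[K] A ⊗[K] N'}
    {f : N →ₗ[K] N'} (h : ∀ z, G' (f.lTensor A z) = f.lTensor A (G z)) (z : (A ⊗[K] B) ⊗[K] N) :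
    legA B G' (f.lTensor _ z) = f.lTensor _ (legA B G z) := by
  refine ext_threefold (f := (legA B G').toLinearMap ∘ₗ f.lTensor _)
    (g := f.lTensor _ ∘ₗ (legA B G).toLinearMap) (fun a b n => ?_) z
  have h1 := h (a ⊗ₜ n)
  rw [LinearMap.lTensor_tmul] at h1
  simp only [LinearMap.comp_apply, LinearEquiv.coe_coe, LinearMap.lTensor_tmul, legA_tmul, h1]
  generalize G (a ⊗ₜ n) = w
  induction w with
  | zero => simp
  | add x y hx hy => simp only [map_add, TensorProduct.add_tmul, hx, hy]
  | tmul u v => simp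

theorem legB_natural {G : B ⊗[K] N ≃ₗ[K] B ⊗[K] N} {G' : B ⊗[K] N' ≃ₗ[K] B ⊗[K] N'}
    {f : N →ₗ[K] N'} (h : ∀ z, G' (f.lTensor B z) = f.lTensor B (G z)) (z : (A ⊗[K] B) ⊗[K] N) :
    legB A G' (f.lTensor _ z) = f.lTensor _ (legB A G z) := by
  refine ext_threefold (f := (legB A G').toLinearMap ∘ₗ f.lTensor _)
    (g := f.lTensor _ ∘ₗ (legB A G).toLinearMap) (fun a b n => ?_) z
  have h1 := h (b ⊗ₜ n)
  rw [LinearMap.lTensor_tmul] at h1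
  simp only [LinearMap.comp_apply, LinearEquiv.coe_coe, LinearMap.lTensor_tmul, legB_tmul, h1]
  generalize G (b ⊗ₜ n) = w
  induction w with
  | zero => simp
  | add x y hx hy => simp only [map_add, TensorProduct.tmul_add, hx, hy]
  | tmul u v => simp

/-- The maps induced on the legs `A ⊗ N` and `B ⊗ N` by maps `τ` of `A ⊗ A` and `τ'` of `B ⊗ B`
commute, if the actions of `A` and `B` on `N` commute. -/
theorem legA_legB_comm {R : NUAlgebra K A} {S : NUAlgebra K B} {π : A →ₗ[K] N →ₗ[K] N}
    {θ : B →ₗ[K] N →ₗ[K] N} (hπ : R.IsModule π) (hθ : S.IsModule θ)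
    (hc : ∀ a b n, π a (θ b n) = θ b (π a n))
    {G : A ⊗[K] N ≃ₗ[K] A ⊗[K] N} {G' : B ⊗[K] N ≃ₗ[K] B ⊗[K] N}
    {τ : A ⊗[K] A → A ⊗[K] A} {τ' : B ⊗[K] B → B ⊗[K] B}
    (hG : ∀ z n, G ((π.flip n).lTensor A z) = (π.flip n).lTensor A (τ z))
    (hG' : ∀ z n, G' ((θ.flip n).lTensor B z) = (θ.flip n).lTensor B (τ' z))
    (z : (A ⊗[K] B) ⊗[K] N) : legA B G (legB A G' z) = legB A G' (legA B G z) := by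
  refine ext_threefold (f := (legA B G).toLinearMap ∘ₗ (legB A G').toLinearMap)
    (g := (legB A G').toLinearMap ∘ₗ (legA B G).toLinearMap) (fun a b n => ?_) z
  simp only [LinearMap.comp_apply, LinearEquiv.coe_coe]
  obtain ⟨e, he⟩ := hπ.exists_unit n
  obtain ⟨f, hf⟩ := hθ.exists_unit n
  -- both sides are the image of `τ (a ⊗ e) ⊗ τ' (b ⊗ f)`
  have h1 : ∀ m, G (a ⊗ₜ π e m) = (π.flip m).lTensor A (τ (a ⊗ₜ e)) := fun m => hG (a ⊗ₜ e) m
  have h2 : ∀ m, G' (b ⊗ₜ θ f m) = (θ.flip m).lTensor B (τ' (b ⊗ₜ f)) := fun m => hG' (b ⊗ₜ f) m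
  have hG1 := h1 n
  have hG2 := h2 n
  rw [he] at hG1
  rw [hf] at hG2
  rw [legA_tmul, legB_tmul, hG1, hG2]
  let Θ : (A ⊗[K] A) ⊗[K] (B ⊗[K] B) →ₗ[K] (A ⊗[K] B) ⊗[K] N :=
    ((Pairing.mulMap π θ).flip n).lTensor (A ⊗[K] B) ∘ₗ
      (TensorProduct.tensorTensorTensorComm K A A B B).toLinearMap
  have hΘ : ∀ x y z w, Θ ((x ⊗ₜ y) ⊗ₜ (z ⊗ₜ w)) = (x ⊗ₜ z) ⊗ₜ π y (θ w n) := fun x y z w => by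
    simp [Θ]
  have hl : ∀ t, legA B G ((TensorProduct.assoc K A B N).symm (a ⊗ₜ (θ.flip n).lTensor B t))
      = Θ (τ (a ⊗ₜ e) ⊗ₜ t) := by
    intro t
    induction t with
    | zero => simp
    | add x y hx hy => simp only [map_add, TensorProduct.tmul_add, hx, hy]
    | tmul x y =>
      have h3 := h1 (θ y n)
      rw [hc, he] at h3
      rw [LinearMap.lTensor_tmul, LinearMap.flip_apply, TensorProduct.assoc_symm_tmul, legA_tmul, h3]
      generalize τ (a ⊗ₜ e) = s
      induction s with
      | zero => simp
      | add x y hx hy => simp only [map_add, TensorProduct.add_tmul, hx, hy]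
      | tmul u v => simp [hΘ]
  have hr : ∀ s, legB A G' (TensorProduct.rightComm K A N B (((π.flip n).lTensor A s) ⊗ₜ b))
      = Θ (s ⊗ₜ τ' (b ⊗ₜ f)) := by
    intro s
    induction s with
    | zero => simp
    | add x y hx hy => simp only [map_add, TensorProduct.add_tmul, hx, hy]
    | tmul x y =>
      have h3 := h2 (π y n)
      rw [← hc, hf] at h3
      rw [LinearMap.lTensor_tmul, LinearMap.flip_apply, TensorProduct.rightComm_tmul, legB_tmul, h3]
      generalize τ' (b ⊗ₜ f) = s
      induction s with
      | zero => simp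
      | add x y hx hy => simp only [map_add, TensorProduct.tmul_add, hx, hy]
      | tmul u v => simp [hΘ, hc]
  rw [hl, hr]

end Legs

namespace IsMultiplierHopf

variable {K : Type*} [Field K] {V N : Type*} [AddCommGroup V] [Module K V]
  [AddCommGroup N] [Module K N] {R : NUAlgebra K V} {Δ : V →ₗ[K] (R.tensor R).M}
  {act act' : V →ₗ[K] N →ₗ[K] N}

theorem canL_congr (h : IsMultiplierHopf R Δ) (hR : R.HasLocalUnits) (hN : R.IsModule act)
    (hN' : R.IsModule act') {φ : V ≃ₗ[K] V} (hφ : ∀ x y, φ (R.mul x y) = R.mul (φ x) (φ y))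
    (hΔ : ∀ a z, M.left (Δ (φ a)) (TensorProduct.congr φ φ z)
      = TensorProduct.congr φ φ (M.left (Δ a) z))
    (hact : ∀ a n, act' a n = act (φ a) n) (z : V ⊗[K] N) :
    h.canL hR hN (φ.rTensor N z) = φ.rTensor N (h.canL hR hN' z) := by
  induction z with
  | zero => simp
  | add x y hx hy => simp only [map_add, hx, hy]
  | tmul a n =>
    obtain ⟨e, he⟩ := hN'.exists_unit n
    rw [LinearEquiv.rTensor_tmul]
    conv_rhs => rw [← he]
    rw [canL_tmul_act]
    rw [hact] at he
    conv_lhs => rw [← he]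
    rw [canL_tmul_act, h.T1_congr φ hφ hΔ]
    generalize h.T1 (a ⊗ₜ e) = z
    induction z with
    | zero => simp
    | add x y hx hy => simp only [map_add, hx, hy]
    | tmul u v => simp [hact]

theorem canR_congr (h : IsMultiplierHopf R Δ) (hR : R.HasLocalUnits) (hN : R.opp.IsModule act)
    (hN' : R.opp.IsModule act') {φ : V ≃ₗ[K] V} (hφ : ∀ x y, φ (R.mul x y) = R.mul (φ x) (φ y))
    (hΔ : ∀ a z, M.left (Δ (φ a)) (TensorProduct.congr φ φ z)
      = TensorProduct.congr φ φ (M.left (Δ a) z))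
    (hact : ∀ a n, act' a n = act (φ a) n) (z : V ⊗[K] N) :
    h.canR hR hN (φ.rTensor N z) = φ.rTensor N (h.canR hR hN' z) := by
  induction z with
  | zero => simp
  | add x y hx hy => simp only [map_add, hx, hy]
  | tmul a n =>
    obtain ⟨e, he⟩ := hN'.exists_unit n
    rw [LinearEquiv.rTensor_tmul]
    conv_rhs => rw [← he]
    rw [canR_tmul_act]
    rw [hact] at he
    conv_lhs => rw [← he]
    rw [canR_tmul_act, h.T2_congr φ hφ hΔ]
    generalize h.T2 (e ⊗ₜ a) = z
    induction z with
    | zero => simp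
    | add x y hx hy => simp only [map_add, hx, hy]
    | tmul u v => simp [hact]

end IsMultiplierHopf

section Canonical

variable {K : Type*} [Field K] {A B N N' : Type*} [AddCommGroup A] [Module K A]
  [AddCommGroup B] [Module K B] [AddCommGroup N] [Module K N] [AddCommGroup N'] [Module K N']
  {R : NUAlgebra K A} {S : NUAlgebra K B} {ΔA : A →ₗ[K] (R.tensor R).M}
  {ΔB : B →ₗ[K] (S.tensor S).M} (hA : IsMultiplierHopf R ΔA) (hB : IsMultiplierHopf S ΔB)
  (uA : R.HasLocalUnits) (uB : S.HasLocalUnits)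
  {π π' : A →ₗ[K] N →ₗ[K] N} {θ θ' θ'' : B →ₗ[K] N →ₗ[K] N}

/-- The map `(a ⊗ b) ⊗ n ↦ (a₍₁₎ ⊗ φ(b₍₁₎)) ⊗ π(a₍₂₎)θ(b₍₂₎)n`, for left actions `π` and `θ` on `N`. -/
def leftCan (φ : B ≃ₗ[K] B) (hπ : R.IsModule π) (hθ : S.IsModule θ) :
    (A ⊗[K] B) ⊗[K] N ≃ₗ[K] (A ⊗[K] B) ⊗[K] N :=
  (legB A (hB.canL uB hθ)).trans ((legMid A N φ).trans (legA B (hA.canL uA hπ)))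

/-- The map `(a ⊗ b) ⊗ n ↦ (a₍₂₎ ⊗ φ(b₍₂₎)) ⊗ nπ(a₍₁₎)θ(b₍₁₎)`, for right actions `π` and `θ` on
`N`. -/
def rightCan (φ : B ≃ₗ[K] B) (hπ : R.opp.IsModule π) (hθ : S.opp.IsModule θ) :
    (A ⊗[K] B) ⊗[K] N ≃ₗ[K] (A ⊗[K] B) ⊗[K] N :=
  (legA B (hA.canR uA hπ)).trans ((legB A (hB.canR uB hθ)).trans (legMid A N φ))

theorem leftCan_natural (φ : B ≃ₗ[K] B) (hπ : R.IsModule π) (hθ : S.IsModule θ)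
    {ρ : A →ₗ[K] N' →ₗ[K] N'} {σ : B →ₗ[K] N' →ₗ[K] N'}
    (hρ : R.IsModule ρ) (hσ : S.IsModule σ) {f : N →ₗ[K] N'} (hf : ∀ a n, f (π a n) = ρ a (f n))
    (hf' : ∀ b n, f (θ b n) = σ b (f n)) (z : (A ⊗[K] B) ⊗[K] N) :
    leftCan hA hB uA uB φ hρ hσ (f.lTensor _ z) = f.lTensor _ (leftCan hA hB uA uB φ hπ hθ z) := by
  have h : ∀ z, legMid A N' φ (f.lTensor _ z) = f.lTensor _ (legMid A N φ z) :=
    ext_threefold (f := (legMid A N' φ).toLinearMap ∘ₗ f.lTensor _)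
      (g := f.lTensor _ ∘ₗ (legMid A N φ).toLinearMap) fun a b n => by simp
  simp only [leftCan, LinearEquiv.trans_apply]
  rw [legB_natural (hB.canL_natural uB hθ hσ hf'), h, legA_natural (hA.canL_natural uA hπ hρ hf)]

theorem rightCan_natural (φ : B ≃ₗ[K] B) (hπ : R.opp.IsModule π) (hθ : S.opp.IsModule θ)
    {ρ : A →ₗ[K] N' →ₗ[K] N'} {σ : B →ₗ[K] N' →ₗ[K] N'} (hρ : R.opp.IsModule ρ)
    (hσ : S.opp.IsModule σ) {f : N →ₗ[K] N'} (hf : ∀ a n, f (π a n) = ρ a (f n))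
    (hf' : ∀ b n, f (θ b n) = σ b (f n)) (z : (A ⊗[K] B) ⊗[K] N) :
    rightCan hA hB uA uB φ hρ hσ (f.lTensor _ z)
      = f.lTensor _ (rightCan hA hB uA uB φ hπ hθ z) := by
  have h : ∀ z, legMid A N' φ (f.lTensor _ z) = f.lTensor _ (legMid A N φ z) :=
    ext_threefold (f := (legMid A N' φ).toLinearMap ∘ₗ f.lTensor _)
      (g := f.lTensor _ ∘ₗ (legMid A N φ).toLinearMap) fun a b n => by simp
  simp only [rightCan, LinearEquiv.trans_apply]
  rw [legA_natural (hA.canR_natural uA hπ hρ hf), legB_natural (hB.canR_natural uB hθ hσ hf'), h]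

/-- Coassociativity for the two families of canonical maps, in the presence of automorphisms. -/
theorem rightCan_leftCan {φ₁ φ₂ χ₃ χ₄ : B ≃ₗ[K] B}
    (hφ : ∀ x y, φ₂ (S.mul x y) = S.mul (φ₂ x) (φ₂ y))
    (hφΔ : ∀ a z, M.left (ΔB (φ₂ a)) (TensorProduct.congr φ₂ φ₂ z)
      = TensorProduct.congr φ₂ φ₂ (M.left (ΔB a) z))
    (hχ : ∀ x y, χ₄ (S.mul x y) = S.mul (χ₄ x) (χ₄ y))
    (hχΔ : ∀ a z, M.left (ΔB (χ₄ a)) (TensorProduct.congr χ₄ χ₄ z)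
      = TensorProduct.congr χ₄ χ₄ (M.left (ΔB a) z))
    (hφχ : ∀ b, χ₃ (φ₂ b) = φ₁ (χ₄ b))
    {πR : A →ₗ[K] N →ₗ[K] N} {θR θR' : B →ₗ[K] N →ₗ[K] N}
    (hπ : R.IsModule π) (hθ : S.IsModule θ) (hθ' : S.IsModule θ')
    (hπR : R.opp.IsModule πR) (hθR : S.opp.IsModule θR) (hθR' : S.opp.IsModule θR')
    (hL : ∀ b n, θ b n = θ' (χ₄ b) n) (hR : ∀ b n, θR' b n = θR (φ₂ b) n)
    (hππ : ∀ a a' n, πR a (π a' n) = π a' (πR a n)) (hπθ : ∀ a b n, πR a (θ b n) = θ b (πR a n))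
    (hθπ : ∀ b a n, θR' b (π a n) = π a (θR' b n))
    (hθθ : ∀ b b' n, θR' b (θ b' n) = θ b' (θR' b n)) (z : (A ⊗[K] B) ⊗[K] N) :
    rightCan hA hB uA uB χ₃ hπR hθR (leftCan hA hB uA uB φ₂ hπ hθ z)
      = leftCan hA hB uA uB φ₁ hπ hθ' (rightCan hA hB uA uB χ₄ hπR hθR' z) := by
  simp only [rightCan, leftCan, LinearEquiv.trans_apply]
  rw [legB_legMid (hB.canL_congr uB hθ' hθ hχ hχΔ hL), legA_legMid, legA_legMid, legA_legMid,
    legA_legMid, legB_legMid (hB.canR_congr uB hθR hθR' hφ hφΔ hR),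
    legA_comm (hA.canR_canL uA hπR hπ hππ),
    legA_legB_comm hπR hθ hπθ (hA.canR_act uA hπR) (hB.canL_act uB hθ),
    ← legA_legB_comm hπ hθR' (fun a b n => (hθπ b a n).symm) (hA.canL_act uA hπ)
      (hB.canR_act uB hθR'),
    legB_comm (hB.canR_canL uB hθR' hθ hθθ)]
  have h : ∀ z, legMid A N χ₃ (legMid A N φ₂ z) = legMid A N φ₁ (legMid A N χ₄ z) :=
    ext_threefold (f := (legMid A N χ₃).toLinearMap ∘ₗ (legMid A N φ₂).toLinearMap)
      (g := (legMid A N φ₁).toLinearMap ∘ₗ (legMid A N χ₄).toLinearMap) fun a b n => by simp [hφχ]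
  rw [h]

end Canonical

/-! ### Direct sums over a group -/

section Glue

variable {K : Type*} [Field K] {G V Q : Type*} [AddCommGroup V] [Module K V] [AddCommGroup Q]
  [Module K Q]

/-- The inclusion of the summand `V ⊗ V` at `(p, q)` into `(⨁ V) ⊗ (⨁ V)`. -/
abbrev incl (K V : Type*) {G : Type*} [Field K] [AddCommGroup V] [Module K V] (p q : G) :
    V ⊗[K] V →ₗ[K] (G →₀ V) ⊗[K] (G →₀ V) :=
  TensorProduct.map (Finsupp.lsingle p) (Finsupp.lsingle q)

theorem ext_incl {f g : (G →₀ V) ⊗[K] (G →₀ V) →ₗ[K] Q}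
    (h : ∀ p q x y, f (Finsupp.single p x ⊗ₜ Finsupp.single q y)
      = g (Finsupp.single p x ⊗ₜ Finsupp.single q y)) : f = g := by
  refine TensorProduct.ext (Finsupp.lhom_ext fun p x => Finsupp.lhom_ext fun q y => h p q x y)

/-- The linear map on `(⨁ V) ⊗ (⨁ V)` given by linear maps on the summands. -/
def glue (F : G → G → V ⊗[K] V →ₗ[K] Q) : (G →₀ V) ⊗[K] (G →₀ V) →ₗ[K] Q :=
  Finsupp.lsum K (fun i : G × G => F i.1 i.2) ∘ₗ
    (finsuppTensorFinsupp K K V V G G).toLinearMap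

@[simp] theorem glue_single (F : G → G → V ⊗[K] V →ₗ[K] Q) (p q : G) (x y : V) :
    glue F (Finsupp.single p x ⊗ₜ Finsupp.single q y) = F p q (x ⊗ₜ y) := by
  simp [glue]

@[simp] theorem glue_incl (F : G → G → V ⊗[K] V →ₗ[K] Q) (p q : G) (z : V ⊗[K] V) :
    glue F (incl K V p q z) = F p q z := by
  induction z with
  | zero => simp
  | add x y hx hy => simp only [map_add, hx, hy]
  | tmul x y => simp

/-- A bijection of the index sets and isomorphisms of the corresponding summands give an
isomorphism. The isomorphisms are indexed by their targets. -/
def glueEquiv (e : G × G ≃ G × G) (t : G → G → V ⊗[K] V ≃ₗ[K] V ⊗[K] V) :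
    (G →₀ V) ⊗[K] (G →₀ V) ≃ₗ[K] (G →₀ V) ⊗[K] (G →₀ V) :=
  LinearEquiv.ofLinearMap
    (glue fun p q => incl K V (e (p, q)).1 (e (p, q)).2 ∘ₗ
      (t (e (p, q)).1 (e (p, q)).2).toLinearMap)
    (glue fun p q => incl K V (e.symm (p, q)).1 (e.symm (p, q)).2 ∘ₗ (t p q).symm.toLinearMap)
    (ext_incl fun p q x y => by simp [-TensorProduct.map_tmul]; simp)
    (ext_incl fun p q x y => by simp)

theorem glueEquiv_incl (e : G × G ≃ G × G) (t : G → G → V ⊗[K] V ≃ₗ[K] V ⊗[K] V) (p q : G)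
    (z : V ⊗[K] V) : glueEquiv e t (incl K V (e.symm (p, q)).1 (e.symm (p, q)).2 z)
      = incl K V p q (t p q z) := by
  refine (glue_incl _ _ _ _).trans ?_
  simp

variable (X : G → NUAlgebra K V)

/-- The direct sum of the algebras `X p`. -/
def glueAlgebra : NUAlgebra K (G →₀ V) where
  mul := Finsupp.lsum K fun p => ((X p).mul.compl₂ (Finsupp.lapply p)).compr₂ (Finsupp.lsingle p)
  assoc x y z := by
    classical
    induction x using Finsupp.induction_linear with
    | zero => simp
    | add x y hx hy => simp only [map_add, LinearMap.add_apply, hx, hy]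
    | single p x =>
      induction y using Finsupp.induction_linear with
      | zero => simp
      | add x y hx hy => simp only [map_add, LinearMap.add_apply, hx, hy]
      | single q y =>
        by_cases h : q = p
        · subst h
          simp [(X q).assoc]
        · simp [h]

theorem glueAlgebra_mul_single (p : G) (x y : V) :
    (glueAlgebra X).mul (Finsupp.single p x) (Finsupp.single p y)
      = Finsupp.single p ((X p).mul x y) := by
  simp [glueAlgebra]

theorem glueAlgebra_mul_single_ne {p q : G} (h : p ≠ q) (x y : V) :
    (glueAlgebra X).mul (Finsupp.single p x) (Finsupp.single q y) = 0 := by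
  classical
  simp [glueAlgebra, h.symm]

theorem glueAlgebra_mul_apply (f g : G →₀ V) (p : G) :
    (glueAlgebra X).mul f g p = (X p).mul (f p) (g p) := by
  classical
  induction f using Finsupp.induction_linear with
  | zero => simp
  | add x y hx hy => simp only [map_add, LinearMap.add_apply, Finsupp.add_apply, hx, hy]
  | single q x =>
    by_cases h : q = p
    · subst h
      simp [glueAlgebra]
    · simp [glueAlgebra, h]

variable {X}

theorem glueAlgebra_nondegenerate (hX : ∀ p, (X p).Nondegenerate) :
    (glueAlgebra X).Nondegenerate := by
  constructor
  · intro f hf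
    ext p
    refine (hX p).1 _ fun y => ?_
    have h := DFunLike.congr_fun (hf (Finsupp.single p y)) p
    rwa [glueAlgebra_mul_apply, Finsupp.single_eq_same] at h
  · intro f hf
    ext p
    refine (hX p).2 _ fun y => ?_
    have h := DFunLike.congr_fun (hf (Finsupp.single p y)) p
    rwa [glueAlgebra_mul_apply, Finsupp.single_eq_same] at h

theorem incl_mul_incl (p q : G) (z w : V ⊗[K] V) :
    ((glueAlgebra X).tensor (glueAlgebra X)).mul (incl K V p q z) (incl K V p q w)
      = incl K V p q (((X p).tensor (X q)).mul z w) := by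
  induction z with
  | zero => simp
  | add x y hx hy => simp only [map_add, LinearMap.add_apply, hx, hy]
  | tmul a b =>
    induction w with
    | zero => simp
    | add x y hx hy => simp only [map_add, hx, hy]
    | tmul c d => simp [glueAlgebra_mul_single]

theorem incl_mul_incl_ne {p q p' q' : G} (h : ¬(p = p' ∧ q = q')) (z w : V ⊗[K] V) :
    ((glueAlgebra X).tensor (glueAlgebra X)).mul (incl K V p q z) (incl K V p' q' w) = 0 := by
  induction z with
  | zero => simp
  | add x y hx hy => simp only [map_add, LinearMap.add_apply, hx, hy, add_zero]
  | tmul a b =>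
    induction w with
    | zero => simp
    | add x y hx hy => simp only [map_add, hx, hy, add_zero]
    | tmul c d =>
      by_cases h' : p = p'
      · have : q ≠ q' := fun h'' => h ⟨h', h''⟩
        simp [glueAlgebra_mul_single_ne X this]
      · simp [glueAlgebra_mul_single_ne X h']

/-- The multiplier of `D ⊗ D`, for the direct sum `D` of the algebras `X p`, with given components. -/
def glueM (X : G → NUAlgebra K V) : (∀ p q, ((X p).tensor (X q)).M) →ₗ[K]
    ((glueAlgebra X).tensor (glueAlgebra X)).M where
  toFun m := ⟨(glue fun p q => incl K V p q ∘ₗ M.left (m p q),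
      MulOpposite.op (glue fun p q => incl K V p q ∘ₗ M.right (m p q))), by
    classical
    intro x y
    rw [MulOpposite.unop_op]
    have key : ((glueAlgebra X).tensor (glueAlgebra X)).mul.compl₂
          (glue fun p q => incl K V p q ∘ₗ M.left (m p q))
        = ((glueAlgebra X).tensor (glueAlgebra X)).mul ∘ₗ
          (glue fun p q => incl K V p q ∘ₗ M.right (m p q)) := by
      refine ext_incl fun p q x y => ext_incl fun p' q' x' y' => ?_
      simp only [LinearMap.compl₂_apply, LinearMap.comp_apply, glue_single]
      have h : ∀ (p q : G) (x y : V), (Finsupp.single p x ⊗ₜ[K] Finsupp.single q y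
        : (G →₀ V) ⊗[K] (G →₀ V)) = incl K V p q (x ⊗ₜ y) := fun p q x y => by simp
      rw [h, h]
      by_cases hpq : p = p' ∧ q = q'
      · obtain ⟨rfl, rfl⟩ := hpq
        rw [incl_mul_incl, incl_mul_incl, M.compat]
      · rw [incl_mul_incl_ne hpq, incl_mul_incl_ne hpq]
    exact LinearMap.congr_fun₂ key x y⟩
  map_add' m n := M.ext
    (LinearMap.congr_fun (ext_incl fun p q x y => by simp [M.left]))
    (LinearMap.congr_fun (ext_incl fun p q x y => by simp [M.right]))
  map_smul' c m := M.ext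
    (LinearMap.congr_fun (ext_incl fun p q x y => by simp [M.left]))
    (LinearMap.congr_fun (ext_incl fun p q x y => by simp [M.right]))

theorem isComponent_glueM (m : ∀ p q, ((X p).tensor (X q)).M) (p q : G) :
    IsComponent (glueM X m) p q (m p q) :=
  fun z => ⟨glue_incl (fun p q => incl K V p q ∘ₗ M.left (m p q)) p q z,
    glue_incl (fun p q => incl K V p q ∘ₗ M.right (m p q)) p q z⟩

namespace IsComponent

variable {N N' : ((glueAlgebra X).tensor (glueAlgebra X)).M} {p q : G}
  {m m' : ((X p).tensor (X q)).M}

theorem mul (h : IsComponent N p q m) (h' : IsComponent N' p q m') :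
    IsComponent (N * N') p q (m * m') := fun z =>
  ⟨by rw [M.left_mul, M.left_mul, (h' z).1, (h _).1],
    by rw [M.right_mul, M.right_mul, (h z).2, (h' _).2]⟩

/-- A multiplier is determined by its components. -/
theorem ext (h : ∀ p q, ∃ m : ((X p).tensor (X q)).M, IsComponent N p q m ∧ IsComponent N' p q m) :
    N = N' := by
  refine M.ext (LinearMap.congr_fun (ext_incl fun p q x y => ?_))
    (LinearMap.congr_fun (ext_incl fun p q x y => ?_))
  all_goals
    obtain ⟨m, hm, hm'⟩ := h p q
    have h1 := hm (x ⊗ₜ y)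
    have h2 := hm' (x ⊗ₜ y)
    simp only [TensorProduct.map_tmul, Finsupp.lsingle_apply] at h1 h2
  · rw [h1.1, h2.1]
  · rw [h1.2, h2.2]

end IsComponent

variable [Group G] {Δ : (G →₀ V) →ₗ[K] ((glueAlgebra X).tensor (glueAlgebra X)).M}
  {Δc : ∀ p q, V →ₗ[K] ((X p).tensor (X q)).M}

/-- The comultiplication of `D = ⨁ X p` with components `Δ_(p,q) : X (p * q) → M(X p ⊗ X q)`. -/
def glueComul (Δc : ∀ p q, V →ₗ[K] ((X p).tensor (X q)).M) :
    (G →₀ V) →ₗ[K] ((glueAlgebra X).tensor (glueAlgebra X)).M :=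
  open Classical in
  Finsupp.lsum K fun r => glueM X ∘ₗ LinearMap.pi fun p => LinearMap.pi fun q =>
    if r = p * q then Δc p q else 0

theorem isComponent_glueComul (Δc : ∀ p q, V →ₗ[K] ((X p).tensor (X q)).M) (p q : G) (x : V) :
    IsComponent (glueComul Δc (Finsupp.single (p * q) x)) p q (Δc p q x) := by
  classical
  rw [glueComul, Finsupp.lsum_single, LinearMap.comp_apply]
  convert isComponent_glueM _ p q using 1
  simp

theorem isComponent_glueComul_ne (Δc : ∀ p q, V →ₗ[K] ((X p).tensor (X q)).M) {r p q : G}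
    (h : r ≠ p * q) (x : V) : IsComponent (glueComul Δc (Finsupp.single r x)) p q
      (0 : ((X p).tensor (X q)).M) := by
  classical
  rw [glueComul, Finsupp.lsum_single, LinearMap.comp_apply]
  convert isComponent_glueM _ p q using 1
  simp [h]

/-- A comultiplication of the direct sum is multiplicative, if its components are. -/
theorem comul_mul_of_components
    (hΔ : ∀ p q x, IsComponent (Δ (Finsupp.single (p * q) x)) p q (Δc p q x))
    (hΔ0 : ∀ r p q x, r ≠ p * q →
      IsComponent (Δ (Finsupp.single r x)) p q (0 : ((X p).tensor (X q)).M))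
    (hmul : ∀ p q x y, Δc p q ((X (p * q)).mul x y) = Δc p q x * Δc p q y) (x y : G →₀ V) :
    Δ ((glueAlgebra X).mul x y) = Δ x * Δ y := by
  induction x using Finsupp.induction_linear with
  | zero => simp
  | add x y hx hy => simp only [map_add, LinearMap.add_apply, add_mul, hx, hy]
  | single r x =>
    induction y using Finsupp.induction_linear with
    | zero => simp
    | add x y hx hy => simp only [map_add, mul_add, hx, hy]
    | single s y =>
      refine IsComponent.ext fun p q => ?_
      by_cases hrs : r = s
      · subst hrs
        rw [glueAlgebra_mul_single]
        by_cases hr : r = p * q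
        · subst hr
          refine ⟨_, ?_, (hΔ p q x).mul (hΔ p q y)⟩
          rw [← hmul]
          exact hΔ p q _
        · refine ⟨0, hΔ0 _ p q _ hr, ?_⟩
          have := (hΔ0 r p q x hr).mul (hΔ0 r p q y hr)
          rwa [mul_zero] at this
      · rw [glueAlgebra_mul_single_ne X hrs, map_zero]
        refine ⟨0, fun z => by simp, ?_⟩
        by_cases hr : r = p * q
        · subst hr
          have := (hΔ p q x).mul (hΔ0 s p q y (Ne.symm hrs))
          rwa [mul_zero] at this
        · obtain ⟨m, hm⟩ : ∃ m : ((X p).tensor (X q)).M,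
              IsComponent (Δ (Finsupp.single s y)) p q m := by
            by_cases hs : s = p * q
            · exact ⟨_, hs ▸ hΔ p q y⟩
            · exact ⟨0, hΔ0 s p q y hs⟩
          have := (hΔ0 r p q x hr).mul hm
          rwa [zero_mul] at this

/-- The map `T₁` of the direct sum, with components `X (p * q) ⊗ X q → X p ⊗ X q`. -/
def glueT₁ (t₁ : G → G → V ⊗[K] V ≃ₗ[K] V ⊗[K] V) :
    (G →₀ V) ⊗[K] (G →₀ V) ≃ₗ[K] (G →₀ V) ⊗[K] (G →₀ V) :=
  glueEquiv
    { toFun := fun i => (i.1 * i.2⁻¹, i.2)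
      invFun := fun i => (i.1 * i.2, i.2)
      left_inv := fun i => by simp
      right_inv := fun i => by simp } t₁

/-- The map `T₂` of the direct sum, with components `X p ⊗ X (p * q) → X p ⊗ X q`. -/
def glueT₂ (t₂ : G → G → V ⊗[K] V ≃ₗ[K] V ⊗[K] V) :
    (G →₀ V) ⊗[K] (G →₀ V) ≃ₗ[K] (G →₀ V) ⊗[K] (G →₀ V) :=
  glueEquiv
    { toFun := fun i => (i.1, i.1⁻¹ * i.2)
      invFun := fun i => (i.1, i.1 * i.2)
      left_inv := fun i => by simp
      right_inv := fun i => by simp } t₂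

theorem glueT₁_incl (t₁ : G → G → V ⊗[K] V ≃ₗ[K] V ⊗[K] V) (p q : G) (z : V ⊗[K] V) :
    glueT₁ t₁ (incl K V (p * q) q z) = incl K V p q (t₁ p q z) :=
  glueEquiv_incl _ t₁ p q z

theorem glueT₂_incl (t₂ : G → G → V ⊗[K] V ≃ₗ[K] V ⊗[K] V) (p q : G) (z : V ⊗[K] V) :
    glueT₂ t₂ (incl K V p (p * q) z) = incl K V p q (t₂ p q z) :=
  glueEquiv_incl _ t₂ p q z

theorem of_glueT₁ (hX : ∀ p, (X p).Nondegenerate)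
    (hΔ : ∀ p q x, IsComponent (Δ (Finsupp.single (p * q) x)) p q (Δc p q x))
    (hΔ0 : ∀ r p q x, r ≠ p * q →
      IsComponent (Δ (Finsupp.single r x)) p q (0 : ((X p).tensor (X q)).M))
    {t₁ : G → G → V ⊗[K] V ≃ₗ[K] V ⊗[K] V}
    (h₁ : ∀ p q x y v n, M.left (Δc p q x) (v ⊗ₜ (X q).mul y n)
      = ((X p).tensor (X q)).mul (t₁ p q (x ⊗ₜ y)) (v ⊗ₜ n)) (a b : G →₀ V) :
    ((glueAlgebra X).tensor (glueAlgebra X)).of (glueT₁ t₁ (a ⊗ₜ b))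
      = Δ a * tmul 1 ((glueAlgebra X).of b) := by
  have hND := glueAlgebra_nondegenerate hX
  have hs : ∀ (p q : G) (x y : V), (Finsupp.single p x ⊗ₜ[K] Finsupp.single q y
    : (G →₀ V) ⊗[K] (G →₀ V)) = incl K V p q (x ⊗ₜ y) := fun p q x y => by simp
  refine M.ext_left (hND.tensor hND) fun w => ?_
  rw [left_of, M.left_mul, left_tmul]
  induction a using Finsupp.induction_linear with
  | zero => simp
  | add x y hx hy => simp only [map_add, TensorProduct.add_tmul, LinearMap.add_apply,
      M.left_add, hx, hy]
  | single r x =>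
    induction b using Finsupp.induction_linear with
    | zero => simp [M.left]
    | add x y hx hy =>
      have h : ∀ w, TensorProduct.map (M.left (1 : (glueAlgebra X).M))
          (M.left ((glueAlgebra X).of x + (glueAlgebra X).of y)) w
          = TensorProduct.map (M.left 1) (M.left ((glueAlgebra X).of x)) w
            + TensorProduct.map (M.left 1) (M.left ((glueAlgebra X).of y)) w := fun w => by
        rw [← LinearMap.add_apply, ← TensorProduct.map_add_right]
        rfl
      simp only [TensorProduct.tmul_add, map_add, LinearMap.add_apply, hx, hy, h]
    | single q y =>
      obtain ⟨p, rfl⟩ : ∃ p, r = p * q := ⟨r * q⁻¹, by simp⟩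
      rw [hs, glueT₁_incl]
      refine LinearMap.congr_fun (g := M.left (Δ (Finsupp.single (p * q) x)) ∘ₗ
        TensorProduct.map (M.left 1) (M.left ((glueAlgebra X).of (Finsupp.single q y))))
        (ext_incl fun p' q' v n => ?_) w
      rw [LinearMap.comp_apply, TensorProduct.map_tmul, M.left_one, left_of]
      by_cases hq : q = q'
      · subst hq
        rw [glueAlgebra_mul_single, hs, hs]
        by_cases hp : p = p'
        · subst hp
          rw [incl_mul_incl, (hΔ p q x _).1, h₁]
        · rw [incl_mul_incl_ne (fun h => hp h.1), (hΔ0 _ p' q x (by simpa using hp) _).1]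
          simp
      · rw [glueAlgebra_mul_single_ne X hq, hs, incl_mul_incl_ne (fun h => hq h.2)]
        simp

theorem of_glueT₂ (hX : ∀ p, (X p).Nondegenerate)
    (hΔ : ∀ p q x, IsComponent (Δ (Finsupp.single (p * q) x)) p q (Δc p q x))
    (hΔ0 : ∀ r p q x, r ≠ p * q →
      IsComponent (Δ (Finsupp.single r x)) p q (0 : ((X p).tensor (X q)).M))
    {t₂ : G → G → V ⊗[K] V ≃ₗ[K] V ⊗[K] V}
    (h₂ : ∀ p q x y v n, M.right (Δc p q y) ((X p).mul v x ⊗ₜ n)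
      = ((X p).tensor (X q)).mul (v ⊗ₜ n) (t₂ p q (x ⊗ₜ y))) (a b : G →₀ V) :
    ((glueAlgebra X).tensor (glueAlgebra X)).of (glueT₂ t₂ (a ⊗ₜ b))
      = tmul ((glueAlgebra X).of a) 1 * Δ b := by
  have hND := glueAlgebra_nondegenerate hX
  have hs : ∀ (p q : G) (x y : V), (Finsupp.single p x ⊗ₜ[K] Finsupp.single q y
    : (G →₀ V) ⊗[K] (G →₀ V)) = incl K V p q (x ⊗ₜ y) := fun p q x y => by simp
  refine M.ext_right (hND.tensor hND) fun w => ?_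
  rw [right_of, M.right_mul, right_tmul]
  induction b using Finsupp.induction_linear with
  | zero => simp
  | add x y hx hy => simp only [map_add, TensorProduct.tmul_add,
      M.right_add, hx, hy]
  | single r y =>
    induction a using Finsupp.induction_linear with
    | zero => simp [M.right]
    | add x y hx hy =>
      have h : ∀ w, TensorProduct.map (M.right ((glueAlgebra X).of x + (glueAlgebra X).of y))
          (M.right (1 : (glueAlgebra X).M)) w
          = TensorProduct.map (M.right ((glueAlgebra X).of x)) (M.right 1) w
            + TensorProduct.map (M.right ((glueAlgebra X).of y)) (M.right 1) w := fun w => by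
        rw [← LinearMap.add_apply, ← TensorProduct.map_add_left]
        rfl
      simp only [TensorProduct.add_tmul, map_add, hx, hy, h]
    | single p x =>
      obtain ⟨q, rfl⟩ : ∃ q, r = p * q := ⟨p⁻¹ * r, by simp⟩
      rw [hs, glueT₂_incl]
      refine LinearMap.congr_fun
        (f := ((glueAlgebra X).tensor (glueAlgebra X)).mul.flip (incl K V p q (t₂ p q (x ⊗ₜ y))))
        (g := M.right (Δ (Finsupp.single (p * q) y)) ∘ₗ
          TensorProduct.map (M.right ((glueAlgebra X).of (Finsupp.single p x))) (M.right 1))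
        (ext_incl fun p' q' v n => ?_) w
      rw [LinearMap.comp_apply, LinearMap.flip_apply, TensorProduct.map_tmul, M.right_one,
        right_of]
      by_cases hp : p' = p
      · subst hp
        rw [glueAlgebra_mul_single, hs, hs]
        by_cases hq : q' = q
        · subst hq
          rw [incl_mul_incl, (hΔ p' q' y _).2, h₂]
        · rw [incl_mul_incl_ne (fun h => hq h.2),
            (hΔ0 _ p' q' y (by simpa using Ne.symm hq) _).2]
          simp
      · rw [glueAlgebra_mul_single_ne X hp, hs, incl_mul_incl_ne (fun h => hp h.1)]
        simp

theorem glueT_coassoc {t₁ t₂ : G → G → V ⊗[K] V ≃ₗ[K] V ⊗[K] V}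
    (hco : ∀ p q r (z : V ⊗[K] (V ⊗[K] V)), (t₂ p q).toLinearMap.rTensor V
        ((TensorProduct.assoc K V V V).symm ((t₁ (p * q) r).toLinearMap.lTensor V z))
      = (TensorProduct.assoc K V V V).symm ((t₁ q r).toLinearMap.lTensor V
        (TensorProduct.assoc K V V V ((t₂ p (q * r)).toLinearMap.rTensor V
          ((TensorProduct.assoc K V V V).symm z)))))
    (z : (G →₀ V) ⊗[K] ((G →₀ V) ⊗[K] (G →₀ V))) :
    (glueT₂ t₂).toLinearMap.rTensor _ ((TensorProduct.assoc K _ _ _).symm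
        ((glueT₁ t₁).toLinearMap.lTensor _ z))
      = (TensorProduct.assoc K _ _ _).symm ((glueT₁ t₁).toLinearMap.lTensor _
          (TensorProduct.assoc K _ _ _ ((glueT₂ t₂).toLinearMap.rTensor _
            ((TensorProduct.assoc K _ _ _).symm z)))) := by
  -- the four maps, on the summands
  have hc₁ : ∀ (p q r : G) (z : V ⊗[K] (V ⊗[K] V)), (glueT₁ t₁).toLinearMap.lTensor _
      (TensorProduct.map (Finsupp.lsingle p) (incl K V (q * r) r) z)
      = TensorProduct.map (Finsupp.lsingle p) (incl K V q r)
        ((t₁ q r).toLinearMap.lTensor V z) := by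
    intro p q r z
    induction z with
    | zero => simp
    | add x y hx hy => simp only [map_add, hx, hy]
    | tmul u v => rw [TensorProduct.map_tmul, LinearMap.lTensor_tmul, LinearEquiv.coe_coe,
        glueT₁_incl]; rfl
  have hc₂ : ∀ (p q r : G) (z : (V ⊗[K] V) ⊗[K] V), (glueT₂ t₂).toLinearMap.rTensor _
      (TensorProduct.map (incl K V p (p * q)) (Finsupp.lsingle r) z)
      = TensorProduct.map (incl K V p q) (Finsupp.lsingle r)
        ((t₂ p q).toLinearMap.rTensor V z) := by
    intro p q r z
    induction z with
    | zero => simp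
    | add x y hx hy => simp only [map_add, hx, hy]
    | tmul u v => rw [TensorProduct.map_tmul, LinearMap.rTensor_tmul, LinearEquiv.coe_coe,
        glueT₂_incl]; rfl
  have hc₃ : ∀ (p q r : G) (z : (V ⊗[K] V) ⊗[K] V), TensorProduct.assoc K _ _ _
      (TensorProduct.map (incl K V p q) (Finsupp.lsingle r) z)
      = TensorProduct.map (Finsupp.lsingle p) (incl K V q r) (TensorProduct.assoc K V V V z) := by
    intro p q r z
    refine ext_threefold (f := (TensorProduct.assoc K _ _ _).toLinearMap ∘ₗ
      TensorProduct.map (incl K V p q) (Finsupp.lsingle r))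
      (g := TensorProduct.map (Finsupp.lsingle p) (incl K V q r) ∘ₗ
        (TensorProduct.assoc K V V V).toLinearMap) (fun a b c => by simp) z
  have hc₄ : ∀ (p q r : G) (z : V ⊗[K] (V ⊗[K] V)), (TensorProduct.assoc K _ _ _).symm
      (TensorProduct.map (Finsupp.lsingle p) (incl K V q r) z)
      = TensorProduct.map (incl K V p q) (Finsupp.lsingle r)
        ((TensorProduct.assoc K V V V).symm z) := by
    intro p q r z
    rw [LinearEquiv.symm_apply_eq, hc₃, LinearEquiv.apply_symm_apply]
  have key : ∀ (p q r : G) (z : V ⊗[K] (V ⊗[K] V)),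
      (glueT₂ t₂).toLinearMap.rTensor _ ((TensorProduct.assoc K _ _ _).symm ((glueT₁ t₁).toLinearMap.lTensor _
        (TensorProduct.map (Finsupp.lsingle p) (incl K V (p * q * r) r) z)))
      = (TensorProduct.assoc K _ _ _).symm ((glueT₁ t₁).toLinearMap.lTensor _
          (TensorProduct.assoc K _ _ _ ((glueT₂ t₂).toLinearMap.rTensor _
            ((TensorProduct.assoc K _ _ _).symm
              (TensorProduct.map (Finsupp.lsingle p) (incl K V (p * q * r) r) z))))) := by
    intro p q r z
    rw [hc₁, hc₄, hc₂, hc₄, mul_assoc, hc₂, hc₃, hc₁, hc₄, hco]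
  induction z with
  | zero => simp only [map_zero]
  | add x y hx hy => simp only [map_add, hx, hy]
  | tmul f z =>
    induction f using Finsupp.induction_linear with
    | zero => simp only [TensorProduct.zero_tmul, map_zero]
    | add x y hx hy => simp only [TensorProduct.add_tmul, map_add, hx, hy]
    | single p x =>
      induction z with
      | zero => simp only [TensorProduct.tmul_zero, map_zero]
      | add x y hx hy => simp only [TensorProduct.tmul_add, map_add, hx, hy]
      | tmul g h =>
        induction g using Finsupp.induction_linear with
        | zero => simp only [TensorProduct.zero_tmul, TensorProduct.tmul_zero, map_zero]
        | add x y hx hy => simp only [TensorProduct.add_tmul, TensorProduct.tmul_add, map_add,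
            hx, hy]
        | single s y =>
          induction h using Finsupp.induction_linear with
          | zero => simp only [TensorProduct.tmul_zero, map_zero]
          | add x y hx hy => simp only [TensorProduct.tmul_add, map_add, hx, hy]
          | single r w =>
            obtain ⟨q, rfl⟩ : ∃ q, s = p * q * r := ⟨p⁻¹ * s * r⁻¹, by group⟩
            have h := key p q r (x ⊗ₜ (y ⊗ₜ w))
            simp only [TensorProduct.map_tmul, Finsupp.lsingle_apply] at h
            exact h

/-- A group-graded family of maps `T₁` and `T₂` makes the direct sum of the `X p` into a multiplier
Hopf algebra. -/
theorem isMultiplierHopf_glue (hX : ∀ p, (X p).Nondegenerate)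
    (hΔ : ∀ p q x, IsComponent (Δ (Finsupp.single (p * q) x)) p q (Δc p q x))
    (hΔ0 : ∀ r p q x, r ≠ p * q →
      IsComponent (Δ (Finsupp.single r x)) p q (0 : ((X p).tensor (X q)).M))
    (hmul : ∀ x y, Δ ((glueAlgebra X).mul x y) = Δ x * Δ y)
    (t₁ t₂ : G → G → V ⊗[K] V ≃ₗ[K] V ⊗[K] V)
    (h₁ : ∀ p q x y v n, M.left (Δc p q x) (v ⊗ₜ (X q).mul y n)
      = ((X p).tensor (X q)).mul (t₁ p q (x ⊗ₜ y)) (v ⊗ₜ n))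
    (h₂ : ∀ p q x y v n, M.right (Δc p q y) ((X p).mul v x ⊗ₜ n)
      = ((X p).tensor (X q)).mul (v ⊗ₜ n) (t₂ p q (x ⊗ₜ y)))
    (hco : ∀ p q r (z : V ⊗[K] (V ⊗[K] V)), (t₂ p q).toLinearMap.rTensor V
        ((TensorProduct.assoc K V V V).symm ((t₁ (p * q) r).toLinearMap.lTensor V z))
      = (TensorProduct.assoc K V V V).symm ((t₁ q r).toLinearMap.lTensor V
        (TensorProduct.assoc K V V V ((t₂ p (q * r)).toLinearMap.rTensor V
          ((TensorProduct.assoc K V V V).symm z))))) :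
    ∃ h : IsMultiplierHopf (glueAlgebra X) Δ,
      (∀ p q z, h.T1 (incl K V (p * q) q z) = incl K V p q (t₁ p q z)) ∧
      (∀ p q z, h.T2 (incl K V p (p * q) z) = incl K V p q (t₂ p q z)) := by
  have hND := glueAlgebra_nondegenerate hX
  have hs₁ := of_glueT₁ hX hΔ hΔ0 h₁
  have hs₂ := of_glueT₂ hX hΔ hΔ0 h₂
  let h : IsMultiplierHopf (glueAlgebra X) Δ :=
    ⟨hND, hmul, glueT₁ t₁, glueT₂ t₂, hs₁, hs₂, glueT_coassoc hco⟩
  have hinj := of_injective (hND.tensor hND)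
  have e₁ : h.T1 = glueT₁ t₁ := LinearEquiv.toLinearMap_injective
    (TensorProduct.ext' fun a b => hinj ((h.T1_spec a b).trans (hs₁ a b).symm))
  have e₂ : h.T2 = glueT₂ t₂ := LinearEquiv.toLinearMap_injective
    (TensorProduct.ext' fun a b => hinj ((h.T2_spec a b).trans (hs₂ a b).symm))
  exact ⟨h, by rw [e₁]; exact glueT₁_incl t₁, by rw [e₂]; exact glueT₂_incl t₂⟩

end Glue

/-! ### Comultiplications on twisted tensor products -/

section Components

variable {K : Type*} [Field K] {A B : Type*} [AddCommGroup A] [Module K A]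
  [AddCommGroup B] [Module K B] {R : NUAlgebra K A} {S : NUAlgebra K B}
  {ΔA ΔA' : A →ₗ[K] (R.tensor R).M} {ΔB ΔB' : B →ₗ[K] (S.tensor S).M}

theorem NUAlgebra.NondegHom.comm_tensor_l {V N N' : Type*} [AddCommGroup V] [Module K V]
    [AddCommGroup N] [Module K N] [AddCommGroup N'] [Module K N']
    (l : V →ₗ[K] N →ₗ[K] N) (l' : V →ₗ[K] N' →ₗ[K] N') (x : V ⊗[K] V) (z : N ⊗[K] N') :
    TensorProduct.comm K N N' (TensorProduct.map₂ l l' x z)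
      = TensorProduct.map₂ l' l (TensorProduct.comm K V V x) (TensorProduct.comm K N N' z) := by
  induction x with
  | zero => simp
  | add x y hx hy => simp only [map_add, LinearMap.add_apply, hx, hy]
  | tmul a b =>
    induction z with
    | zero => simp
    | add x y hx hy => simp only [map_add, hx, hy]
    | tmul c d => simp

theorem NUAlgebra.NondegHom.left_extend_flip {V N N' : Type*} [AddCommGroup V] [Module K V]
    [AddCommGroup N] [Module K N] [AddCommGroup N'] [Module K N'] {R : NUAlgebra K V}
    {Y : NUAlgebra K N} {Y' : NUAlgebra K N'} (j : R.NondegHom Y) (j' : R.NondegHom Y')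
    (hR : (R.tensor R).HasLocalUnits) (m : (R.tensor R).M) (z : N' ⊗[K] N) :
    M.left ((j'.tensor j).extend hR (R.flip m)) z
      = TensorProduct.comm K N N' (M.left ((j.tensor j').extend hR m)
        (TensorProduct.comm K N' N z)) := by
  refine LinearMap.congr_fun (g := (TensorProduct.comm K N N').toLinearMap ∘ₗ
    M.left ((j.tensor j').extend hR m) ∘ₗ (TensorProduct.comm K N' N).toLinearMap)
    ((j'.tensor j).isModule_l.ext_act fun x w => ?_) z
  have h1 := comm_tensor_l j'.l j.l x w
  have h2 := comm_tensor_l j.l j'.l (M.left m (TensorProduct.comm K V V x))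
    (TensorProduct.comm K N' N w)
  have h3 := (j.tensor j').left_extend hR m (TensorProduct.comm K V V x)
    (TensorProduct.comm K N' N w)
  rw [LinearMap.comp_apply, LinearMap.comp_apply, NondegHom.left_extend, LinearEquiv.coe_coe,
    LinearEquiv.coe_coe]
  refine Eq.trans ?_ (congrArg _ (h3.symm.trans (congrArg _ h1.symm)))
  refine Eq.trans ?_ h2.symm
  rw [left_flip]
  congr 1
  exact ((TensorProduct.comm K N N').apply_symm_apply w).symm

theorem NUAlgebra.NondegHom.right_extend_flip {V N N' : Type*} [AddCommGroup V] [Module K V]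
    [AddCommGroup N] [Module K N] [AddCommGroup N'] [Module K N'] {R : NUAlgebra K V}
    {Y : NUAlgebra K N} {Y' : NUAlgebra K N'} (j : R.NondegHom Y) (j' : R.NondegHom Y')
    (hR : (R.tensor R).HasLocalUnits) (m : (R.tensor R).M) (z : N' ⊗[K] N) :
    M.right ((j'.tensor j).extend hR (R.flip m)) z
      = TensorProduct.comm K N N' (M.right ((j.tensor j').extend hR m)
        (TensorProduct.comm K N' N z)) := by
  refine LinearMap.congr_fun (g := (TensorProduct.comm K N N').toLinearMap ∘ₗ
    M.right ((j.tensor j').extend hR m) ∘ₗ (TensorProduct.comm K N' N).toLinearMap)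
    ((j'.tensor j).isModule_r.ext_act fun x w => ?_) z
  have h1 := comm_tensor_l j'.r j.r x w
  have h2 := comm_tensor_l j.r j'.r (M.right m (TensorProduct.comm K V V x))
    (TensorProduct.comm K N' N w)
  have h3 := (j.tensor j').right_extend hR m (TensorProduct.comm K V V x)
    (TensorProduct.comm K N' N w)
  rw [LinearMap.comp_apply, LinearMap.comp_apply, NondegHom.right_extend, LinearEquiv.coe_coe,
    LinearEquiv.coe_coe]
  refine Eq.trans ?_ (congrArg _ (h3.symm.trans (congrArg _ h1.symm)))
  refine Eq.trans ?_ h2.symm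
  rw [right_flip]
  congr 1
  exact ((TensorProduct.comm K N N').apply_symm_apply w).symm

namespace TwistMap

variable (X Y Z : TwistMap R S) {φ χ : B ≃ₗ[K] B} (hφ : ∀ x y, φ (S.mul x y) = S.mul (φ x) (φ y))
  (hχ : ∀ x y, χ (S.mul x y) = S.mul (χ x) (χ y))

/-- The image in `M(X ⊗ Y)` of a multiplier of `R ⊗ R`. -/
def multA : (R.tensor R).M →ₗ[K] (X.algebra.tensor Y.algebra).M :=
  (X.homA.tensor Y.homA).extend (X.unitsA.tensor X.unitsA)

/-- The image in `M(X ⊗ Y)` of `(φ ⊗ χ)(m)`, for a multiplier `m` of `S ⊗ S`. -/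
def multB : (S.tensor S).M →ₗ[K] (X.algebra.tensor Y.algebra).M :=
  ((X.homB.comp φ hφ).tensor (Y.homB.comp χ hχ)).extend (X.unitsB.tensor X.unitsB)

/-- The map `a ⋈ b ↦ Δ(a)(φ ⊗ χ)Δ(b)` with values in `M(X ⊗ Y)`. -/
def comulMap (ΔA : A →ₗ[K] (R.tensor R).M) (ΔB : B →ₗ[K] (S.tensor S).M) :
    A ⊗[K] B →ₗ[K] (X.algebra.tensor Y.algebra).M :=
  prodMap (multA X Y ∘ₗ ΔA) (multB X Y hφ hχ ∘ₗ ΔB)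

theorem comulMap_tmul (a : A) (b : B) : comulMap X Y hφ hχ ΔA ΔB (a ⊗ₜ b)
    = multA X Y (ΔA a) * multB X Y hφ hχ (ΔB b) := prodMap_tmul _ _ a b

theorem left_comulMap_flip (hA : ∀ a, ΔA' a = R.flip (ΔA a)) (hB : ∀ b, ΔB' b = S.flip (ΔB b))
    (x z) : M.left (comulMap Y X hχ hφ ΔA' ΔB' x) z
      = TensorProduct.comm K _ _ (M.left (comulMap X Y hφ hχ ΔA ΔB x)
        (TensorProduct.comm K _ _ z)) := by
  induction x with
  | zero => simp
  | add x y hx hy => simp only [map_add, M.left_add, hx, hy]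
  | tmul a b =>
    rw [comulMap_tmul, comulMap_tmul, M.left_mul, M.left_mul, hA, hB, multA, multA, multB, multB,
      NondegHom.left_extend_flip, NondegHom.left_extend_flip]
    congr 2
    exact (TensorProduct.comm K _ _).symm_apply_apply _

theorem right_comulMap_flip (hA : ∀ a, ΔA' a = R.flip (ΔA a)) (hB : ∀ b, ΔB' b = S.flip (ΔB b))
    (x z) : M.right (comulMap Y X hχ hφ ΔA' ΔB' x) z
      = TensorProduct.comm K _ _ (M.right (comulMap X Y hφ hχ ΔA ΔB x)
        (TensorProduct.comm K _ _ z)) := by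
  induction x with
  | zero => simp
  | add x y hx hy => simp only [map_add, M.right_add, hx, hy]
  | tmul a b =>
    rw [comulMap_tmul, comulMap_tmul, M.right_mul, M.right_mul, hA, hB, multA, multA, multB, multB,
      NondegHom.right_extend_flip, NondegHom.right_extend_flip]
    congr 2
    exact (TensorProduct.comm K _ _).symm_apply_apply _

variable (hA : IsMultiplierHopf R ΔA) (hB : IsMultiplierHopf S ΔB)

/-- The map `x ⊗ y ↦ Δ(x)(1 ⊗ y)` for `comulMap`, with `y` in `Y`. -/
def compT₁ (φ : B ≃ₗ[K] B) (hχ : ∀ x y, χ (S.mul x y) = S.mul (χ x) (χ y)) :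
    (A ⊗[K] B) ⊗[K] (A ⊗[K] B) ≃ₗ[K] (A ⊗[K] B) ⊗[K] (A ⊗[K] B) :=
  leftCan hA hB Y.unitsA Y.unitsB φ Y.isModule_lA (Y.isModule_lB.comp χ hχ)

/-- The map `y ⊗ x ↦ (x ⊗ 1)Δ(y)` for `comulMap`, with `x` in `X` and with the two legs of the
result interchanged. -/
def compT₂flip (hφ : ∀ x y, φ (S.mul x y) = S.mul (φ x) (φ y)) (χ : B ≃ₗ[K] B) :
    (A ⊗[K] B) ⊗[K] (A ⊗[K] B) ≃ₗ[K] (A ⊗[K] B) ⊗[K] (A ⊗[K] B) :=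
  rightCan hA hB X.unitsA X.unitsB χ X.isModule_rA (X.isModule_rB.comp φ fun x y => hφ y x)

/-- The map `x ⊗ y ↦ (x ⊗ 1)Δ(y)` for `comulMap`, with `x` in `X`. -/
def compT₂ (hφ : ∀ x y, φ (S.mul x y) = S.mul (φ x) (φ y)) (χ : B ≃ₗ[K] B) :
    (A ⊗[K] B) ⊗[K] (A ⊗[K] B) ≃ₗ[K] (A ⊗[K] B) ⊗[K] (A ⊗[K] B) :=
  (TensorProduct.comm K _ _).trans ((X.compT₂flip hA hB hφ χ).trans (TensorProduct.comm K _ _))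

theorem left_comulMap_tmul (x v m : A ⊗[K] B) : M.left (comulMap X Y hφ hχ ΔA ΔB x) (v ⊗ₜ m)
    = (X.algebra.mul.flip v).rTensor _ (Y.compT₁ hA hB φ hχ (x ⊗ₜ m)) := by
  induction x with
  | zero => simp
  | add x y hx hy => simp only [map_add, TensorProduct.add_tmul, M.left_add, hx, hy]
  | tmul a b =>
    rw [comulMap_tmul, M.left_mul, multA, multB, hB.left_extend_comul]
    simp only [compT₁, leftCan, LinearEquiv.trans_apply, legB_tmul]
    change M.left _ (LinearMap.rTensor _ _ (hB.canL Y.unitsB (Y.isModule_lB.comp χ hχ) _)) = _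
    generalize hB.canL Y.unitsB (Y.isModule_lB.comp χ hχ) (b ⊗ₜ m) = s
    induction s with
    | zero => simp
    | add x y hx hy => simp only [map_add, TensorProduct.tmul_add, hx, hy]
    | tmul b' m' =>
      rw [LinearMap.rTensor_tmul, hA.left_extend_comul, TensorProduct.assoc_symm_tmul, legMid_tmul,
        legA_tmul]
      change LinearMap.rTensor _ _ (hA.canL Y.unitsA Y.isModule_lA _) = _
      generalize hA.canL Y.unitsA Y.isModule_lA (a ⊗ₜ m') = s
      induction s with
      | zero => simp
      | add x y hx hy => simp only [map_add, TensorProduct.add_tmul, hx, hy]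
      | tmul a' m'' =>
        rw [TensorProduct.rightComm_tmul, LinearMap.rTensor_tmul, LinearMap.rTensor_tmul,
          LinearMap.flip_apply, LinearMap.flip_apply]
        exact congrArg (· ⊗ₜ m'') (X.mul_tmul a' (φ b') v).symm

theorem right_comulMap_tmul (x m n : A ⊗[K] B) : M.right (comulMap X Y hφ hχ ΔA ΔB x) (m ⊗ₜ n)
    = TensorProduct.comm K _ _ ((Y.algebra.mul n).rTensor _ (X.compT₂flip hA hB hφ χ (x ⊗ₜ m))) := by
  induction x with
  | zero => simp
  | add x y hx hy => simp only [map_add, TensorProduct.add_tmul, M.right_add, hx, hy]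
  | tmul a b =>
    rw [comulMap_tmul, M.right_mul, multA, multB, hA.right_extend_comul]
    simp only [compT₂flip, rightCan, LinearEquiv.trans_apply, legA_tmul]
    change M.right _ (TensorProduct.comm K _ _
      (LinearMap.rTensor _ _ (hA.canR X.unitsA X.isModule_rA _))) = _
    generalize hA.canR X.unitsA X.isModule_rA (a ⊗ₜ m) = s
    induction s with
    | zero => simp
    | add x y hx hy => simp only [map_add, TensorProduct.add_tmul, hx, hy]
    | tmul a' m' =>
      rw [LinearMap.rTensor_tmul, TensorProduct.comm_tmul, hB.right_extend_comul,
        TensorProduct.rightComm_tmul, legB_tmul]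
      change TensorProduct.comm K _ _ (LinearMap.rTensor _ _ (hB.canR X.unitsB
        (X.isModule_rB.comp φ fun x y => hφ y x) _)) = _
      generalize hB.canR X.unitsB (X.isModule_rB.comp φ fun x y => hφ y x) (b ⊗ₜ m') = s
      induction s with
      | zero => simp
      | add x y hx hy => simp only [map_add, TensorProduct.tmul_add, hx, hy]
      | tmul b' m'' =>
        rw [TensorProduct.assoc_symm_tmul, legMid_tmul, LinearMap.rTensor_tmul,
          LinearMap.rTensor_tmul, LinearMap.flip_apply, LinearMap.flip_apply, mul_tmul_right]
        rfl

theorem compT₁_spec (x y v n : A ⊗[K] B) :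
    M.left (comulMap X Y hφ hχ ΔA ΔB x) (v ⊗ₜ Y.algebra.mul y n)
      = (X.algebra.tensor Y.algebra).mul (Y.compT₁ hA hB φ hχ (x ⊗ₜ y)) (v ⊗ₜ n) := by
  have h := leftCan_natural hA hB Y.unitsA Y.unitsB φ Y.isModule_lA (Y.isModule_lB.comp χ hχ)
    Y.isModule_lA (Y.isModule_lB.comp χ hχ) (f := Y.algebra.mul.flip n)
    (fun a m => (Y.homA.l_mul Y.nondegenerate a m n).symm)
    (fun b m => (Y.homB.l_mul Y.nondegenerate (χ b) m n).symm) (x ⊗ₜ y)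
  rw [left_comulMap_tmul X Y hφ hχ hA hB, compT₁]
  refine (congrArg _ h).trans ?_
  generalize leftCan hA hB Y.unitsA Y.unitsB φ Y.isModule_lA (Y.isModule_lB.comp χ hχ)
    (x ⊗ₜ y) = s
  induction s with
  | zero => simp
  | add x y hx hy => simp only [map_add, LinearMap.add_apply, hx, hy]
  | tmul u w => simp

theorem compT₂_spec (x y v n : A ⊗[K] B) :
    M.right (comulMap X Y hφ hχ ΔA ΔB y) (X.algebra.mul v x ⊗ₜ n)
      = (X.algebra.tensor Y.algebra).mul (v ⊗ₜ n) (X.compT₂ hA hB hφ χ (x ⊗ₜ y)) := by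
  have h := rightCan_natural hA hB X.unitsA X.unitsB χ X.isModule_rA
    (X.isModule_rB.comp φ fun x y => hφ y x) X.isModule_rA
    (X.isModule_rB.comp φ fun x y => hφ y x) (f := X.algebra.mul v)
    (fun a m => (X.homA.r_mul X.nondegenerate a v m).symm)
    (fun b m => (X.homB.r_mul X.nondegenerate (φ b) v m).symm) (y ⊗ₜ x)
  rw [right_comulMap_tmul X Y hφ hχ hA hB, compT₂flip]
  refine (congrArg _ (congrArg _ h)).trans ?_
  simp only [compT₂, compT₂flip, LinearEquiv.trans_apply, TensorProduct.comm_tmul]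
  generalize rightCan hA hB X.unitsA X.unitsB χ X.isModule_rA
    (X.isModule_rB.comp φ fun x y => hφ y x) (y ⊗ₜ x) = s
  induction s with
  | zero => simp
  | add x y hx hy => simp only [map_add, hx, hy]
  | tmul u w => simp

section LeftComm

variable {C N N' : Type*} [AddCommGroup C] [Module K C] [AddCommGroup N] [Module K N]
  [AddCommGroup N'] [Module K N']

theorem leftComm_lTensor {G : C ⊗[K] N' ≃ₗ[K] C ⊗[K] N'}
    {GM : C ⊗[K] (N ⊗[K] N') ≃ₗ[K] C ⊗[K] (N ⊗[K] N')}
    (h : ∀ n z, GM ((TensorProduct.mk K N N' n).lTensor C z)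
      = (TensorProduct.mk K N N' n).lTensor C (G z)) (u : N ⊗[K] (C ⊗[K] N')) :
    TensorProduct.leftComm K N C N' (G.toLinearMap.lTensor N u)
      = GM (TensorProduct.leftComm K N C N' u) := by
  have key : ∀ n (t : C ⊗[K] N'), TensorProduct.leftComm K N C N' (n ⊗ₜ t)
      = (TensorProduct.mk K N N' n).lTensor C t := by
    intro n t
    induction t with
    | zero => simp
    | add x y hx hy => simp only [map_add, TensorProduct.tmul_add, hx, hy]
    | tmul c w => simp
  induction u with
  | zero => simp
  | add x y hx hy => simp only [map_add, hx, hy]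
  | tmul n t => rw [LinearMap.lTensor_tmul, key, key, h]; rfl

theorem leftComm_rTensor {F : C ⊗[K] N ≃ₗ[K] C ⊗[K] N}
    {FM : C ⊗[K] (N ⊗[K] N') ≃ₗ[K] C ⊗[K] (N ⊗[K] N')}
    (h : ∀ w z, FM (((TensorProduct.mk K N N').flip w).lTensor C z)
      = ((TensorProduct.mk K N N').flip w).lTensor C (F z)) (u : N ⊗[K] (C ⊗[K] N')) :
    TensorProduct.leftComm K N C N' (TensorProduct.assoc K N C N'
        (((TensorProduct.comm K N C).trans (F.trans (TensorProduct.comm K C N))).toLinearMap.rTensor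
          N' ((TensorProduct.assoc K N C N').symm u)))
      = FM (TensorProduct.leftComm K N C N' u) := by
  induction u with
  | zero => simp
  | add x y hx hy => simp only [map_add, hx, hy]
  | tmul n t =>
    induction t with
    | zero => simp
    | add x y hx hy => simp only [map_add, TensorProduct.tmul_add, hx, hy]
    | tmul c w =>
      have h1 := h w (c ⊗ₜ n)
      rw [LinearMap.lTensor_tmul, LinearMap.flip_apply, TensorProduct.mk_apply] at h1
      rw [TensorProduct.assoc_symm_tmul, LinearMap.rTensor_tmul, TensorProduct.leftComm_tmul, h1,
        LinearEquiv.coe_coe, LinearEquiv.trans_apply, LinearEquiv.trans_apply,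
        TensorProduct.comm_tmul]
      generalize F (c ⊗ₜ n) = s
      induction s with
      | zero => simp
      | add x y hx hy => simp only [map_add, TensorProduct.add_tmul, hx, hy]
      | tmul x y => simp

end LeftComm

/-- Coassociativity of the maps `comulMap`. -/
theorem compT_coassoc {φ₁ φ₂ φ₃ φ₄ χ₁ χ₂ χ₃ χ₄ : B ≃ₗ[K] B}
    (hφ₁ : ∀ x y, φ₁ (S.mul x y) = S.mul (φ₁ x) (φ₁ y))
    (hφ₂ : ∀ x y, φ₂ (S.mul x y) = S.mul (φ₂ x) (φ₂ y))
    (hφ₂Δ : ∀ a z, M.left (ΔB (φ₂ a)) (TensorProduct.congr φ₂ φ₂ z)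
      = TensorProduct.congr φ₂ φ₂ (M.left (ΔB a) z))
    (hφ₄ : ∀ x y, φ₄ (S.mul x y) = S.mul (φ₄ x) (φ₄ y))
    (hχ₂ : ∀ x y, χ₂ (S.mul x y) = S.mul (χ₂ x) (χ₂ y))
    (hχ₃ : ∀ x y, χ₃ (S.mul x y) = S.mul (χ₃ x) (χ₃ y))
    (hχ₄ : ∀ x y, χ₄ (S.mul x y) = S.mul (χ₄ x) (χ₄ y))
    (hχ₄Δ : ∀ a z, M.left (ΔB (χ₄ a)) (TensorProduct.congr χ₄ χ₄ z)
      = TensorProduct.congr χ₄ χ₄ (M.left (ΔB a) z))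
    (h₁ : ∀ b, φ₁ (φ₂ b) = φ₄ b) (h₂ : ∀ b, χ₁ (φ₂ b) = φ₃ (χ₄ b)) (h₃ : ∀ b, χ₂ b = χ₃ (χ₄ b))
    (z : (A ⊗[K] B) ⊗[K] ((A ⊗[K] B) ⊗[K] (A ⊗[K] B))) :
    (X.compT₂ hA hB hφ₁ χ₁).toLinearMap.rTensor _ ((TensorProduct.assoc K _ _ _).symm
        ((Z.compT₁ hA hB φ₂ hχ₂).toLinearMap.lTensor _ z))
      = (TensorProduct.assoc K _ _ _).symm ((Z.compT₁ hA hB φ₃ hχ₃).toLinearMap.lTensor _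
        (TensorProduct.assoc K _ _ _ ((X.compT₂ hA hB hφ₄ χ₄).toLinearMap.rTensor _
          ((TensorProduct.assoc K _ _ _).symm z)))) := by
  refine (TensorProduct.assoc K _ _ _).injective ?_
  rw [LinearEquiv.apply_symm_apply]
  refine (TensorProduct.leftComm K _ _ _).injective ?_
  have hL₁ := leftComm_lTensor (N := A ⊗[K] B) fun n => leftCan_natural hA hB Z.unitsA Z.unitsB φ₂
    Z.isModule_lA (Z.isModule_lB.comp χ₂ hχ₂) Z.isModule_lA.lTensor
    (Z.isModule_lB.comp χ₂ hχ₂).lTensor (f := TensorProduct.mk K (A ⊗[K] B) (A ⊗[K] B) n)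
    (fun _ _ => by simp) (fun _ _ => by simp)
  have hL₂ := leftComm_lTensor (N := A ⊗[K] B) fun n => leftCan_natural hA hB Z.unitsA Z.unitsB φ₃
    Z.isModule_lA (Z.isModule_lB.comp χ₃ hχ₃) Z.isModule_lA.lTensor
    (Z.isModule_lB.comp χ₃ hχ₃).lTensor (f := TensorProduct.mk K (A ⊗[K] B) (A ⊗[K] B) n)
    (fun _ _ => by simp) (fun _ _ => by simp)
  have hR₁ := leftComm_rTensor (N' := A ⊗[K] B) fun w => rightCan_natural hA hB X.unitsA X.unitsB χ₁
    X.isModule_rA (X.isModule_rB.comp φ₁ fun x y => hφ₁ y x) X.isModule_rA.rTensor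
    (X.isModule_rB.comp φ₁ fun x y => hφ₁ y x).rTensor
    (f := (TensorProduct.mk K (A ⊗[K] B) (A ⊗[K] B)).flip w)
    (fun _ _ => by simp) (fun _ _ => by simp)
  have hR₂ := leftComm_rTensor (N' := A ⊗[K] B) fun w => rightCan_natural hA hB X.unitsA X.unitsB χ₄
    X.isModule_rA (X.isModule_rB.comp φ₄ fun x y => hφ₄ y x) X.isModule_rA.rTensor
    (X.isModule_rB.comp φ₄ fun x y => hφ₄ y x).rTensor
    (f := (TensorProduct.mk K (A ⊗[K] B) (A ⊗[K] B)).flip w)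
    (fun _ _ => by simp) (fun _ _ => by simp)
  have hc : ∀ (f g : Module.End K (A ⊗[K] B)) (n : (A ⊗[K] B) ⊗[K] (A ⊗[K] B)),
      f.rTensor _ (g.lTensor _ n) = g.lTensor _ (f.rTensor _ n) := fun f g n => by
    rw [← LinearMap.comp_apply, ← LinearMap.comp_apply, LinearMap.rTensor_comp_lTensor,
      LinearMap.lTensor_comp_rTensor]
  refine (hR₁ _).trans ((congrArg _ (hL₁ z)).trans ?_)
  refine Eq.trans ?_ ((hL₂ _).trans (congrArg _ (hR₂ z))).symm
  exact rightCan_leftCan hA hB X.unitsA X.unitsB hφ₂ hφ₂Δ hχ₄ hχ₄Δ h₂ _ _ _ _ _ _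
    (fun b n => by simp [h₃]) (fun b n => by simp [h₁]) (fun _ _ _ => hc _ _ _)
    (fun _ _ _ => hc _ _ _) (fun _ _ _ => hc _ _ _) (fun _ _ _ => hc _ _ _) _

end TwistMap

end Components

/-! ### Multiplicativity of the comultiplication -/

section

/-- The left action of multipliers, as a linear map. -/
def NUAlgebra.M.leftHom {K V : Type*} [Field K] [AddCommGroup V] [Module K V] (R : NUAlgebra K V) :
    R.M →ₗ[K] Module.End K V := LinearMap.fst K _ _ ∘ₗ R.M.val.toLinearMap

section GlueFlip

variable {K : Type*} [Field K] {G V : Type*} [AddCommGroup V] [Module K V]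
  {X : G → NUAlgebra K V}

theorem IsComponent.flip {N : ((glueAlgebra X).tensor (glueAlgebra X)).M} {p q : G}
    {m : ((X p).tensor (X q)).M} {m' : ((X q).tensor (X p)).M} (h : IsComponent N p q m)
    (hl : ∀ z, M.left m' z = TensorProduct.comm K V V (M.left m (TensorProduct.comm K V V z)))
    (hr : ∀ z, M.right m' z = TensorProduct.comm K V V (M.right m (TensorProduct.comm K V V z))) :
    IsComponent ((glueAlgebra X).flip N) q p m' := fun z => by
  rw [left_flip, right_flip, ← TensorProduct.map_comm, (h _).1, (h _).2, hl, hr,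
    TensorProduct.map_comm, TensorProduct.map_comm]
  exact ⟨rfl, rfl⟩

/-- The version of `isMultiplierHopf_glue` for the opposite comultiplication: the components of
`D^cop` are graded by the opposite group. -/
theorem isMultiplierHopf_glue_cop [Group G]
    {Δ : (G →₀ V) →ₗ[K] ((glueAlgebra X).tensor (glueAlgebra X)).M}
    {Δc Δc' : ∀ p q, V →ₗ[K] ((X p).tensor (X q)).M} (hX : ∀ p, (X p).Nondegenerate)
    (hΔ : ∀ p q x, IsComponent (Δ (Finsupp.single (p * q) x)) p q (Δc p q x))
    (hΔ0 : ∀ r p q x, r ≠ p * q →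
      IsComponent (Δ (Finsupp.single r x)) p q (0 : ((X p).tensor (X q)).M))
    (hmul : ∀ x y, Δ ((glueAlgebra X).mul x y) = Δ x * Δ y)
    (hl : ∀ p q x z, M.left (Δc' p q x) z
      = TensorProduct.comm K V V (M.left (Δc q p x) (TensorProduct.comm K V V z)))
    (hr : ∀ p q x z, M.right (Δc' p q x) z
      = TensorProduct.comm K V V (M.right (Δc q p x) (TensorProduct.comm K V V z)))
    (t₁ t₂ : G → G → V ⊗[K] V ≃ₗ[K] V ⊗[K] V)
    (h₁ : ∀ p q x y v n, M.left (Δc' p q x) (v ⊗ₜ (X q).mul y n)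
      = ((X p).tensor (X q)).mul (t₁ p q (x ⊗ₜ y)) (v ⊗ₜ n))
    (h₂ : ∀ p q x y v n, M.right (Δc' p q y) ((X p).mul v x ⊗ₜ n)
      = ((X p).tensor (X q)).mul (v ⊗ₜ n) (t₂ p q (x ⊗ₜ y)))
    (hco : ∀ p q r (z : V ⊗[K] (V ⊗[K] V)), (t₂ p q).toLinearMap.rTensor V
        ((TensorProduct.assoc K V V V).symm ((t₁ (q * p) r).toLinearMap.lTensor V z))
      = (TensorProduct.assoc K V V V).symm ((t₁ q r).toLinearMap.lTensor V
        (TensorProduct.assoc K V V V ((t₂ p (r * q)).toLinearMap.rTensor V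
          ((TensorProduct.assoc K V V V).symm z))))) :
    IsMultiplierHopf (glueAlgebra X) ((glueAlgebra X).flip ∘ₗ Δ) := by
  have h := @isMultiplierHopf_glue K _ G V _ _ X (MulOpposite.opEquiv (α := G)).group
    ((glueAlgebra X).flip ∘ₗ Δ) Δc' hX (fun p q x => (hΔ q p x).flip (hl p q x) (hr p q x))
    (fun r p q x hne => (hΔ0 r q p x hne).flip (fun z => by simp) (fun z => by simp))
    (fun x y => by simp only [LinearMap.comp_apply, hmul, flip_mul_flip]) t₁ t₂ h₁ h₂ hco
  exact h.1

end GlueFlip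

variable {K : Type*} {A : Type*} {B : Type*} [Field K] [AddCommGroup A] [Module K A]
  [AddCommGroup B] [Module K B] {𝒜 : RegularMHA K A} {ℬ : RegularMHA K B}

namespace RegularMHA.AutPair

/-- The automorphism `γ⁻¹βγ`, for `p = (α, β)` and `q = (γ, δ)`. -/
def conjSnd (p q : ℬ.AutPair) : ℬ.hopfAut := q.fst⁻¹ * p.snd * q.fst

theorem fst_mul (p q : ℬ.AutPair) : (p * q).fst = p.fst * q.fst := rfl

theorem snd_mul (p q : ℬ.AutPair) : (p * q).snd = q.snd * conjSnd p q :=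
  show q.snd * q.fst⁻¹ * p.snd * q.fst = q.snd * (q.fst⁻¹ * p.snd * q.fst) by
    simp only [mul_assoc]

/-- This identity and the next one are the compatibilities of the automorphisms in `Δ_(p,q)` which
coassociativity requires. -/
theorem conjSnd_mul_fst (p q r : ℬ.AutPair) :
    conjSnd p q * r.fst = r.fst * conjSnd p (q * r) := by
  simp only [conjSnd, fst_mul]
  group

theorem conjSnd_mul (p q r : ℬ.AutPair) :
    conjSnd (p * q) r = conjSnd q r * conjSnd p (q * r) := by
  simp only [conjSnd, fst_mul, snd_mul]
  group

theorem fst_mul_conjSnd (p q : ℬ.AutPair) : q.fst * conjSnd p q = p.snd * q.fst := by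
  simp only [conjSnd, mul_assoc, mul_inv_cancel_left]

end RegularMHA.AutPair

open RegularMHA

namespace TwistMap

variable {R : NUAlgebra K A} {S : NUAlgebra K B} {ΔA : A →ₗ[K] (R.tensor R).M}
  {ΔB : B →ₗ[K] (S.tensor S).M} (X Y : TwistMap R S) {φ χ : B ≃ₗ[K] B}
  (hφ : ∀ x y, φ (S.mul x y) = S.mul (φ x) (φ y)) (hχ : ∀ x y, χ (S.mul x y) = S.mul (χ x) (χ y))

theorem multA_mul (m n : (R.tensor R).M) : X.multA Y (m * n) = X.multA Y m * X.multA Y n :=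
  (X.homA.tensor Y.homA).extend_mul (X.unitsA.tensor X.unitsA) m n

theorem multB_mul (m n : (S.tensor S).M) :
    X.multB Y hφ hχ (m * n) = X.multB Y hφ hχ m * X.multB Y hφ hχ n :=
  ((X.homB.comp φ hφ).tensor (Y.homB.comp χ hχ)).extend_mul (X.unitsB.tensor X.unitsB) m n

theorem comulMap_mul (W : TwistMap R S)
    (hA : IsMultiplierHopf R ΔA) (hB : IsMultiplierHopf S ΔB)
    (h : ∀ b a, X.multB Y hφ hχ (ΔB b) * X.multA Y (ΔA a)
      = X.comulMap Y hφ hχ ΔA ΔB (W.T (b ⊗ₜ a))) (x y : A ⊗[K] B) :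
    X.comulMap Y hφ hχ ΔA ΔB (W.algebra.mul x y)
      = X.comulMap Y hφ hχ ΔA ΔB x * X.comulMap Y hφ hχ ΔA ΔB y := by
  have h1 : ∀ a a', (X.multA Y ∘ₗ ΔA) (R.mul a a')
      = (X.multA Y ∘ₗ ΔA) a * (X.multA Y ∘ₗ ΔA) a' := fun a a' => by
    simp only [LinearMap.comp_apply]
    rw [hA.comul_mul, multA_mul]
  have h2 : ∀ b b', (X.multB Y hφ hχ ∘ₗ ΔB) (S.mul b b')
      = (X.multB Y hφ hχ ∘ₗ ΔB) b * (X.multB Y hφ hχ ∘ₗ ΔB) b' := fun b b' => by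
    simp only [LinearMap.comp_apply]
    rw [hB.comul_mul, multB_mul]
  exact W.prodMap_mul h1 h2 h x y

end TwistMap

namespace Pairing

/-- The left multipliers `Δ^cop(a)` and `(φ ⊗ χ)Δ(b)` are covariant. The first tensor factor is
governed by the pairings `P` and `Q`, twisted by `φ`, and the second one by `P'` and `Q'`, twisted by
`χ`; only the outer pairings remain if the inner ones agree. -/
theorem covariant_multA_multB {P Q P' Q' : Pairing 𝒜 ℬ} (φ χ : ℬ.hopfAut) (h : Q.twist φ = P'.twist χ) :
    Covariant (P.twist φ) (Q'.twist χ)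
      (M.leftHom _ ∘ₗ (twistMap P Q).multA (twistMap P' Q') ∘ₗ 𝒜.toNUAlgebra.flip ∘ₗ 𝒜.comul)
      (M.leftHom _ ∘ₗ (twistMap P Q).multB (twistMap P' Q') φ.2.1 χ.2.1 ∘ₗ ℬ.comul) := by
  have h1 := (covariant_twistMap P Q).twist φ
  rw [h] at h1
  exact h1.tensor ((covariant_twistMap P' Q').twist χ) (twistMap P' Q').isModule_lA
    ((twistMap P' Q').isModule_lB.comp χ.1 χ.2.1)
    (fun a v n => 𝒜.isMultiplierHopf_cop.left_extend_comul 𝒜.hasLocalUnits (twistMap P Q).homA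
      (twistMap P' Q').homA a v n)
    (fun b v n => ℬ.isMultiplierHopf.left_extend_comul ℬ.hasLocalUnits
      ((twistMap P Q).homB.comp φ.1 φ.2.1) ((twistMap P' Q').homB.comp χ.1 χ.2.1) b v n)

/-- The map `a ⋈ b ↦ Δ^cop(a)(φ ⊗ χ)Δ(b)` is multiplicative, if the pairings that define the two
inner commutation relations agree. -/
theorem comulMap_mul {P Q P' Q' : Pairing 𝒜 ℬ} (φ χ : ℬ.hopfAut) (h : Q.twist φ = P'.twist χ)
    (x y : A ⊗[K] B) :
    (twistMap P Q).comulMap (twistMap P' Q') φ.2.1 χ.2.1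
        (𝒜.toNUAlgebra.flip ∘ₗ 𝒜.comul) ℬ.comul
        ((twistMap (P.twist φ) (Q'.twist χ)).algebra.mul x y)
      = (twistMap P Q).comulMap (twistMap P' Q') φ.2.1 χ.2.1
          (𝒜.toNUAlgebra.flip ∘ₗ 𝒜.comul) ℬ.comul x *
        (twistMap P Q).comulMap (twistMap P' Q') φ.2.1 χ.2.1
          (𝒜.toNUAlgebra.flip ∘ₗ 𝒜.comul) ℬ.comul y := by
  refine TwistMap.comulMap_mul _ _ φ.2.1 χ.2.1 _ 𝒜.isMultiplierHopf_cop ℬ.isMultiplierHopf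
    (fun b a => ?_) x y
  refine M.ext_left ((twistMap P Q).nondegenerate.tensor (twistMap P' Q').nondegenerate)
    fun z => ?_
  have h1 := covariant_iff.1 (covariant_multA_multB (P := P) (Q' := Q') φ χ h) b a z
  rw [M.left_mul]
  refine h1.trans ?_
  change _ = M.left (TwistMap.comulMap _ _ _ _ _ _ (T (P.twist φ) (Q'.twist χ) (b ⊗ₜ a))) z
  generalize T (P.twist φ) (Q'.twist χ) (b ⊗ₜ a) = w
  induction w with
  | zero => simp
  | add x y hx hy => simp only [map_add, LinearMap.add_apply, M.left_add, hx, hy]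
  | tmul u v =>
    rw [mulMap_tmul, TwistMap.comulMap_tmul, M.left_mul]
    rfl

end Pairing

end

/-! ### The double as a regular multiplier Hopf algebra -/

section

open RegularMHA RegularMHA.AutPair

variable {K : Type*} {A : Type*} {B : Type*} [Field K] [AddCommGroup A] [Module K A]
  [AddCommGroup B] [Module K B] {𝒜 : RegularMHA K A} {ℬ : RegularMHA K B} (P : Pairing 𝒜 ℬ)

namespace Pairing

/-- The twist map of the component `A ⋈ B_p` of the double. -/
def component (p : ℬ.AutPair) : TwistMap 𝒜.toNUAlgebra ℬ.toNUAlgebra :=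
  twistMap (P.twist p.fst) (P.twist p.snd)

/-- The pairings of `A ⋈ B_(p * q)`, written as twists of the first pairing of `A ⋈ B_p` and of the
second pairing of `A ⋈ B_q`. -/
theorem component_mul (p q : ℬ.AutPair) : P.component (p * q)
    = twistMap ((P.twist p.fst).twist q.fst) ((P.twist q.snd).twist (conjSnd p q)) := by
  rw [component, snd_mul, fst_mul]
  rfl

/-- The component `Δ_(p,q)(a ⋈ b) = Δ^cop(a)(γ ⊗ γ⁻¹βγ)Δ(b)` of the comultiplication of the double,
for `p = (α, β)` and `q = (γ, δ)`. -/
def doubleComul (p q : ℬ.AutPair) :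
    A ⊗[K] B →ₗ[K] ((P.component p).algebra.tensor (P.component q).algebra).M :=
  (P.component p).comulMap (P.component q) q.fst.2.1 (conjSnd p q).2.1
    (𝒜.toNUAlgebra.flip ∘ₗ 𝒜.comul) ℬ.comul

/-- For `p = (α, β)` and `q = (γ, δ)` the inner pairings agree since `γ(γ⁻¹βγ) = βγ`. -/
theorem doubleComul_mul (p q : ℬ.AutPair) (x y : A ⊗[K] B) :
    P.doubleComul p q ((P.component (p * q)).algebra.mul x y)
      = P.doubleComul p q x * P.doubleComul p q y := by
  rw [component_mul]
  refine comulMap_mul (P := P.twist p.fst) (Q' := P.twist q.snd) q.fst (conjSnd p q) ?_ x y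
  rw [twist_twist, twist_twist, fst_mul_conjSnd]

/-- The map `x ⊗ y ↦ Δ_(p,q)(x)(1 ⊗ y)`. -/
def doubleT₁ (p q : ℬ.AutPair) : (A ⊗[K] B) ⊗[K] (A ⊗[K] B) ≃ₗ[K] (A ⊗[K] B) ⊗[K] (A ⊗[K] B) :=
  (P.component q).compT₁ 𝒜.isMultiplierHopf_cop ℬ.isMultiplierHopf q.fst.1 (conjSnd p q).2.1

/-- The map `x ⊗ y ↦ (x ⊗ 1)Δ_(p,q)(y)`. -/
def doubleT₂ (p q : ℬ.AutPair) : (A ⊗[K] B) ⊗[K] (A ⊗[K] B) ≃ₗ[K] (A ⊗[K] B) ⊗[K] (A ⊗[K] B) :=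
  (P.component p).compT₂ 𝒜.isMultiplierHopf_cop ℬ.isMultiplierHopf q.fst.2.1 (conjSnd p q).1

theorem nondegenerate_component (p : ℬ.AutPair) : (P.component p).algebra.Nondegenerate :=
  (P.component p).nondegenerate

/-- The algebra `D(A, B) = ⨁ A ⋈ B_p`. -/
abbrev doubleAlgebra : NUAlgebra K (ℬ.AutPair →₀ A ⊗[K] B) :=
  glueAlgebra fun p => (P.component p).algebra

theorem double_comul_mul (x y : ℬ.AutPair →₀ A ⊗[K] B) :
    glueComul P.doubleComul (P.doubleAlgebra.mul x y)
      = glueComul P.doubleComul x * glueComul P.doubleComul y :=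
  comul_mul_of_components (isComponent_glueComul P.doubleComul)
    (fun _ _ _ x h => isComponent_glueComul_ne P.doubleComul h x) P.doubleComul_mul x y

theorem isMultiplierHopf_double :
    ∃ h : IsMultiplierHopf P.doubleAlgebra (glueComul P.doubleComul),
      (∀ p q z, h.T1 (incl K _ (p * q) q z) = incl K _ p q (P.doubleT₁ p q z)) ∧
      (∀ p q z, h.T2 (incl K _ p (p * q) z) = incl K _ p q (P.doubleT₂ p q z)) := by
  refine isMultiplierHopf_glue P.nondegenerate_component (isComponent_glueComul P.doubleComul)
    (fun _ _ _ x h => isComponent_glueComul_ne P.doubleComul h x) P.double_comul_mul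
    P.doubleT₁ P.doubleT₂
    (fun p q x y v n => TwistMap.compT₁_spec _ _ _ _ _ _ x y v n)
    (fun p q x y v n => TwistMap.compT₂_spec _ _ _ _ _ _ x y v n)
    (fun p q r z => TwistMap.compT_coassoc _ _ _ _ _ r.fst.2.1 (fun a z => (r.fst.2.2 a z).1) _ _ _
      (conjSnd p (q * r)).2.1 (fun a z => ((conjSnd p (q * r)).2.2 a z).1) (fun b => rfl)
      (fun b => ?_) (fun b => ?_) z)
  · exact congrArg (fun α : ℬ.hopfAut => α.1 b) (conjSnd_mul_fst p q r)
  · exact congrArg (fun α : ℬ.hopfAut => α.1 b) (conjSnd_mul p q r)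

theorem isMultiplierHopf_double_cop :
    IsMultiplierHopf P.doubleAlgebra (P.doubleAlgebra.flip ∘ₗ glueComul P.doubleComul) := by
  refine isMultiplierHopf_glue_cop P.nondegenerate_component (isComponent_glueComul P.doubleComul)
    (fun _ _ _ x h => isComponent_glueComul_ne P.doubleComul h x) P.double_comul_mul
    (Δc' := fun p q => (P.component p).comulMap (P.component q) (conjSnd q p).2.1 p.fst.2.1
      𝒜.comul (ℬ.toNUAlgebra.flip ∘ₗ ℬ.comul))
    (fun p q x z => TwistMap.left_comulMap_flip _ _ _ _ 𝒜.cop_cop (fun _ => rfl) x z)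
    (fun p q x z => TwistMap.right_comulMap_flip _ _ _ _ 𝒜.cop_cop (fun _ => rfl) x z)
    (fun p q => (P.component q).compT₁ 𝒜.isMultiplierHopf ℬ.isMultiplierHopf_cop
      (conjSnd q p).1 p.fst.2.1)
    (fun p q => (P.component p).compT₂ 𝒜.isMultiplierHopf ℬ.isMultiplierHopf_cop
      (conjSnd q p).2.1 p.fst.1)
    (fun p q x y v n => TwistMap.compT₁_spec _ _ _ _ _ _ x y v n)
    (fun p q x y v n => TwistMap.compT₂_spec _ _ _ _ _ _ x y v n)
    (fun p q r z => TwistMap.compT_coassoc _ _ _ _ _ (conjSnd r (q * p)).2.1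
      (ℬ.hopfAut_cop _) _ _ _ p.fst.2.1 (ℬ.hopfAut_cop _) (fun b => ?_)
      (fun b => ?_) (fun b => rfl) z)
  · exact congrArg (fun α : ℬ.hopfAut => α.1 b) (conjSnd_mul r q p).symm
  · exact congrArg (fun α : ℬ.hopfAut => α.1 b) (conjSnd_mul_fst r q p).symm

/-- The multiplier Hopf algebra `D(A, B)`. -/
def double : RegularMHA K (ℬ.AutPair →₀ A ⊗[K] B) where
  toNUAlgebra := P.doubleAlgebra
  comul := glueComul P.doubleComul
  isMultiplierHopf := P.isMultiplierHopf_double.1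
  isMultiplierHopf_cop := P.isMultiplierHopf_double_cop

theorem double_T₁ (p q : ℬ.AutPair) (z : (A ⊗[K] B) ⊗[K] (A ⊗[K] B)) :
    P.double.T₁ (incl K _ (p * q) q z) = incl K _ p q (P.doubleT₁ p q z) :=
  P.isMultiplierHopf_double.2.1 p q z

theorem double_T₂ (p q : ℬ.AutPair) (z : (A ⊗[K] B) ⊗[K] (A ⊗[K] B)) :
    P.double.T₂ (incl K _ p (p * q) z) = incl K _ p q (P.doubleT₂ p q z) :=
  P.isMultiplierHopf_double.2.2 p q z

end Pairing

end

/-! ### Images of multipliers, counit and antipode identities -/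

section

open RegularMHA RegularMHA.AutPair

section Images

variable {K : Type*} {A : Type*} {B : Type*} [Field K] [AddCommGroup A] [Module K A]
  [AddCommGroup B] [Module K B]

theorem tensorTensorTensorComm_act_left {f : A →ₗ[K] A →ₗ[K] A}
    {l l' : A →ₗ[K] A ⊗[K] B →ₗ[K] A ⊗[K] B} (hl : ∀ a, l a = (f a).rTensor B)
    (hl' : ∀ a, l' a = (f a).rTensor B) (x : A ⊗[K] A) (w : (A ⊗[K] B) ⊗[K] (A ⊗[K] B)) :
    TensorProduct.tensorTensorTensorComm K A B A B (TensorProduct.map₂ l l' x w)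
      = (TensorProduct.map₂ f f x).rTensor (B ⊗[K] B)
        (TensorProduct.tensorTensorTensorComm K A B A B w) := by
  refine LinearMap.congr_fun (g := (TensorProduct.map₂ f f x).rTensor (B ⊗[K] B) ∘ₗ
    (TensorProduct.tensorTensorTensorComm K A B A B).toLinearMap)
    (f := (TensorProduct.tensorTensorTensorComm K A B A B).toLinearMap ∘ₗ
      TensorProduct.map₂ l l' x) (TensorProduct.ext_fourfold' fun a b a' b' => ?_) w
  simp only [LinearMap.comp_apply, LinearEquiv.coe_coe, TensorProduct.tensorTensorTensorComm_tmul,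
    LinearMap.rTensor_tmul]
  induction x with
  | zero => simp
  | add x y hx hy => simp only [map_add, LinearMap.add_apply, TensorProduct.add_tmul, hx, hy]
  | tmul u v => simp [hl, hl']

theorem tensorTensorTensorComm_act_right {f f' : B →ₗ[K] B →ₗ[K] B}
    {r r' : B →ₗ[K] A ⊗[K] B →ₗ[K] A ⊗[K] B} (hr : ∀ b, r b = (f b).lTensor A)
    (hr' : ∀ b, r' b = (f' b).lTensor A) (x : B ⊗[K] B) (w : (A ⊗[K] B) ⊗[K] (A ⊗[K] B)) :
    TensorProduct.tensorTensorTensorComm K A B A B (TensorProduct.map₂ r r' x w)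
      = (TensorProduct.map₂ f f' x).lTensor (A ⊗[K] A)
        (TensorProduct.tensorTensorTensorComm K A B A B w) := by
  refine LinearMap.congr_fun (g := (TensorProduct.map₂ f f' x).lTensor (A ⊗[K] A) ∘ₗ
    (TensorProduct.tensorTensorTensorComm K A B A B).toLinearMap)
    (f := (TensorProduct.tensorTensorTensorComm K A B A B).toLinearMap ∘ₗ
      TensorProduct.map₂ r r' x) (TensorProduct.ext_fourfold' fun a b a' b' => ?_) w
  simp only [LinearMap.comp_apply, LinearEquiv.coe_coe, TensorProduct.tensorTensorTensorComm_tmul,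
    LinearMap.lTensor_tmul]
  induction x with
  | zero => simp
  | add x y hx hy => simp only [map_add, LinearMap.add_apply, TensorProduct.tmul_add, hx, hy]
  | tmul u v => simp [hr, hr']

variable {R : NUAlgebra K A} {S : NUAlgebra K B}

theorem TwistMap.isImageA_multA (X Y : TwistMap R S) (m : (R.tensor R).M) :
    IsImageA (𝒜 := R) m (X.multA Y m) := by
  have hRR := (X.unitsA.tensor X.unitsA).nondegenerate
  refine LinearMap.congr_fun (f := (TensorProduct.tensorTensorTensorComm K A B A B).toLinearMap ∘ₗ
    M.left (X.multA Y m)) (g := (M.left m).rTensor (B ⊗[K] B) ∘ₗ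
      (TensorProduct.tensorTensorTensorComm K A B A B).toLinearMap)
    ((X.homA.tensor Y.homA).isModule_l.ext_act fun x w => ?_)
  have h := tensorTensorTensorComm_act_left (f := R.mul) (l := X.lA) (l' := Y.lA) (fun _ => rfl)
    (fun _ => rfl)
  have h0 : M.left (X.multA Y m) (TensorProduct.map₂ X.lA Y.lA x w)
      = TensorProduct.map₂ X.lA Y.lA (M.left m x) w :=
    (X.homA.tensor Y.homA).left_extend (X.unitsA.tensor X.unitsA) m x w
  change TensorProduct.tensorTensorTensorComm K A B A B
      (M.left (X.multA Y m) (TensorProduct.map₂ X.lA Y.lA x w))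
    = (M.left m).rTensor (B ⊗[K] B)
      (TensorProduct.tensorTensorTensorComm K A B A B (TensorProduct.map₂ X.lA Y.lA x w))
  rw [h0, h, h, ← LinearMap.rTensor_comp_apply]
  congr 2
  exact LinearMap.ext fun y => (M.left_mul_right hRR m x y).symm

theorem TwistMap.isImageB_multB (X Y : TwistMap R S) {φ χ : B ≃ₗ[K] B}
    (hφ : ∀ x y, φ (S.mul x y) = S.mul (φ x) (φ y)) (hχ : ∀ x y, χ (S.mul x y) = S.mul (χ x) (χ y))
    (m : (S.tensor S).M) :
    IsImageB (ℬ := S) (congr (TensorProduct.congr φ χ) (congr_mul S φ χ hφ hχ) m)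
      (X.multB Y hφ hχ m) := by
  have hSS := (X.unitsB.tensor X.unitsB).nondegenerate
  refine LinearMap.congr_fun (f := (TensorProduct.tensorTensorTensorComm K A B A B).toLinearMap ∘ₗ
    M.right (X.multB Y hφ hχ m)) (g := (M.right (congr (TensorProduct.congr φ χ)
      (congr_mul S φ χ hφ hχ) m)).lTensor (A ⊗[K] A) ∘ₗ
      (TensorProduct.tensorTensorTensorComm K A B A B).toLinearMap)
    (((X.homB.comp φ hφ).tensor (Y.homB.comp χ hχ)).isModule_r.ext_act fun x w => ?_)
  have h := tensorTensorTensorComm_act_right (f := S.mul.flip ∘ₗ φ.toLinearMap)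
    (f' := S.mul.flip ∘ₗ χ.toLinearMap) (r := X.rB ∘ₗ φ.toLinearMap) (r' := Y.rB ∘ₗ χ.toLinearMap)
    (fun _ => rfl) (fun _ => rfl)
  have h2 : ∀ x y, TensorProduct.map₂ (S.mul.flip ∘ₗ φ.toLinearMap) (S.mul.flip ∘ₗ χ.toLinearMap) x y
      = (S.tensor S).mul y (TensorProduct.congr φ χ x) := by
    intro x y
    induction x with
    | zero => simp
    | add x y hx hy => simp only [map_add, LinearMap.add_apply, hx, hy]
    | tmul u v =>
      induction y with
      | zero => simp
      | add x y hx hy => simp only [map_add, LinearMap.add_apply, hx, hy]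
      | tmul u v => simp
  have h0 : M.right (X.multB Y hφ hχ m)
      (TensorProduct.map₂ (X.rB ∘ₗ φ.toLinearMap) (Y.rB ∘ₗ χ.toLinearMap) x w)
      = TensorProduct.map₂ (X.rB ∘ₗ φ.toLinearMap) (Y.rB ∘ₗ χ.toLinearMap) (M.right m x) w :=
    ((X.homB.comp φ hφ).tensor (Y.homB.comp χ hχ)).right_extend (X.unitsB.tensor X.unitsB) m x w
  change TensorProduct.tensorTensorTensorComm K A B A B (M.right (X.multB Y hφ hχ m)
      (TensorProduct.map₂ (X.rB ∘ₗ φ.toLinearMap) (Y.rB ∘ₗ χ.toLinearMap) x w))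
    = (M.right (congr (TensorProduct.congr φ χ) (congr_mul S φ χ hφ hχ) m)).lTensor (A ⊗[K] A)
      (TensorProduct.tensorTensorTensorComm K A B A B
        (TensorProduct.map₂ (X.rB ∘ₗ φ.toLinearMap) (Y.rB ∘ₗ χ.toLinearMap) x w))
  rw [h0, h, h, ← LinearMap.lTensor_comp_apply]
  congr 2
  refine LinearMap.ext fun y => ?_
  rw [LinearMap.comp_apply, h2, h2, M.right_mul_left hSS]
  congr 1
  change _ = TensorProduct.congr φ χ (M.right m ((TensorProduct.congr φ χ).symm _))
  rw [LinearEquiv.symm_apply_apply]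

end Images

section Evaluation

variable {K : Type*} [Field K] {A B N Q : Type*} [AddCommGroup A] [Module K A]
  [AddCommGroup B] [Module K B] [AddCommGroup N] [Module K N] [AddCommGroup Q] [Module K Q]
  {R : NUAlgebra K A} {S : NUAlgebra K B} {ΔA : A →ₗ[K] (R.tensor R).M}
  {ΔB : B →ₗ[K] (S.tensor S).M} (hA : IsMultiplierHopf R ΔA) (hB : IsMultiplierHopf S ΔB)
  (uA : R.HasLocalUnits) (uB : S.HasLocalUnits)
  {π : A →ₗ[K] N →ₗ[K] N} {θ : B →ₗ[K] N →ₗ[K] N}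

/-- An operator that acts through the two legs of `leftCan` separately is computed one leg at a time. -/
theorem lift_leftCan (φ : B ≃ₗ[K] B) (hπ : R.IsModule π) (hθ : S.IsModule θ)
    {f : A →ₗ[K] N →ₗ[K] N} {g : B →ₗ[K] N →ₗ[K] Q} {F : A ⊗[K] B →ₗ[K] N →ₗ[K] Q}
    (hF : ∀ a b n, F (a ⊗ₜ b) n = g b (f a n)) (a : A) (b : B) (n : N) :
    TensorProduct.lift F (leftCan hA hB uA uB φ hπ hθ ((a ⊗ₜ b) ⊗ₜ n))
      = TensorProduct.lift ((g ∘ₗ φ.toLinearMap).compl₂ (TensorProduct.lift f ∘ₗ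
          (hA.canL uA hπ).toLinearMap ∘ₗ TensorProduct.mk K A N a)) (hB.canL uB hθ (b ⊗ₜ n)) := by
  rw [leftCan, LinearEquiv.trans_apply, LinearEquiv.trans_apply, legB_tmul]
  generalize hB.canL uB hθ (b ⊗ₜ n) = z
  induction z with
  | zero => simp
  | add x y hx hy => simp only [map_add, TensorProduct.tmul_add, hx, hy]
  | tmul b' n' =>
    rw [TensorProduct.assoc_symm_tmul, legMid_tmul, legA_tmul, TensorProduct.lift.tmul]
    change _ = g (φ b') (TensorProduct.lift f (hA.canL uA hπ (a ⊗ₜ n')))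
    generalize hA.canL uA hπ (a ⊗ₜ n') = z
    induction z with
    | zero => simp
    | add x y hx hy => simp only [map_add, TensorProduct.add_tmul, hx, hy]
    | tmul a' n'' => simp [hF]

theorem sliceL_eq_lift {V : Type*} [AddCommGroup V] [Module K V] (f : V →ₗ[K] K) :
    sliceL N f = TensorProduct.lift (f.smulRight (LinearMap.id : N →ₗ[K] N)) :=
  TensorProduct.ext' fun v n => by simp

/-- The counit property of the tensor product of the counits. -/
theorem sliceL_leftCan {εA : A →ₗ[K] K} {εB : B →ₗ[K] K} (hεA : εA = hA.counit)
    (hεB : εB = hB.counit) {φ : B ≃ₗ[K] B} (hφ : ∀ b, εB (φ b) = εB b) (hπ : R.IsModule π)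
    (hθ : S.IsModule θ) {ε : A ⊗[K] B →ₗ[K] K} (hε : ∀ a b, ε (a ⊗ₜ b) = εA a * εB b)
    (a : A) (b : B) (n : N) :
    sliceL N ε (leftCan hA hB uA uB φ hπ hθ ((a ⊗ₜ b) ⊗ₜ n)) = π a (θ b n) := by
  rw [sliceL_eq_lift, lift_leftCan hA hB uA uB φ hπ hθ (f := εA.smulRight LinearMap.id)
    (g := εB.smulRight LinearMap.id) (fun a b n => by simp [hε, smul_smul])]
  have h1 : TensorProduct.lift (εA.smulRight (LinearMap.id : N →ₗ[K] N)) ∘ₗ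
      (hA.canL uA hπ).toLinearMap ∘ₗ TensorProduct.mk K A N a = π a := LinearMap.ext fun n => by
    rw [← sliceL_eq_lift, hεA]
    exact hA.counit_canL uA hπ a n
  rw [h1, ← hB.counit_canL uB hθ b n, ← hεB]
  generalize hB.canL uB hθ (b ⊗ₜ n) = z
  induction z with
  | zero => simp
  | add x y hx hy => simp only [map_add, hx, hy]
  | tmul u v => simp [hφ]

/-- The antipode property of `a ⊗ b ↦ θ(S_B(b))π(S_A(a))`. -/
theorem lift_antipode_leftCan {SA : A →ₗ[K] A} {SB : B →ₗ[K] B}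
    (hSA : ∀ a b, TensorProduct.lift R.mul (SA.rTensor A (hA.T1 (a ⊗ₜ b))) = hA.counit a • b)
    (hSB : ∀ a b, TensorProduct.lift S.mul (SB.rTensor B (hB.T1 (a ⊗ₜ b))) = hB.counit a • b)
    (φ : B ≃ₗ[K] B) (hπ : R.IsModule π) (hθ : S.IsModule θ) {F : A ⊗[K] B →ₗ[K] N →ₗ[K] N}
    (hF : ∀ a b n, F (a ⊗ₜ φ b) n = θ (SB b) (π (SA a) n)) (a : A) (b : B) (n : N) :
    TensorProduct.lift F (leftCan hA hB uA uB φ hπ hθ ((a ⊗ₜ b) ⊗ₜ n))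
      = (hA.counit a * hB.counit b) • n := by
  rw [lift_leftCan hA hB uA uB φ hπ hθ (f := π ∘ₗ SA) (g := θ ∘ₗ SB ∘ₗ φ.symm.toLinearMap)
    (fun a b n => by simpa using hF a (φ.symm b) n)]
  have h1 : TensorProduct.lift (π ∘ₗ SA) ∘ₗ (hA.canL uA hπ).toLinearMap ∘ₗ
      TensorProduct.mk K A N a = hA.counit a • LinearMap.id := LinearMap.ext fun n =>
    hA.lift_canL uA hπ hSA a n
  rw [h1, mul_smul, ← hB.lift_canL uB hθ hSB b n]
  generalize hB.canL uB hθ (b ⊗ₜ n) = z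
  induction z with
  | zero => simp
  | add x y hx hy => simp only [map_add, smul_add, hx, hy]
  | tmul u v => simp

end Evaluation

section Graded

variable {K : Type*} [Field K] {G V : Type*} [AddCommGroup V] [Module K V]

theorem isInternal_range_lsingle : open Classical in
    DirectSum.IsInternal fun p : G => LinearMap.range (Finsupp.lsingle p : V →ₗ[K] G →₀ V) := by
  classical
  refine DirectSum.isInternal_submodule_of_iSupIndep_of_iSup_eq_top (fun p => ?_)
    Finsupp.iSup_lsingle_range
  have h := Finsupp.disjoint_lsingle_lsingle (R := K) (M := V) {p} {q | q ≠ p} (by simp)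
  simpa using h

theorem range_mapIncl_lsingle (p q : G) :
    LinearMap.range (TensorProduct.mapIncl (LinearMap.range (Finsupp.lsingle p : V →ₗ[K] G →₀ V))
      (LinearMap.range (Finsupp.lsingle q : V →ₗ[K] G →₀ V))) = LinearMap.range (incl K V p q) := by
  rw [TensorProduct.range_mapIncl, TensorProduct.range_map]

theorem map_range_incl {p q p' q' : G} {T : (G →₀ V) ⊗[K] (G →₀ V) ≃ₗ[K] (G →₀ V) ⊗[K] (G →₀ V)}
    {t : V ⊗[K] V ≃ₗ[K] V ⊗[K] V} (h : ∀ z, T (incl K V p q z) = incl K V p' q' (t z)) :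
    Submodule.map T.toLinearMap (LinearMap.range (incl K V p q))
      = LinearMap.range (incl K V p' q') := by
  rw [← LinearMap.range_comp, show T.toLinearMap ∘ₗ incl K V p q
    = incl K V p' q' ∘ₗ t.toLinearMap from LinearMap.ext h, LinearMap.range_comp, LinearEquiv.range,
    Submodule.map_top]

end Graded

end

/-! ### The structure maps of the double -/

section

open RegularMHA RegularMHA.AutPair

section Glue

variable {K : Type*} [Field K] {G V : Type*} [AddCommGroup V] [Module K V] {X : G → NUAlgebra K V}

theorem sliceL_incl (ε : (G →₀ V) →ₗ[K] K) (p q : G) (z : V ⊗[K] V) :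
    sliceL _ ε (incl K V p q z) = Finsupp.single q (sliceL V (ε ∘ₗ Finsupp.lsingle p) z) := by
  induction z with
  | zero => simp
  | add x y hx hy => simp only [map_add, Finsupp.single_add, hx, hy]
  | tmul x y => simp

theorem lift_mul_incl (p : G) (z : V ⊗[K] V) :
    TensorProduct.lift (glueAlgebra X).mul (incl K V p p z)
      = Finsupp.single p (TensorProduct.lift (X p).mul z) := by
  induction z with
  | zero => simp
  | add x y hx hy => simp only [map_add, Finsupp.single_add, hx, hy]
  | tmul x y => simp [glueAlgebra_mul_single]

theorem lift_mul_incl_ne {p q : G} (h : p ≠ q) (z : V ⊗[K] V) :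
    TensorProduct.lift (glueAlgebra X).mul (incl K V p q z) = 0 := by
  induction z with
  | zero => simp
  | add x y hx hy => simp only [map_add, hx, hy, add_zero]
  | tmul x y => simp [glueAlgebra_mul_single_ne X h]

end Glue

namespace Pairing

variable {K : Type*} {A : Type*} {B : Type*} [Field K] [AddCommGroup A] [Module K A]
  [AddCommGroup B] [Module K B] {𝒜 : RegularMHA K A} {ℬ : RegularMHA K B} (P : Pairing 𝒜 ℬ)

theorem double_isCograded [Nontrivial A] [Nontrivial B] :
    P.double.IsCograded (fun p : ℬ.AutPair =>
      LinearMap.range (Finsupp.lsingle p : A ⊗[K] B →ₗ[K] ℬ.AutPair →₀ A ⊗[K] B)) where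
  nontrivial p h := by
    obtain ⟨x, hx⟩ := exists_ne (0 : A ⊗[K] B)
    have h1 : Finsupp.single p x ∈ (⊥ : Submodule K (ℬ.AutPair →₀ A ⊗[K] B)) := h ▸ ⟨x, rfl⟩
    exact hx (by simpa using h1)
  mul_mem := by
    rintro p _ ⟨x, rfl⟩ _ ⟨y, rfl⟩
    exact ⟨_, (glueAlgebra_mul_single _ p x y).symm⟩
  isInternal := isInternal_range_lsingle
  mul_eq_zero := by
    rintro p q h _ ⟨x, rfl⟩ _ ⟨y, rfl⟩
    exact glueAlgebra_mul_single_ne _ h x y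
  comul_right p q := by
    rw [range_mapIncl_lsingle, range_mapIncl_lsingle]
    exact map_range_incl (P.double_T₁ p q)
  comul_left p q := by
    rw [range_mapIncl_lsingle, range_mapIncl_lsingle]
    exact map_range_incl (P.double_T₂ p q)

theorem sliceL_doubleT₁ (q : ℬ.AutPair) (x y : A ⊗[K] B) :
    sliceL _ (LinearMap.mul' K K ∘ₗ TensorProduct.map 𝒜.counit ℬ.counit) (P.doubleT₁ 1 q (x ⊗ₜ y))
      = (P.component q).algebra.mul x y := by
  induction x with
  | zero => simp
  | add x x' hx hx' => simp only [TensorProduct.add_tmul, map_add, LinearMap.add_apply, hx, hx']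
  | tmul a b =>
    refine (sliceL_leftCan _ _ _ _ 𝒜.counit_eq_cop ℬ.counit_eq_isMultiplierHopf
      (ℬ.counit_hopfAut q.fst) _ _ (fun a b => by simp) a b y).trans ?_
    rw [TwistMap.mul_tmul]
    have h : conjSnd 1 q = 1 := by
      change q.fst⁻¹ * 1 * q.fst = 1
      group
    rw [LinearMap.comp_apply, h]
    rfl

theorem double_counit : P.double.counit
    = (LinearMap.mul' K K ∘ₗ TensorProduct.map 𝒜.counit ℬ.counit) ∘ₗ Finsupp.lapply 1 := by
  suffices key : sliceL _ ((LinearMap.mul' K K ∘ₗ TensorProduct.map 𝒜.counit ℬ.counit) ∘ₗ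
      Finsupp.lapply 1) ∘ₗ P.double.T₁.toLinearMap = TensorProduct.lift P.double.mul from
    P.double.counit_eq fun x y => LinearMap.congr_fun key (x ⊗ₜ y)
  refine ext_incl fun r q x y => ?_
  obtain ⟨p, rfl⟩ : ∃ p, r = p * q := ⟨r * q⁻¹, by simp⟩
  have h1 := P.double_T₁ p q (x ⊗ₜ y)
  rw [TensorProduct.map_tmul, Finsupp.lsingle_apply, Finsupp.lsingle_apply] at h1
  rw [LinearMap.comp_apply, LinearEquiv.coe_coe, h1, sliceL_incl, TensorProduct.lift.tmul,
    LinearMap.comp_assoc]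
  by_cases hp : p = 1
  · subst hp
    have h2 : Finsupp.lapply (1 : ℬ.AutPair) ∘ₗ Finsupp.lsingle 1
        = (LinearMap.id : A ⊗[K] B →ₗ[K] A ⊗[K] B) := LinearMap.ext fun z => by simp
    rw [one_mul, h2, LinearMap.comp_id, sliceL_doubleT₁]
    exact (glueAlgebra_mul_single (fun p => (P.component p).algebra) q x y).symm
  · refine Eq.trans ?_ (glueAlgebra_mul_single_ne _ (by simpa using hp) x y).symm
    have h2 : Finsupp.lapply (R := K) 1 ∘ₗ Finsupp.lsingle p = (0 : A ⊗[K] B →ₗ[K] A ⊗[K] B) :=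
      LinearMap.ext fun z => by simp [Finsupp.single_eq_of_ne (Ne.symm hp)]
    rw [h2, LinearMap.comp_zero]
    simp [sliceL]

/-- The component `A ⋈ B_p → A ⋈ B_p⁻¹` of the antipode, `a ⋈ b ↦ T(αβS(b) ⊗ S⁻¹(a))` for
`p = (α, β)`. -/
def doubleAntipode (p : ℬ.AutPair) : A ⊗[K] B →ₗ[K] A ⊗[K] B :=
  (P.component p⁻¹).T.toLinearMap ∘ₗ
    TensorProduct.map (p.fst.1.toLinearMap ∘ₗ p.snd.1.toLinearMap ∘ₗ ℬ.antipode.toLinearMap)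
      𝒜.antipode.symm.toLinearMap ∘ₗ (TensorProduct.comm K A B).toLinearMap

theorem doubleAntipode_tmul (p : ℬ.AutPair) (a : A) (b : B) : P.doubleAntipode p (a ⊗ₜ b)
    = (P.component p⁻¹).T (p.fst.1 (p.snd.1 (ℬ.antipode b)) ⊗ₜ 𝒜.antipode.symm a) := rfl

/-- The identity `m((S ⊗ ι)(Δ(x)(1 ⊗ y))) = ε(x)y`, for the component of `Δ(x)` at `(p, p⁻¹)`. -/
theorem lift_doubleAntipode (p : ℬ.AutPair) (x y : A ⊗[K] B) :
    TensorProduct.lift (P.component p⁻¹).algebra.mul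
        ((P.doubleAntipode p).rTensor _ (P.doubleT₁ p p⁻¹ (x ⊗ₜ y)))
      = LinearMap.mul' K K (TensorProduct.map 𝒜.counit ℬ.counit x) • y := by
  have h1 : ∀ z, TensorProduct.lift (P.component p⁻¹).algebra.mul
      ((P.doubleAntipode p).rTensor _ z)
      = TensorProduct.lift ((P.component p⁻¹).algebra.mul ∘ₗ P.doubleAntipode p) z := by
    intro z
    induction z with
    | zero => simp
    | add x y hx hy => simp only [map_add, hx, hy]
    | tmul u v => simp
  rw [h1]
  induction x with
  | zero => simp
  | add x y hx hy => simp only [TensorProduct.add_tmul, map_add, add_smul, hx, hy]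
  | tmul a b =>
    rw [TensorProduct.map_tmul, LinearMap.mul'_apply, 𝒜.counit_eq_cop,
      ℬ.counit_eq_isMultiplierHopf]
    refine lift_antipode_leftCan _ _ _ _ 𝒜.antipode_symm_left (SB := ℬ.antipode.toLinearMap)
      (fun a b => ?_) _ _ _ (fun a b n => ?_) a b y
    · rw [← ℬ.counit_eq_isMultiplierHopf]
      exact ℬ.isAntipode_antipode.antipode_left a b
    · have h2 : p.fst.1 (p.snd.1 (ℬ.antipode (p⁻¹.fst.1 b)))
          = (conjSnd p p⁻¹).1 (ℬ.antipode b) := by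
        rw [ℬ.antipode_hopfAut]
        have h3 : conjSnd p p⁻¹ = p.fst * p.snd * p⁻¹.fst := by
          change p.fst⁻¹⁻¹ * p.snd * p.fst⁻¹ = p.fst * p.snd * p.fst⁻¹
          rw [inv_inv]
        rw [h3]
        rfl
      rw [LinearMap.comp_apply, doubleAntipode_tmul, h2]
      exact ((P.component p⁻¹).lB_lA _ _ n).symm

theorem double_antipode (x : ℬ.AutPair →₀ A ⊗[K] B) : P.double.antipode x
    = Finsupp.lsum K (fun p => Finsupp.lsingle p⁻¹ ∘ₗ P.doubleAntipode p) x := by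
  suffices key : TensorProduct.lift P.double.mul ∘ₗ (Finsupp.lsum K fun p =>
      Finsupp.lsingle p⁻¹ ∘ₗ P.doubleAntipode p).rTensor _ ∘ₗ P.double.T₁.toLinearMap
        = TensorProduct.lift (P.double.counit.smulRight LinearMap.id) from
    P.double.antipode_eq (fun x y => LinearMap.congr_fun key (x ⊗ₜ y)) x
  refine ext_incl fun r q x y => ?_
  obtain ⟨p, rfl⟩ : ∃ p, r = p * q := ⟨r * q⁻¹, by simp⟩
  have h1 := P.double_T₁ p q (x ⊗ₜ y)
  rw [TensorProduct.map_tmul, Finsupp.lsingle_apply, Finsupp.lsingle_apply] at h1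
  have h2 : ∀ z, (Finsupp.lsum K fun p => Finsupp.lsingle p⁻¹ ∘ₗ P.doubleAntipode p).rTensor _
      (incl K _ p q z) = incl K _ p⁻¹ q ((P.doubleAntipode p).rTensor _ z) := by
    intro z
    induction z with
    | zero => simp
    | add x y hx hy => simp only [map_add, hx, hy]
    | tmul u v => simp
  rw [LinearMap.comp_apply, LinearMap.comp_apply, LinearEquiv.coe_coe, h1, h2, double_counit]
  by_cases hp : p⁻¹ = q
  · subst hp
    refine (lift_mul_incl (X := fun p => (P.component p).algebra) _ _).trans ?_
    rw [lift_doubleAntipode]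
    simp
  · refine (lift_mul_incl_ne (X := fun p => (P.component p).algebra) hp _).trans ?_
    have hpq : p * q ≠ 1 := fun h => hp (inv_eq_of_mul_eq_one_right h)
    simp [Finsupp.single_eq_of_ne (Ne.symm hpq)]

end Pairing

end

end MHA

end

open scoped TensorProduct in
/-- `D(A, B) = ⨁ A ⋈ B_(α,β)` is the space of finitely supported functions from the group of pairs
`p = (α, β)` to `A ⊗ B`; `Finsupp.single p (a ⊗ₜ b)` is the element `a ⋈ b` of `A ⋈ B_p`. -/
theorem theorem3p3 {K : Type*} {A : Type*} {B : Type*} [Field K]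
    [AddCommGroup A] [Module K A] [Nontrivial A] [AddCommGroup B] [Module K B] [Nontrivial B]
    (𝒜 : MHA.RegularMHA K A) (ℬ : MHA.RegularMHA K B) (P : MHA.Pairing 𝒜 ℬ) :
    ∃ (T : ℬ.AutPair → (B ⊗[K] A →ₗ[K] A ⊗[K] B))
      (X : ℬ.AutPair → MHA.NUAlgebra K (A ⊗[K] B))
      (D : MHA.RegularMHA K (ℬ.AutPair →₀ A ⊗[K] B)),
      -- the product of `A ⋈ B_p` is `(a ⋈ b)(a' ⋈ b') = a T(b ⊗ a') b'`
      (∀ p T', P.IsTwist p T' ↔ T' = T p) ∧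
      (∀ p a b a' b', (X p).mul (a ⊗ₜ b) (a' ⊗ₜ b')
        = TensorProduct.map (𝒜.mul a) (ℬ.mul.flip b') (T p (b ⊗ₜ a'))) ∧
      (∀ p, (X p).Nondegenerate) ∧
      -- the product of `D(A, B)` is the one of the direct sum of the algebras `A ⋈ B_p`
      (∀ p x y, D.mul (Finsupp.single p x) (Finsupp.single p y)
        = Finsupp.single p ((X p).mul x y)) ∧
      (∀ p q x y, p ≠ q → D.mul (Finsupp.single p x) (Finsupp.single q y) = 0) ∧
      -- `D(A, B)` is cograded with components `A ⋈ B_p`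
      D.IsCograded (fun p : ℬ.AutPair =>
        LinearMap.range (Finsupp.lsingle p : A ⊗[K] B →ₗ[K] ℬ.AutPair →₀ A ⊗[K] B)) ∧
      -- the comultiplication: its `(p, q)` component on `A ⋈ B_(p * q)`, for `p = (α, β)` and
      -- `q = (γ, δ)`, is `Δ^cop(a) (γ ⊗ γ⁻¹βγ)Δ(b)`, and its other components vanish
      (∀ (p q : ℬ.AutPair) (a : A) (b : B), ∃ U W : ((X p).tensor (X q)).M,
        MHA.IsImageA (𝒜.flip (𝒜.comul a)) U ∧
        MHA.IsImageB (ℬ.twistedComul q.fst (q.fst⁻¹ * p.snd * q.fst) b) W ∧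
        MHA.IsComponent (D.comul (Finsupp.single (p * q) (a ⊗ₜ b))) p q (U * W)) ∧
      (∀ (r p q : ℬ.AutPair) (x : A ⊗[K] B), r ≠ p * q →
        MHA.IsComponent (D.comul (Finsupp.single r x)) p q (0 : ((X p).tensor (X q)).M)) ∧
      -- the counit
      D.IsCounit D.counit ∧
      (∀ a b, D.counit (Finsupp.single 1 (a ⊗ₜ b)) = 𝒜.counit a * ℬ.counit b) ∧
      (∀ (p : ℬ.AutPair) (x : A ⊗[K] B), p ≠ 1 → D.counit (Finsupp.single p x) = 0) ∧
      -- the antipode: `S_(α,β)(a ⋈ b) = T(αβS(b) ⊗ S⁻¹(a))` in `A ⋈ B_(α,β)⁻¹`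
      D.IsAntipode D.antipode ∧
      (∀ (p : ℬ.AutPair) (a : A) (b : B), D.antipode (Finsupp.single p (a ⊗ₜ b))
        = Finsupp.single p⁻¹ (T p⁻¹
            (p.fst.1 (p.snd.1 (ℬ.antipode b)) ⊗ₜ 𝒜.antipode.symm a))) := by
  refine ⟨fun p => (P.component p).T.toLinearMap, fun p => (P.component p).algebra, P.double,
    P.isTwist_iff, fun p a b a' b' => (P.component p).mul_tmul_tmul a a' b b',
    P.nondegenerate_component, MHA.glueAlgebra_mul_single _,
    fun p q x y h => MHA.glueAlgebra_mul_single_ne _ h x y, P.double_isCograded,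
    fun p q a b => ⟨(P.component p).multA (P.component q) (𝒜.flip (𝒜.comul a)),
      (P.component p).multB (P.component q) q.fst.2.1
        (MHA.RegularMHA.AutPair.conjSnd p q).2.1 (ℬ.comul b),
      MHA.TwistMap.isImageA_multA _ _ _, MHA.TwistMap.isImageB_multB _ _ _ _ _, ?_⟩,
    fun r p q x h => MHA.isComponent_glueComul_ne P.doubleComul h x,
    P.double.isCounit_counit, fun a b => ?_, fun p x h => ?_, P.double.isAntipode_antipode,
    fun p a b => ?_⟩
  · have h := MHA.isComponent_glueComul P.doubleComul p q (a ⊗ₜ b)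
    rw [MHA.Pairing.doubleComul, MHA.TwistMap.comulMap_tmul] at h
    exact h
  · rw [P.double_counit]
    simp
  · rw [P.double_counit]
    simp [Finsupp.single_eq_of_ne (Ne.symm h)]
  · rw [P.double_antipode]
    simp [P.doubleAntipode_tmul]
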